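/- **Setting.** Let $V=\mathbb C^{N}$ with its fixed basis and let $P$ be the permutation operator of $V\otimes V$. For $X\in\operatorname{End}(V^{\otimes2})$ let $X_m$ be $X$ acting on the factors $m,m+1$ of $V^{\otimes n}$. An *R-matrix* is an invertible $R$ with $R_1R_2R_1=R_2R_1R_2$; it defines representations $\rho_R:\mathbb C\mathcal B_n\to\operatorname{End}(V^{\otimes n})$, $\sigma_i\mapsto R_i$, of the braid groups $\mathcal B_n$. An operator $X$ is *skew invertible* if there is $\Psi_X$ with $\operatorname{Tr}_{(2)}X_{12}(\Psi_X)_{23}=\operatorname{Tr}_{(2)}(\Psi_X)_{12}X_{23}=P_{13}$; put $C_X=\operatorname{Tr}_{(1)}\Psi_X$, $D_X=\operatorname{Tr}_{(2)}\Psi_X$; $X$ is *strict skew invertible* if moreover $C_X$ or $D_X$ is invertible. A pair $\{R,F\}$ is *compatible* if $R_1F_2F_1=F_2F_1R_2$ and $R_2F_1F_2=F_1F_2R_1$. Let $\{R,F\}$ be a compatible pair of strict skew invertible R-matrices. The *quantum matrix algebra* $\mathcal M(R,F)$ is the unital associative $\mathbb C$-algebra generated by the entries of an $N\times N$ matrix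 $M=\|M_a^b\|$ subject to $R_1M_{\overline1}M_{\overline2}=M_{\overline1}M_{\overline2}R_1$, where $M_{\overline1}=M_1$ and $M_{\overline{i+1}}=F_iM_{\overline i}F_i^{-1}$. For $\alpha\in\mathbb C\mathcal B_n$, $n\ge1$, put $$ch(\alpha)=\operatorname{Tr}_{(1,\dots,n)}\bigl((D_R)_1\cdots(D_R)_n\,M_{\overline1}\cdots M_{\overline n}\,\rho_R(\alpha)\bigr).$$ The *characteristic subalgebra* $\mathcal C(R,F)\subset\mathcal M(R,F)$ is the linear span of $1$ and all $ch(\alpha)$, $\alpha\in\mathbb C\mathcal B_n$, $n\ge1$. Let $q\in\mathbb C\setminus\{0,\pm1\}$ and $\mu\in\mathbb C\setminus\{0,q,-q^{-1}\}$, and put $i_q=\frac{q^i-q^{-i}}{q-q^{-1}}$, $\eta=\frac{(q-\mu)(q^{-1}+\mu)}{\mu(q-q^{-1})}$. The R-matrix $R$ is of *BMW type* (with parameters $q,\mu$) if its minimal polynomial is $(x-q)(x+q^{-1})(x-\mu)$ and $K=\frac{(qI-R)(q^{-1}I+R)}{\mu(q-q^{-1})}$ satisfies $K_2K_1=R_1^{\pm1}R_2^{\pm1}K_1$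 (both signs) and $K_1K_2K_1=K_1$. In $\mathbb C\mathcal B_n$ put $\kappa_i=\frac{(q-\sigma_i)(q^{-1}+\sigma_i)}{\mu(q-q^{-1})}$ and, for $\varepsilon=\pm1$ and $\alpha_\varepsilon=-\varepsilon q^{-\varepsilon}\mu^{-1}$, $$\sigma_i^{\varepsilon}(x)=1+\tfrac{x-1}{q-q^{-1}}\sigma_i+\tfrac{x-1}{\alpha_\varepsilon x+1}\kappa_i .$$ Put $a^{(1)}=s^{(1)}=1$ and, whenever the coefficients are defined, $$a^{(i+1)}=\tfrac{q^i}{(i+1)_q}\,a^{(i)}\sigma_i^{-}(q^{-2i})a^{(i)},\qquad s^{(i+1)}=\tfrac{q^{-i}}{(i+1)_q}\,s^{(i)}\sigma_i^{+}(q^{2i})s^{(i)} .$$ In $\mathcal C(R,F)$ put $g=\eta^{-1}ch(\kappa_1)$ with $\kappa_1\in\mathbb C\mathcal B_2$, $a_0=s_0=1$, and $a_i=ch(a^{(i)})$, $s_i=ch(s^{(i)})$ for $i\ge1$. For $k\ge2$, a skew invertible R-matrix $R$ of BMW type with parameters $q,\mu$ is said to have height $k$ if $i_q\ne0$ for $2\le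 i\le k$ and $\mu\neq-q^{1-2i}$ for $1\le i\le k$, if $\operatorname{rk}\rho_R(a^{(i)})\neq0$ for $2\le i\le k$, and if $\rho_R\bigl(a^{(k)\uparrow1}\sigma_1^-(q^{-2k})a^{(k)\uparrow1}\bigr)=0$ on $V^{\otimes(k+1)}$, where $\uparrow1$ is the embedding $\sigma_j\mapsto\sigma_{j+1}$. It is of type $Sp(2k)$ if it has height $k$ and $\mu=-q^{-1-2k}$, and of type $O(k)$ if it has height $k$, $\mu=q^{1-k}$ and $\operatorname{rk}\rho_R(a^{(k)})=1$. **Proposition.** Let $\{R,F\}$ be a compatible pair of strict skew invertible R-matrices, where $R$ is of BMW type with parameters $q,\mu$. 1. If $j_q\ne0$ and $\mu\ne-q^{-2j+3}$ for all $j\ge2$, then the subspace $\mathcal C(R,F)$ is the unital subalgebra of $\mathcal M(R,F)$ generated by $\{g\}\cup\{a_i\}_{i\ge0}$. 2. If $j_q\ne0$ and $\mu\ne q^{2j-3}$ for all $j\ge2$, then $\mathcal C(R,F)$ is the unital subalgebra of $\mathcal M(R,F)$ generated by $\{g\}\cup\{s_i\}_{i\ge0}$. 3. If $R$ is of type $Sp(2k)$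 or of type $O(k)$ for some $k\ge2$, with these parameters $q,\mu$, then $\mathcal C(R,F)$ is the unital subalgebra of $\mathcal M(R,F)$ generated by $\{g\}\cup\{a_i\}_{i=0}^{k}$. -/

import Mathlib

/-!
Quantum matrix algebras of Birman-Murakami-Wenzl type.

Conventions.  `V = ℂ^N` with its fixed basis.  An element of `End (V^{⊗ n}) ⊗ W` is a matrix with
entries in `W` whose rows and columns are multi-indices `Fin n → Fin N`; in particular operators on
`V ⊗ V` are matrices over `Fin 2 → Fin N`, where `![a, b]` is the index of the basis vector
`v_a ⊗ v_b`.  Tensor factors, and the Artin generators of the braid groups, are numbered from `0`.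
-/

namespace QMat

noncomputable section

/-- `End (V^{⊗ n}) ⊗ W` for `V = ℂ^N`, as matrices. -/
abbrev TMat (N n : ℕ) (W : Type*) := Matrix (Fin n → Fin N) (Fin n → Fin N) W

/-- The operator on `V^{⊗ n}` that acts as `X` on the tensor factors `f 0, …, f (k - 1)` and as the
identity on all the other ones (used for injective `f`). -/
def emb {N k n : ℕ} {W : Type*} [Zero W] (f : Fin k → Fin n) (X : TMat N k W) : TMat N n W :=
  Matrix.of fun i j => if ∀ l, (∀ a, f a ≠ l) → i l = j l then X (i ∘ f) (j ∘ f) else 0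

/-- For `X` on `V ⊗ V`, the operator on `V^{⊗ n}` acting as `X` on the neighbouring tensor factors
`m` and `m + 1` (numbered from `0`); it is only used when `m + 1 < n`. -/
def leg {N : ℕ} (n m : ℕ) (X : TMat N 2 ℂ) : TMat N n ℂ :=
  if h : m + 1 < n then emb ![⟨m, Nat.lt_of_succ_lt h⟩, ⟨m + 1, h⟩] X else 1

/-! ### Skew invertibility, R-matrices, compatible pairs -/

/-- `Ψ` is a skew inverse of `X`: `Tr₍₂₎ X₁₂ Ψ₂₃ = P₁₃ = Tr₍₂₎ Ψ₁₂ X₂₃`, where `P` is the permutation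
operator; written out in components. -/
def IsSkewInverse {N : ℕ} (X Ψ : TMat N 2 ℂ) : Prop :=
  ∀ a b c d : Fin N,
    (∑ x, ∑ y, X ![a, x] ![b, y] * Ψ ![y, c] ![x, d] = if a = d ∧ c = b then 1 else 0) ∧
    (∑ x, ∑ y, Ψ ![a, x] ![b, y] * X ![y, c] ![x, d] = if a = d ∧ c = b then 1 else 0)

/-- `X` is skew invertible. -/
def IsSkewInvertible {N : ℕ} (X : TMat N 2 ℂ) : Prop := ∃ Ψ, IsSkewInverse X Ψ

open Classical in
/-- The (unique) skew inverse of a skew invertible operator; `0` if there is none. -/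
def skewInverse {N : ℕ} (X : TMat N 2 ℂ) : TMat N 2 ℂ :=
  if h : IsSkewInvertible X then h.choose else 0

/-- `C_X = Tr₍₁₎ Ψ_X`. -/
def matC {N : ℕ} (X : TMat N 2 ℂ) : Matrix (Fin N) (Fin N) ℂ :=
  Matrix.of fun x y => ∑ a, skewInverse X ![a, x] ![a, y]

/-- `D_X = Tr₍₂₎ Ψ_X`. -/
def matD {N : ℕ} (X : TMat N 2 ℂ) : Matrix (Fin N) (Fin N) ℂ :=
  Matrix.of fun x y => ∑ a, skewInverse X ![x, a] ![y, a]

/-- `X` is strict skew invertible. -/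
def IsStrictSkewInvertible {N : ℕ} (X : TMat N 2 ℂ) : Prop :=
  IsSkewInvertible X ∧ (IsUnit (matC X) ∨ IsUnit (matD X))

/-- `X` is an R-matrix: an invertible solution of the Yang-Baxter equation. -/
structure IsRMatrix {N : ℕ} (X : TMat N 2 ℂ) : Prop where
  isUnit : IsUnit X
  yangBaxter : leg 3 0 X * leg 3 1 X * leg 3 0 X = leg 3 1 X * leg 3 0 X * leg 3 1 X

/-- `{R, F}` is a compatible pair: the twist relations hold. -/
def IsCompatible {N : ℕ} (R F : TMat N 2 ℂ) : Prop :=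
  leg 3 0 R * leg 3 1 F * leg 3 0 F = leg 3 1 F * leg 3 0 F * leg 3 1 R ∧
  leg 3 1 R * leg 3 0 F * leg 3 1 F = leg 3 0 F * leg 3 1 F * leg 3 0 R

/-! ### Braid groups -/

/-- The relations of the Artin presentation of the braid group on `n` strands. -/
def braidRels (n : ℕ) : Set (FreeGroup (Fin (n - 1))) :=
  {r | (∃ i j : Fin (n - 1), (i : ℕ) + 1 = j ∧
          r = FreeGroup.of i * FreeGroup.of j * FreeGroup.of i *
            (FreeGroup.of j * FreeGroup.of i * FreeGroup.of j)⁻¹) ∨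
       (∃ i j : Fin (n - 1), (i : ℕ) + 1 < j ∧
          r = FreeGroup.of i * FreeGroup.of j * (FreeGroup.of j * FreeGroup.of i)⁻¹)}

/-- The braid group on `n` strands. -/
abbrev BraidGroup (n : ℕ) : Type := PresentedGroup (braidRels n)

/-- The group algebra of the braid group on `n` strands. -/
abbrev BraidAlg (n : ℕ) : Type := MonoidAlgebra ℂ (BraidGroup n)

/-- The Artin generators, as elements of the group algebra; only used for `i + 1 < n`. -/
def sigma (n i : ℕ) : BraidAlg n :=
  if h : i < n - 1 then MonoidAlgebra.of ℂ (BraidGroup n) (PresentedGroup.of ⟨i, h⟩) else 1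

/-! ### Helper facts: the representation of the braid group defined by an R-matrix -/

section Helpers

theorem emb_one {N k n : ℕ} {f : Fin k → Fin n} :
    emb f (1 : TMat N k ℂ) = 1 := by
  ext i j
  simp only [emb, Matrix.of_apply, Matrix.one_apply]
  by_cases hij : i = j
  · simp [hij]
  · rw [if_neg hij]
    by_cases h : ∀ l, (∀ a, f a ≠ l) → i l = j l
    · rw [if_pos h, if_neg]
      intro h2
      apply hij
      funext l
      by_cases hl : ∀ a, f a ≠ l
      · exact h l hl
      · push Not at hl
        obtain ⟨a, rfl⟩ := hl
        exact congrFun h2 a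
    · rw [if_neg h]

theorem emb_mul {N k n : ℕ} {f : Fin k → Fin n} (hf : Function.Injective f) (X Y : TMat N k ℂ) :
    emb f (X * Y) = emb f X * emb f Y := by
  ext i j
  simp only [emb, Matrix.of_apply, Matrix.mul_apply]
  have hcomp : ∀ u : Fin k → Fin N, Function.extend f u i ∘ f = u := fun u =>
    funext fun a => hf.extend_apply u i a
  have hoff : ∀ (u : Fin k → Fin N) (l : Fin n), (∀ a, f a ≠ l) →
      Function.extend f u i l = i l := fun u l hl =>
    Function.extend_apply' u i l (by simpa using hl)
  symm
  split_ifs with h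
  · symm
    apply Fintype.sum_of_injective (fun u : Fin k → Fin N => Function.extend f u i)
    · intro u v huv
      have := congrArg (· ∘ f) huv
      simpa [hcomp] using this
    · intro w hw
      rw [if_neg, zero_mul]
      intro hiw
      apply hw
      refine ⟨w ∘ f, ?_⟩
      funext l
      by_cases hl : ∀ a, f a ≠ l
      · show Function.extend f (w ∘ f) i l = w l
        rw [hoff _ _ hl, hiw l hl]
      · push Not at hl
        obtain ⟨a, rfl⟩ := hl
        exact hf.extend_apply (w ∘ f) i a
    · intro u
      have h1 : ∀ l, (∀ a, f a ≠ l) → i l = Function.extend f u i l := fun l hl =>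
        (hoff u l hl).symm
      have h2 : ∀ l, (∀ a, f a ≠ l) → Function.extend f u i l = j l := fun l hl =>
        (hoff u l hl).trans (h l hl)
      simp only [if_pos h1, if_pos h2, hcomp]
  · apply Finset.sum_eq_zero
    intro w _
    by_cases h1 : ∀ l, (∀ a, f a ≠ l) → i l = w l
    · rw [if_neg (c := ∀ l, (∀ a, f a ≠ l) → w l = j l), mul_zero]
      intro h2
      exact h fun l hl => (h1 l hl).trans (h2 l hl)
    · rw [if_neg h1, zero_mul]

theorem emb_emb {N k m n : ℕ} {f : Fin k → Fin m} {g : Fin m → Fin n}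
    (hg : Function.Injective g) (X : TMat N k ℂ) : emb g (emb f X) = emb (g ∘ f) X := by
  ext i j
  simp only [emb, Matrix.of_apply, Function.comp_assoc]
  by_cases h : ∀ l, (∀ a, (g ∘ f) a ≠ l) → i l = j l
  · have h1 : ∀ l, (∀ a, g a ≠ l) → i l = j l := fun l hl => h l fun a => hl (f a)
    have h2 : ∀ l, (∀ a, f a ≠ l) → (i ∘ g) l = (j ∘ g) l := fun l hl =>
      h (g l) fun a ha => hl a (hg ha)
    rw [if_pos h, if_pos h1, if_pos h2]
  · rw [if_neg h]
    by_cases h1 : ∀ l, (∀ a, g a ≠ l) → i l = j l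
    · rw [if_pos h1, if_neg]
      intro h2
      apply h
      intro l hl
      by_cases hl' : ∀ a, g a ≠ l
      · exact h1 l hl'
      · push Not at hl'
        obtain ⟨a, rfl⟩ := hl'
        exact h2 a fun b hb => hl b (congrArg g hb)
    · rw [if_neg h1]

theorem emb_mul_apply_of_disjoint {N k m n : ℕ} {f : Fin k → Fin n} {g : Fin m → Fin n}
    (hf : Function.Injective f) (hfg : ∀ a b, f a ≠ g b)
    (X : TMat N k ℂ) (Y : TMat N m ℂ) (i j : Fin n → Fin N) :
    (emb f X * emb g Y) i j =
      if ∀ l, (∀ a, f a ≠ l) → (∀ b, g b ≠ l) → i l = j l then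
        X (i ∘ f) (j ∘ f) * Y (i ∘ g) (j ∘ g) else 0 := by
  rw [Matrix.mul_apply, Finset.sum_eq_single (Function.extend f (j ∘ f) i)]
  · have hc : Function.extend f (j ∘ f) i ∘ f = j ∘ f :=
      funext fun a => hf.extend_apply (j ∘ f) i a
    have hoff : ∀ l, (∀ a, f a ≠ l) → Function.extend f (j ∘ f) i l = i l := fun l hl =>
      Function.extend_apply' _ i l (by simpa using hl)
    have hg : Function.extend f (j ∘ f) i ∘ g = i ∘ g :=
      funext fun b => hoff (g b) fun a => hfg a b
    simp only [emb, Matrix.of_apply, hc, hg]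
    rw [if_pos fun l hl => (hoff l hl).symm]
    by_cases h : ∀ l, (∀ a, f a ≠ l) → (∀ b, g b ≠ l) → i l = j l
    · rw [if_pos h, if_pos]
      intro l hl
      by_cases hl' : ∀ a, f a ≠ l
      · rw [hoff l hl', h l hl' hl]
      · push Not at hl'
        obtain ⟨a, rfl⟩ := hl'
        exact congrFun hc a
    · rw [if_neg h, if_neg, mul_zero]
      intro h2
      apply h
      intro l hl hl'
      rw [← h2 l hl', hoff l hl]
  · intro w _ hw
    simp only [emb, Matrix.of_apply]
    by_cases h1 : ∀ l, (∀ a, f a ≠ l) → i l = w l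
    · rw [if_neg (c := ∀ l, (∀ a, g a ≠ l) → w l = j l), mul_zero]
      intro h2
      apply hw
      funext l
      by_cases hl' : ∀ a, f a ≠ l
      · rw [Function.extend_apply' _ i l (by simpa using hl'), h1 l hl']
      · push Not at hl'
        obtain ⟨a, rfl⟩ := hl'
        rw [hf.extend_apply]
        exact h2 (f a) fun b hb => hfg a b hb.symm
    · rw [if_neg h1, zero_mul]
  · intro h
    exact absurd (Finset.mem_univ _) h

theorem emb_commute {N k m n : ℕ} {f : Fin k → Fin n} {g : Fin m → Fin n}
    (hf : Function.Injective f) (hg : Function.Injective g) (hfg : ∀ a b, f a ≠ g b)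
    (X : TMat N k ℂ) (Y : TMat N m ℂ) : emb f X * emb g Y = emb g Y * emb f X := by
  ext i j
  rw [emb_mul_apply_of_disjoint hf hfg, emb_mul_apply_of_disjoint hg fun b a => (hfg a b).symm]
  rw [mul_comm]
  congr 1
  exact propext ⟨fun h l h1 h2 => h l h2 h1, fun h l h1 h2 => h l h2 h1⟩

theorem pair_injective {n m : ℕ} (h : m + 1 < n) :
    Function.Injective (![⟨m, Nat.lt_of_succ_lt h⟩, ⟨m + 1, h⟩] : Fin 2 → Fin n) := by
  intro a b
  fin_cases a <;> fin_cases b <;> simp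

theorem triple_injective {n m : ℕ} (h : m + 2 < n) :
    Function.Injective (![⟨m, by omega⟩, ⟨m + 1, by omega⟩, ⟨m + 2, h⟩] : Fin 3 → Fin n) := by
  intro a b
  fin_cases a <;> fin_cases b <;> simp

theorem leg_one {N : ℕ} (n m : ℕ) : leg n m (1 : TMat N 2 ℂ) = 1 := by
  unfold leg
  split_ifs
  · exact emb_one
  · rfl

theorem leg_mul {N : ℕ} (n m : ℕ) (X Y : TMat N 2 ℂ) :
    leg n m (X * Y) = leg n m X * leg n m Y := by
  unfold leg
  split_ifs with h
  · exact emb_mul (pair_injective h) X Y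
  · simp

theorem leg_commute {N n m r : ℕ} (h : m + 1 < r) (X Y : TMat N 2 ℂ) :
    leg n m X * leg n r Y = leg n r Y * leg n m X := by
  unfold leg
  split_ifs with h1 h2
  · apply emb_commute (pair_injective h1) (pair_injective h2)
    intro a b
    fin_cases a <;> fin_cases b <;> simp <;> omega
  all_goals simp

theorem leg_braid {N n m : ℕ} (h : m + 2 < n) {X : TMat N 2 ℂ} (hX : IsRMatrix X) :
    leg n m X * leg n (m + 1) X * leg n m X = leg n (m + 1) X * leg n m X * leg n (m + 1) X := by
  have h0 : leg n m X = emb ![⟨m, by omega⟩, ⟨m + 1, by omega⟩, ⟨m + 2, h⟩] (leg 3 0 X) := by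
    unfold leg
    rw [dif_pos (by omega), dif_pos (by omega), emb_emb (triple_injective h)]
    congr 1
    funext a
    fin_cases a <;> rfl
  have h1 : leg n (m + 1) X =
      emb ![⟨m, by omega⟩, ⟨m + 1, by omega⟩, ⟨m + 2, h⟩] (leg 3 1 X) := by
    unfold leg
    rw [dif_pos (by omega), dif_pos (by omega), emb_emb (triple_injective h)]
    congr 1
    funext a
    fin_cases a <;> rfl
  rw [h0, h1]
  simp only [← emb_mul (triple_injective h), hX.yangBaxter]

end Helpers

/-- The automorphism of `V^{⊗ n}` by which an R-matrix acts on the tensor factors `m`, `m + 1`. -/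
def legUnit {N : ℕ} {R : TMat N 2 ℂ} (hR : IsRMatrix R) (n m : ℕ) : (TMat N n ℂ)ˣ :=
  Units.map (⟨⟨leg n m, leg_one n m⟩, leg_mul n m⟩ : TMat N 2 ℂ →* TMat N n ℂ) hR.isUnit.unit

theorem legUnit_val {N : ℕ} {R : TMat N 2 ℂ} (hR : IsRMatrix R) (n m : ℕ) :
    (legUnit hR n m : TMat N n ℂ) = leg n m R := rfl

/-- The representation of the braid group on `V^{⊗ n}` defined by an R-matrix. -/
def braidRep {N : ℕ} {R : TMat N 2 ℂ} (hR : IsRMatrix R) (n : ℕ) :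
    BraidGroup n →* (TMat N n ℂ)ˣ :=
  PresentedGroup.toGroup (f := fun i : Fin (n - 1) => legUnit hR n i) (by
    rintro r (⟨i, j, hij, rfl⟩ | ⟨i, j, hij, rfl⟩)
    · simp only [map_mul, map_inv, FreeGroup.lift_apply_of, mul_inv_eq_one]
      ext1
      have hj := j.isLt
      simp only [Units.val_mul, legUnit_val, ← hij]
      exact leg_braid (by omega) hR
    · simp only [map_mul, map_inv, FreeGroup.lift_apply_of, mul_inv_eq_one]
      ext1
      simp only [Units.val_mul, legUnit_val]
      exact leg_commute hij R R)

/-- The representation `ρ_R` of the group algebra of the braid group on `V^{⊗ n}`. -/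
def rho {N : ℕ} {R : TMat N 2 ℂ} (hR : IsRMatrix R) (n : ℕ) : BraidAlg n →ₐ[ℂ] TMat N n ℂ :=
  MonoidAlgebra.lift ℂ (TMat N n ℂ) (BraidGroup n) ((Units.coeHom _).comp (braidRep hR n))

/-! ### Elements of the BMW algebras

The BMW algebra is a quotient of the group algebra of the braid group.  The elements `κ`, the
baxterized generators, the (anti)symmetrizers and the contractor are written below as explicit
polynomials in the generators, and so make sense in any algebra; evaluated at the Artin generators in
`ℂ 𝓑ₙ` they are representatives of the corresponding elements of the BMW algebra. -/

/-- The `q`-number `i_q = (q^i - q^{-i}) / (q - q^{-1})`. -/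
def qNum (q : ℂ) (i : ℕ) : ℂ := (q ^ i - q⁻¹ ^ i) / (q - q⁻¹)

/-- `κ = (q - σ)(q⁻¹ + σ) / (μ (q - q⁻¹))`. -/
def kappa {A : Type*} [Ring A] [Algebra ℂ A] (q μ : ℂ) (s : A) : A :=
  (μ * (q - q⁻¹))⁻¹ • ((q • (1 : A) - s) * (q⁻¹ • (1 : A) + s))

/-- `η = (q - μ)(q⁻¹ + μ) / (μ (q - q⁻¹))`, so that `κ² = η κ`. -/
def eta (q μ : ℂ) : ℂ := (q - μ) * (q⁻¹ + μ) / (μ * (q - q⁻¹))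

/-- The baxterized element `σ^ε(x) = 1 + (x - 1)/(q - q⁻¹) σ + (x - 1)/(α x + 1) κ` with
`α = - ε q^{-ε} μ⁻¹`, for `ε = ± 1`. -/
def baxterized {A : Type*} [Ring A] [Algebra ℂ A] (q μ : ℂ) (ε : ℤ) (x : ℂ) (s : A) : A :=
  1 + ((x - 1) / (q - q⁻¹)) • s +
    ((x - 1) / (-(ε : ℂ) * q ^ (-ε) * μ⁻¹ * x + 1)) • kappa q μ s

/-- The antisymmetrizers `a^{(i)}` built from generators `s 0, s 1, …`:
`a^{(1)} = 1`, `a^{(i+1)} = q^i / (i+1)_q · a^{(i)} σ_i^-(q^{-2i}) a^{(i)}`.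
(The value at `i = 0` plays no role.) -/
def antisymmetrizer {A : Type*} [Ring A] [Algebra ℂ A] (q μ : ℂ) (s : ℕ → A) : ℕ → A
  | 0 => 1
  | 1 => 1
  | i + 2 => (q ^ (i + 1) / qNum q (i + 2)) •
      (antisymmetrizer q μ s (i + 1) * baxterized q μ (-1) (q ^ (-2 * ((i : ℤ) + 1))) (s i) *
        antisymmetrizer q μ s (i + 1))

/-- The symmetrizers `s^{(i)}` built from generators `s 0, s 1, …`:
`s^{(1)} = 1`, `s^{(i+1)} = q^{-i} / (i+1)_q · s^{(i)} σ_i^+(q^{2i}) s^{(i)}`.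
(The value at `i = 0` plays no role.) -/
def symmetrizer {A : Type*} [Ring A] [Algebra ℂ A] (q μ : ℂ) (s : ℕ → A) : ℕ → A
  | 0 => 1
  | 1 => 1
  | i + 2 => (q⁻¹ ^ (i + 1) / qNum q (i + 2)) •
      (symmetrizer q μ s (i + 1) * baxterized q μ 1 (q ^ (2 * ((i : ℤ) + 1))) (s i) *
        symmetrizer q μ s (i + 1))

/-- The second order contractor `c^{(2)} = η⁻¹ κ₁`. -/
def contractor2 (q μ : ℂ) : BraidAlg 2 := (eta q μ)⁻¹ • kappa q μ (sigma 2 0)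

/-! ### Types of R-matrices -/

open Polynomial in
/-- `R` is of BMW type with parameters `q`, `μ`.  (`K₁`, `K₂` are `leg 3 0 K`, `leg 3 1 K`.) -/
structure IsBMWType {N : ℕ} (R : TMat N 2 ℂ) (q μ : ℂ) : Prop where
  q_ne_zero : q ≠ 0
  q_ne_one : q ≠ 1
  q_ne_neg_one : q ≠ -1
  mu_ne_zero : μ ≠ 0
  mu_ne_q : μ ≠ q
  mu_ne_neg_inv_q : μ ≠ -q⁻¹
  minpoly_eq : minpoly ℂ R = (X - C q) * (X + C q⁻¹) * (X - C μ)
  KK : leg 3 1 (kappa q μ R) * leg 3 0 (kappa q μ R) =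
    leg 3 0 R * leg 3 1 R * leg 3 0 (kappa q μ R)
  KK_inv : leg 3 1 (kappa q μ R) * leg 3 0 (kappa q μ R) =
    leg 3 0 R⁻¹ * leg 3 1 R⁻¹ * leg 3 0 (kappa q μ R)
  KKK : leg 3 0 (kappa q μ R) * leg 3 1 (kappa q μ R) * leg 3 0 (kappa q μ R) =
    leg 3 0 (kappa q μ R)

/-- The common part of the definitions of the symplectic and orthogonal types: `a^{(i)}` is well
defined and `ρ_R(a^{(i)})` has nonzero rank for `i = 2, …, k`, while the unnormalized antisymmetrizer
`a^{(k)↑1} σ₁^-(q^{-2k}) a^{(k)↑1}` of order `k + 1` (well defined as well) is mapped to zero. -/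
structure HasHeight {N : ℕ} {R : TMat N 2 ℂ} (hR : IsRMatrix R) (q μ : ℂ) (k : ℕ) : Prop where
  two_le : 2 ≤ k
  qNum_ne_zero : ∀ i, 2 ≤ i → i ≤ k → qNum q i ≠ 0
  mu_ne : ∀ i : ℕ, 1 ≤ i → i ≤ k → μ ≠ -q ^ (-2 * (i : ℤ) + 1)
  rank_ne_zero : ∀ i, 2 ≤ i → i ≤ k →
    (rho hR i (antisymmetrizer q μ (sigma i) i)).rank ≠ 0
  eq_zero : rho hR (k + 1)
    (antisymmetrizer q μ (fun j => sigma (k + 1) (j + 1)) k *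
      baxterized q μ (-1) (q ^ (-2 * (k : ℤ))) (sigma (k + 1) 0) *
      antisymmetrizer q μ (fun j => sigma (k + 1) (j + 1)) k) = 0

/-- `R` is an `Sp(2k)`-type R-matrix with parameters `q`, `μ`. -/
structure IsSpType {N : ℕ} {R : TMat N 2 ℂ} (hR : IsRMatrix R) (q μ : ℂ) (k : ℕ) : Prop where
  skewInvertible : IsSkewInvertible R
  bmw : IsBMWType R q μ
  height : HasHeight hR q μ k
  mu_eq : μ = -q ^ (-1 - 2 * (k : ℤ))

/-- `R` is an `O(k)`-type R-matrix with parameters `q`, `μ`. -/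
structure IsOType {N : ℕ} {R : TMat N 2 ℂ} (hR : IsRMatrix R) (q μ : ℂ) (k : ℕ) : Prop where
  skewInvertible : IsSkewInvertible R
  bmw : IsBMWType R q μ
  height : HasHeight hR q μ k
  mu_eq : μ = q ^ (1 - (k : ℤ))
  rank_eq_one : (rho hR k (antisymmetrizer q μ (sigma k) k)).rank = 1

/-! ### Quantum matrix algebras -/

/-- The matrix of an operator on `V^{⊗ n}`, with its entries regarded as scalars of the algebra `W`. -/
abbrev scal {N n : ℕ} (W : Type*) [Ring W] [Algebra ℂ W] (X : TMat N n ℂ) : TMat N n W :=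
  X.map (algebraMap ℂ W)

/-- The copies of a matrix `M`, acting on `V^{⊗ n}`: `M_{\overline 1} = M₁` and
`M_{\overline{i+1}} = F_i M_{\overline i} F_i⁻¹`.  The copy `M_{\overline{i+1}}` is
`copy F M n i`; it is only used for `i < n`. -/
def copy {N : ℕ} {W : Type*} [Ring W] [Algebra ℂ W] (F : TMat N 2 ℂ) (M : Matrix (Fin N) (Fin N) W)
    (n : ℕ) : ℕ → TMat N n W
  | 0 => if h : 0 < n then emb ![⟨0, h⟩] (Matrix.of fun i j : Fin 1 → Fin N => M (i 0) (j 0)) else 1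
  | i + 1 => scal W (leg n i F) * copy F M n i * scal W (leg n i F⁻¹)

/-- The matrix of free generators `M_a^b`. -/
def freeMatrix (N : ℕ) : Matrix (Fin N) (Fin N) (FreeAlgebra ℂ (Fin N × Fin N)) :=
  Matrix.of fun a b => FreeAlgebra.ι ℂ (a, b)

/-- The entries of the matrix relation `R₁ M_{\overline 1} M_{\overline 2} =
M_{\overline 1} M_{\overline 2} R₁`. -/
inductive QMRel {N : ℕ} (R F : TMat N 2 ℂ) :
    FreeAlgebra ℂ (Fin N × Fin N) → FreeAlgebra ℂ (Fin N × Fin N) → Prop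
  | entry (i j : Fin 2 → Fin N) : QMRel R F
      ((scal (FreeAlgebra ℂ (Fin N × Fin N)) (leg 2 0 R) * copy F (freeMatrix N) 2 0 *
        copy F (freeMatrix N) 2 1) i j)
      ((copy F (freeMatrix N) 2 0 * copy F (freeMatrix N) 2 1 *
        scal (FreeAlgebra ℂ (Fin N × Fin N)) (leg 2 0 R)) i j)

/-- The quantum matrix algebra `M(R, F)`: the free associative algebra on the `N²` symbols `M_a^b`
modulo the two-sided ideal generated by the entries of the matrix relation. -/
abbrev QMAlgebra {N : ℕ} (R F : TMat N 2 ℂ) : Type := RingQuot (QMRel R F)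

/-- The matrix `M` of generators of the quantum matrix algebra. -/
def genMatrix {N : ℕ} (R F : TMat N 2 ℂ) : Matrix (Fin N) (Fin N) (QMAlgebra R F) :=
  Matrix.of fun a b => RingQuot.mkAlgHom ℂ (QMRel R F) (FreeAlgebra.ι ℂ (a, b))

/-- The R-trace over all tensor factors: the trace of `D_R ⊗ ⋯ ⊗ D_R · Y`. -/
def rTrace {N n : ℕ} {W : Type*} [Ring W] [Algebra ℂ W] (R : TMat N 2 ℂ) (Y : TMat N n W) : W :=
  ∑ i, ∑ j, (∏ l, matD R (i l) (j l)) • Y j i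

/-- `ch(α) = Tr_{R(1, …, n)} (M_{\overline 1} ⋯ M_{\overline n} ρ_R(α))` for `α ∈ ℂ 𝓑ₙ`. -/
def ch {N : ℕ} {R : TMat N 2 ℂ} (hR : IsRMatrix R) (F : TMat N 2 ℂ) (n : ℕ) (α : BraidAlg n) :
    QMAlgebra R F :=
  rTrace R (((List.range n).map (copy F (genMatrix R F) n)).prod *
    scal (QMAlgebra R F) (rho hR n α))

/-- The characteristic subalgebra `C(R, F)`: the linear span of the unity and of all elements
`ch(α)`, `α ∈ ℂ 𝓑ₙ`, `n ≥ 1`. -/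
def charSubspace {N : ℕ} {R : TMat N 2 ℂ} (hR : IsRMatrix R) (F : TMat N 2 ℂ) :
    Submodule ℂ (QMAlgebra R F) :=
  Submodule.span ℂ ({1} ∪ {x | ∃ n : ℕ, 1 ≤ n ∧ ∃ α : BraidAlg n, x = ch hR F n α})

/-- The 2-contraction `g = ch(c^{(2)})`. -/
def contraction {N : ℕ} {R : TMat N 2 ℂ} (hR : IsRMatrix R) (F : TMat N 2 ℂ) (q μ : ℂ) :
    QMAlgebra R F := ch hR F 2 (contractor2 q μ)

/-- `a_0 = 1` and `a_i = ch(a^{(i)})` for `i ≥ 1`. -/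
def elemA {N : ℕ} {R : TMat N 2 ℂ} (hR : IsRMatrix R) (F : TMat N 2 ℂ) (q μ : ℂ) :
    ℕ → QMAlgebra R F
  | 0 => 1
  | i + 1 => ch hR F (i + 1) (antisymmetrizer q μ (sigma (i + 1)) (i + 1))

/-- `s_0 = 1` and `s_i = ch(s^{(i)})` for `i ≥ 1`. -/
def elemS {N : ℕ} {R : TMat N 2 ℂ} (hR : IsRMatrix R) (F : TMat N 2 ℂ) (q μ : ℂ) :
    ℕ → QMAlgebra R F
  | 0 => 1
  | i + 1 => ch hR F (i + 1) (symmetrizer q μ (sigma (i + 1)) (i + 1))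

end

end QMat

/-!
The linear map `ch` behaves like a Markov-type trace on the tower of braid groups, and the theorem
is a statement about all such traces on Birman-Murakami-Wenzl algebras.

*The map `ch` is multiplicative:* `ch(α) ch(β) = ch(α β^{↑n})` for `α` on `n` strands. By
compatibility, conjugation with products of `F` moves operators on `m` factors to the last `m` of
`n + m` factors (`exists_shift`), and the partial R-trace commutes with it
(`partialTrace_conj_leg`); the latter comes down to the identity `sum_conj_matD` for the skew
inverse of `R`. This gives `chOp_mul_chOp`.

*The map `ch` is cyclic* (`chOp_mul_comm`), since `R_i` commutes both with `D_R ⊗ ⋯ ⊗ D_R`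
(`commute_tensorD_two`) and with the product of the copies of the matrix of generators
(`commute_leg_copies`).

Let `T` be the subalgebra of the quantum matrix algebra generated by the elements in question, and
argue by induction on the number of strands. Modulo `T`, the map `ch` on `n + 1` strands is
cyclic, and, by multiplicativity and induction, it vanishes on products of two elements that act
on complementary sets of strands: it is a split trace (`IsSplitTrace`). It also vanishes at `κ₁`
for two strands. As in the standard construction of Markov traces, an element of a BMW algebra can
be written with at most one occurrence of the last `r` or `κ` in each term
(`IsBMWGens.gen_le_bmwSpan`). So a split trace vanishes on the ideal generated by the `κ`'s
(`IsSplitTrace.map_mul_kappa`), and it is determined by its value on the product `r₁ r₂ ⋯ r_n` of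
all generators (`IsSplitTrace.map_mem_span`). It remains to see that this value is zero.

Dividing by the radical of the trace form makes the `κ`'s zero, and leaves a split trace on a
Hecke algebra (`IsSplitTrace.exists_hecke_quotient`). There the antisymmetrizers are idempotents
on which the generators act by `-q⁻¹` (`IsHeckeGens.mul_heckeAnti`), and their recursion shows
that the trace of `a^{(n+1)}` is a nonzero multiple of the trace of `r₁ r₂ ⋯ r_n`
(`IsSplitTrace.exists_map_heckeAnti_mul_word`). Thus the latter vanishes once `a_{n+1}` lies in
`T`. Symmetrizers are antisymmetrizers for `-q⁻¹` in place of `q`, and the same argument applies.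
For an R-matrix of height `k` and `n ≥ k`, the vanishing of the next antisymmetrizer forces the
trace of `r₁ r₂ ⋯ r_n` to be zero (`IsSplitTrace.map_word_eq_zero`), so that the `a_i` with
`i ≤ k` suffice.
-/

namespace QMat

noncomputable section

/-! ### Operators acting on some of the tensor factors -/

section Embedding

variable {N k m n : ℕ} {W : Type*}

theorem extend_comp_self {f : Fin k → Fin n} (hf : Function.Injective f) (u : Fin k → Fin N)
    (i : Fin n → Fin N) : Function.extend f u i ∘ f = u :=
  funext fun a => hf.extend_apply u i a

theorem extend_apply_of_forall_ne {f : Fin k → Fin n} (u : Fin k → Fin N) (i : Fin n → Fin N)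
    {l : Fin n} (hl : ∀ a, f a ≠ l) : Function.extend f u i l = i l :=
  Function.extend_apply' u i l (by simpa using hl)

theorem extend_eq_of_agree {f : Fin k → Fin n} (hf : Function.Injective f) {i w : Fin n → Fin N}
    (h : ∀ l, (∀ a, f a ≠ l) → i l = w l) : Function.extend f (w ∘ f) i = w := by
  funext l
  by_cases hl : ∀ a, f a ≠ l
  · rw [extend_apply_of_forall_ne _ _ hl, h l hl]
  · push Not at hl
    obtain ⟨a, rfl⟩ := hl
    exact hf.extend_apply (w ∘ f) i a

theorem extend_injective {f : Fin k → Fin n} (hf : Function.Injective f) (i : Fin n → Fin N) :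
    Function.Injective fun u : Fin k → Fin N => Function.extend f u i := by
  intro u v huv
  have := congrArg (· ∘ f) huv
  simpa [extend_comp_self hf] using this

theorem emb_mul_apply [Semiring W] {f : Fin k → Fin n} (hf : Function.Injective f)
    (X : TMat N k W) (Y : TMat N n W) (i j : Fin n → Fin N) :
    (emb f X * Y) i j = ∑ u, X (i ∘ f) u * Y (Function.extend f u i) j := by
  rw [Matrix.mul_apply]
  symm
  apply Fintype.sum_of_injective _ (extend_injective hf i)
  · intro w hw
    simp only [emb, Matrix.of_apply]
    rw [if_neg, zero_mul]
    exact fun h => hw ⟨w ∘ f, extend_eq_of_agree hf h⟩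
  · intro u
    simp only [emb, Matrix.of_apply]
    rw [if_pos fun l hl => (extend_apply_of_forall_ne u i hl).symm, extend_comp_self hf]

theorem mul_emb_apply [Semiring W] {f : Fin k → Fin n} (hf : Function.Injective f)
    (X : TMat N k W) (Y : TMat N n W) (i j : Fin n → Fin N) :
    (Y * emb f X) i j = ∑ u, Y i (Function.extend f u j) * X u (j ∘ f) := by
  rw [Matrix.mul_apply]
  symm
  apply Fintype.sum_of_injective _ (extend_injective hf j)
  · intro w hw
    simp only [emb, Matrix.of_apply]
    rw [if_neg, mul_zero]
    exact fun h => hw ⟨w ∘ f, extend_eq_of_agree hf fun l hl => (h l hl).symm⟩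
  · intro u
    simp only [emb, Matrix.of_apply]
    rw [if_pos fun l hl => extend_apply_of_forall_ne u j hl, extend_comp_self hf]

theorem emb_mul_emb [Semiring W] {f : Fin k → Fin n} (hf : Function.Injective f)
    (X Y : TMat N k W) : emb f (X * Y) = emb f X * emb f Y := by
  ext i j
  rw [emb_mul_apply hf]
  simp only [emb, Matrix.of_apply, extend_comp_self hf, Matrix.mul_apply]
  have : ∀ u : Fin k → Fin N, (∀ l, (∀ a, f a ≠ l) → Function.extend f u i l = j l) ↔
      ∀ l, (∀ a, f a ≠ l) → i l = j l := fun u =>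
    forall_congr' fun l => forall_congr' fun hl => by rw [extend_apply_of_forall_ne u i hl]
  simp only [this]
  split_ifs <;> simp

theorem emb_one_of_semiring [Semiring W] {f : Fin k → Fin n} :
    emb f (1 : TMat N k W) = 1 := by
  ext i j
  simp only [emb, Matrix.of_apply, Matrix.one_apply]
  by_cases hij : i = j
  · simp [hij]
  · rw [if_neg hij]
    by_cases h : ∀ l, (∀ a, f a ≠ l) → i l = j l
    · rw [if_pos h, if_neg]
      intro h2
      apply hij
      funext l
      by_cases hl : ∀ a, f a ≠ l
      · exact h l hl
      · push Not at hl
        obtain ⟨a, rfl⟩ := hl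
        exact congrFun h2 a
    · rw [if_neg h]

theorem emb_comp [Zero W] {f : Fin k → Fin m} {g : Fin m → Fin n}
    (hg : Function.Injective g) (X : TMat N k W) : emb g (emb f X) = emb (g ∘ f) X := by
  ext i j
  simp only [emb, Matrix.of_apply, Function.comp_assoc]
  have : (∀ l, (∀ a, (g ∘ f) a ≠ l) → i l = j l) ↔
      (∀ l, (∀ a, g a ≠ l) → i l = j l) ∧ ∀ l, (∀ a, f a ≠ l) → (i ∘ g) l = (j ∘ g) l := by
    constructor
    · exact fun h => ⟨fun l hl => h l fun a => hl (f a),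
        fun l hl => h (g l) fun a ha => hl a (hg ha)⟩
    · rintro ⟨h1, h2⟩ l hl
      by_cases hl' : ∀ a, g a ≠ l
      · exact h1 l hl'
      · push Not at hl'
        obtain ⟨a, rfl⟩ := hl'
        exact h2 a fun b hb => hl b (congrArg g hb)
  simp only [this, ite_and]

variable [Ring W] [Algebra ℂ W]

/-- `emb f` for injective `f`, as a homomorphism of algebras. -/
def embHom (N : ℕ) (W : Type*) [Ring W] [Algebra ℂ W] {f : Fin k → Fin n}
    (hf : Function.Injective f) : TMat N k W →ₐ[ℂ] TMat N n W :=
  AlgHom.ofLinearMap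
    { toFun := emb f
      map_add' := fun X Y => by
        ext i j
        simp only [emb, Matrix.of_apply, Matrix.add_apply]
        split_ifs <;> simp
      map_smul' := fun c X => by
        ext i j
        simp only [emb, Matrix.of_apply, Matrix.smul_apply, RingHom.id_apply]
        split_ifs <;> simp }
    emb_one_of_semiring (emb_mul_emb hf)

@[simp] theorem embHom_apply {f : Fin k → Fin n} (hf : Function.Injective f) (X : TMat N k W) :
    embHom N W hf X = emb f X := rfl

/-- Regarding operators on `V^{⊗ n}` as matrices over `W`, as a homomorphism of algebras. -/
def scalHom (N n : ℕ) (W : Type*) [Ring W] [Algebra ℂ W] : TMat N n ℂ →ₐ[ℂ] TMat N n W :=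
  (Algebra.ofId ℂ W).mapMatrix

@[simp] theorem scalHom_apply (X : TMat N n ℂ) : scalHom N n W X = scal W X := rfl

theorem scal_mul (X Y : TMat N n ℂ) : scal W (X * Y) = scal W X * scal W Y :=
  map_mul (scalHom N n W) X Y

theorem scal_one : scal W (1 : TMat N n ℂ) = 1 := map_one (scalHom N n W)

theorem emb_scal (f : Fin k → Fin n) (X : TMat N k ℂ) :
    emb f (scal W X) = scal W (emb f X) := by
  ext i j
  simp only [emb, Matrix.of_apply, scal, Matrix.map_apply]
  split_ifs <;> simp

/-- Operators on disjoint sets of tensor factors commute, even over a noncommutative algebra, as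
soon as one of them has scalar entries. -/
theorem scal_emb_commute {f : Fin k → Fin n} {g : Fin m → Fin n}
    (hf : Function.Injective f) (hfg : ∀ a b, f a ≠ g b)
    (X : TMat N k ℂ) (Y : TMat N m W) : Commute (scal W (emb f X)) (emb g Y) := by
  rw [← emb_scal]
  ext i j
  rw [emb_mul_apply hf, mul_emb_apply hf]
  have h1 : ∀ u : Fin k → Fin N, Function.extend f u i ∘ g = i ∘ g := fun u =>
    funext fun b => extend_apply_of_forall_ne u i fun a => hfg a b
  have h2 : ∀ u : Fin k → Fin N, Function.extend f u j ∘ g = j ∘ g := fun u =>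
    funext fun b => extend_apply_of_forall_ne u j fun a => hfg a b
  simp only [emb, Matrix.of_apply, h1, h2, Matrix.map_apply, scal]
  rw [Finset.sum_eq_single (j ∘ f), Finset.sum_eq_single (i ∘ f)]
  · have h3 : (∀ l, (∀ a, g a ≠ l) → Function.extend f (j ∘ f) i l = j l) ↔
        ∀ l, (∀ a, g a ≠ l) → (∀ a, f a ≠ l) → i l = j l := by
      refine forall_congr' fun l => forall_congr' fun hl => ?_
      by_cases hl' : ∀ a, f a ≠ l
      · simp [hl']
      · simp only [hl', IsEmpty.forall_iff, iff_true]
        push Not at hl'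
        obtain ⟨a, rfl⟩ := hl'
        exact hf.extend_apply _ _ _
    have h4 : (∀ l, (∀ a, g a ≠ l) → i l = Function.extend f (i ∘ f) j l) ↔
        ∀ l, (∀ a, g a ≠ l) → (∀ a, f a ≠ l) → i l = j l := by
      refine forall_congr' fun l => forall_congr' fun hl => ?_
      by_cases hl' : ∀ a, f a ≠ l
      · simp [hl']
      · simp only [hl', IsEmpty.forall_iff, iff_true]
        push Not at hl'
        obtain ⟨a, rfl⟩ := hl'
        exact (hf.extend_apply (i ∘ f) j a).symm
    simp only [h3, h4]
    split_ifs
    · exact Algebra.commutes _ _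
    · simp
  · intro u _ hu
    rw [if_neg, zero_mul]
    intro h
    apply hu
    funext a
    have := h (f a) fun b => (hfg a b).symm
    rw [hf.extend_apply] at this
    exact this.symm
  · simp
  · intro u _ hu
    rw [if_neg, mul_zero]
    intro h
    apply hu
    funext a
    have := h (f a) fun b => (hfg a b).symm
    rw [hf.extend_apply] at this
    exact this
  · simp

theorem leg_of_lt {X : TMat N 2 ℂ} {i : ℕ} (h : i + 1 < n) :
    leg n i X = emb ![⟨i, Nat.lt_of_succ_lt h⟩, ⟨i + 1, h⟩] X := dif_pos h

/-- An embedding of tensor factors that preserves neighbours maps `leg` to `leg`. -/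
theorem emb_leg {f : Fin m → Fin n} (hf : Function.Injective f) {i j : ℕ} (hi : i + 1 < m)
    (h0 : (f ⟨i, Nat.lt_of_succ_lt hi⟩ : ℕ) = j) (h1 : (f ⟨i + 1, hi⟩ : ℕ) = j + 1)
    (X : TMat N 2 ℂ) : emb f (leg m i X) = leg n j X := by
  have hj : j + 1 < n := by rw [← h1]; exact Fin.isLt _
  rw [leg_of_lt hi, leg_of_lt hj, emb_comp hf]
  congr 1
  funext a
  fin_cases a
  · exact Fin.ext h0
  · exact Fin.ext h1

end Embedding

/-! ### The matrix `D_R` -/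

section SkewInverse

variable {N : ℕ} {W : Type*}

theorem leg_three_zero_apply (X : TMat N 2 ℂ) (i j : Fin 3 → Fin N) :
    leg 3 0 X i j = if i 2 = j 2 then X ![i 0, i 1] ![j 0, j 1] else 0 := by
  rw [leg_of_lt (by omega)]
  simp only [emb, Matrix.of_apply]
  have : (∀ l : Fin 3, (∀ a : Fin 2, (![⟨0, by omega⟩, ⟨0 + 1, by omega⟩] : Fin 2 → Fin 3) a ≠ l) →
      i l = j l) ↔ i 2 = j 2 := by
    simp [Fin.forall_fin_succ]
  simp only [this]
  have hc : ∀ w : Fin 3 → Fin N, w ∘ ![⟨0, by omega⟩, ⟨0 + 1, by omega⟩] = ![w 0, w 1] := by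
    intro w; funext a; fin_cases a <;> rfl
  rw [hc, hc]

theorem leg_three_one_apply (X : TMat N 2 ℂ) (i j : Fin 3 → Fin N) :
    leg 3 1 X i j = if i 0 = j 0 then X ![i 1, i 2] ![j 1, j 2] else 0 := by
  rw [leg_of_lt (by omega)]
  simp only [emb, Matrix.of_apply]
  have : (∀ l : Fin 3, (∀ a : Fin 2, (![⟨1, by omega⟩, ⟨1 + 1, by omega⟩] : Fin 2 → Fin 3) a ≠ l) →
      i l = j l) ↔ i 0 = j 0 := by
    simp [Fin.forall_fin_succ]
  simp only [this]
  have hc : ∀ w : Fin 3 → Fin N, w ∘ ![⟨1, by omega⟩, ⟨1 + 1, by omega⟩] = ![w 1, w 2] := by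
    intro w; funext a; fin_cases a <;> rfl
  rw [hc, hc]

theorem sum_fin_three (f : (Fin 3 → Fin N) → ℂ) :
    ∑ w, f w = ∑ a, ∑ p : Fin N × Fin N, f ![a, p.1, p.2] := by
  rw [← Fintype.sum_prod_type' (f := fun a (p : Fin N × Fin N) => f ![a, p.1, p.2])]
  symm
  refine Fintype.sum_equiv ⟨fun t => ![t.1, t.2.1, t.2.2], fun w => (w 0, w 1, w 2), ?_, ?_⟩ _ _ ?_
  · intro t; rfl
  · intro w; funext a; fin_cases a <;> rfl
  · intro t; rfl

theorem leg_three_one_mul_apply (X : TMat N 2 ℂ) (Y : TMat N 3 ℂ) (a b c : Fin N)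
    (j : Fin 3 → Fin N) :
    (leg 3 1 X * Y) ![a, b, c] j =
      ∑ p : Fin N × Fin N, X ![b, c] ![p.1, p.2] * Y ![a, p.1, p.2] j := by
  rw [Matrix.mul_apply, sum_fin_three]
  simp [leg_three_one_apply]
  rw [Finset.sum_eq_single a] <;> simp +contextual [eq_comm]

theorem mul_leg_three_one_apply (X : TMat N 2 ℂ) (Y : TMat N 3 ℂ) (a b c : Fin N)
    (j : Fin 3 → Fin N) :
    (Y * leg 3 1 X) j ![a, b, c] =
      ∑ p : Fin N × Fin N, Y j ![a, p.1, p.2] * X ![p.1, p.2] ![b, c] := by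
  rw [Matrix.mul_apply, sum_fin_three]
  simp [leg_three_one_apply]
  rw [Finset.sum_eq_single a] <;> simp +contextual [eq_comm]

theorem leg_three_zero_mul_apply (X : TMat N 2 ℂ) (Y : TMat N 3 ℂ) (a b c : Fin N)
    (j : Fin 3 → Fin N) :
    (leg 3 0 X * Y) ![a, b, c] j =
      ∑ p : Fin N × Fin N, X ![a, b] ![p.1, p.2] * Y ![p.1, p.2, c] j := by
  rw [Matrix.mul_apply, sum_fin_three]
  simp only [leg_three_zero_apply, Fintype.sum_prod_type]
  refine Finset.sum_congr rfl fun x _ => Finset.sum_congr rfl fun y _ => ?_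
  rw [Finset.sum_eq_single c] <;> simp +contextual [eq_comm]

theorem mul_leg_three_zero_apply (X : TMat N 2 ℂ) (Y : TMat N 3 ℂ) (a b c : Fin N)
    (j : Fin 3 → Fin N) :
    (Y * leg 3 0 X) j ![a, b, c] =
      ∑ p : Fin N × Fin N, Y j ![p.1, p.2, c] * X ![p.1, p.2] ![a, b] := by
  rw [Matrix.mul_apply, sum_fin_three]
  simp only [leg_three_zero_apply, Fintype.sum_prod_type]
  refine Finset.sum_congr rfl fun x _ => Finset.sum_congr rfl fun y _ => ?_
  rw [Finset.sum_eq_single c] <;> simp +contextual [eq_comm]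

theorem mul_apply_two (X Y : TMat N 2 ℂ) (i j : Fin 2 → Fin N) :
    (X * Y) i j = ∑ p : Fin N × Fin N, X i ![p.1, p.2] * Y ![p.1, p.2] j := by
  rw [Matrix.mul_apply]
  symm
  refine Fintype.sum_equiv ⟨fun t => ![t.1, t.2], fun w => (w 0, w 1), ?_, ?_⟩ _ _ ?_
  · intro t; rfl
  · intro w; funext a; fin_cases a <;> rfl
  · intro t; rfl

theorem isSkewInverse_skewInverse {R : TMat N 2 ℂ} (h : IsSkewInvertible R) :
    IsSkewInverse R (skewInverse R) := by
  rw [skewInverse, dif_pos h]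
  exact h.choose_spec

theorem sum_mul_matD {R : TMat N 2 ℂ} (h : IsSkewInvertible R) (a b : Fin N) :
    ∑ p : Fin N × Fin N, R ![a, p.1] ![b, p.2] * matD R p.2 p.1 = if a = b then 1 else 0 := by
  have h1 : ∀ p : Fin N × Fin N, R ![a, p.1] ![b, p.2] * matD R p.2 p.1 =
      ∑ e, R ![a, p.1] ![b, p.2] * skewInverse R ![p.2, e] ![p.1, e] := fun p => by
    rw [matD, Matrix.of_apply, Finset.mul_sum]
  simp only [h1]
  rw [Finset.sum_comm]
  have h2 := fun e => (isSkewInverse_skewInverse h a b e e).1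
  simp only [← Fintype.sum_prod_type'] at h2
  simp only [h2]
  by_cases hab : a = b
  · subst hab
    rw [Finset.sum_eq_single a] <;> simp +contextual [eq_comm]
  · rw [if_neg hab]
    apply Finset.sum_eq_zero
    rintro e -
    rw [if_neg]
    rintro ⟨rfl, rfl⟩
    exact hab rfl

theorem mul_leg_inv {X Y : TMat N 2 ℂ} (h : X * Y = 1) (n m : ℕ) : leg n m X * leg n m Y = 1 := by
  rw [← leg_mul, h, leg_one]

/-- If `F` transports `R` along the tensor factors, then the `R`-trace over the second factor of
`F₁ B₁ F₁⁻¹` is `Tr_R(B)` times the identity; here in components, for the matrix units `B`. -/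
theorem sum_conj_matD {R F Fi : TMat N 2 ℂ} (hs : IsSkewInvertible R)
    (h : leg 3 1 R * leg 3 0 F * leg 3 1 F = leg 3 0 F * leg 3 1 F * leg 3 0 R)
    (h1 : F * Fi = 1) (h2 : Fi * F = 1) (a a' c c' : Fin N) :
    ∑ p : Fin N × Fin N, (∑ y, F ![a, p.1] ![c, y] * Fi ![c', y] ![a', p.2]) * matD R p.2 p.1 =
      if a = a' then matD R c' c else 0 := by
  have key : leg 3 1 F * leg 3 0 R * leg 3 1 Fi = leg 3 0 Fi * leg 3 1 R * leg 3 0 F := by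
    have e1 := mul_leg_inv h1 3 1
    have e2 := mul_leg_inv h2 3 0
    calc leg 3 1 F * leg 3 0 R * leg 3 1 Fi
        = leg 3 0 Fi * leg 3 0 F * (leg 3 1 F * leg 3 0 R * leg 3 1 Fi) := by rw [e2, one_mul]
      _ = leg 3 0 Fi * (leg 3 0 F * leg 3 1 F * leg 3 0 R) * leg 3 1 Fi := by
          simp only [mul_assoc]
      _ = leg 3 0 Fi * (leg 3 1 R * leg 3 0 F) * (leg 3 1 F * leg 3 1 Fi) := by
          rw [← h]; simp only [mul_assoc]
      _ = _ := by rw [e1, mul_one]; simp only [mul_assoc]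
  have hΨ := isSkewInverse_skewInverse hs
  set Ψ := skewInverse R with hΨdef
  -- the entry of both sides of `key`, contracted with `D_R` over the last factor and with the
  -- skew inverse over the first one
  have hL : ∀ i3 j3 : Fin N, ∑ s : Fin N × Fin N, Ψ ![c', s.1] ![c, s.2] *
      (leg 3 1 F * leg 3 0 R * leg 3 1 Fi) ![s.2, a, i3] ![s.1, a', j3] =
      ∑ y, F ![a, i3] ![c, y] * Fi ![c', y] ![a', j3] := by
    intro i3 j3
    have e : ∀ s : Fin N × Fin N, Ψ ![c', s.1] ![c, s.2] *
        (leg 3 1 F * leg 3 0 R * leg 3 1 Fi) ![s.2, a, i3] ![s.1, a', j3] =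
        ∑ p : Fin N × Fin N, ∑ u, (F ![a, i3] ![u, p.2] * Fi ![p.1, p.2] ![a', j3]) *
          (Ψ ![c', s.1] ![c, s.2] * R ![s.2, u] ![s.1, p.1]) := by
      intro s
      rw [mul_leg_three_one_apply, Finset.mul_sum]
      refine Finset.sum_congr rfl fun p _ => ?_
      rw [leg_three_one_mul_apply, Fintype.sum_prod_type, Finset.sum_mul, Finset.mul_sum]
      refine Finset.sum_congr rfl fun u _ => ?_
      rw [Finset.sum_eq_single p.2]
      · simp only [leg_three_zero_apply]
        simp
        ring
      · intro v _ hv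
        simp [leg_three_zero_apply, hv]
      · simp
    simp only [e]
    rw [Finset.sum_comm]
    have e2 : ∀ p : Fin N × Fin N, (∑ s : Fin N × Fin N, ∑ u,
        (F ![a, i3] ![u, p.2] * Fi ![p.1, p.2] ![a', j3]) *
          (Ψ ![c', s.1] ![c, s.2] * R ![s.2, u] ![s.1, p.1])) =
        if p.1 = c' then F ![a, i3] ![c, p.2] * Fi ![c', p.2] ![a', j3] else 0 := by
      intro p
      rw [Finset.sum_comm]
      simp only [← Finset.mul_sum]
      have e3 := fun u => (hΨ c' c u p.1).2
      simp only [← Fintype.sum_prod_type'] at e3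
      simp only [e3]
      rw [Finset.sum_eq_single c]
      · by_cases hp : p.1 = c'
        · simp [hp]
        · simp [hp, Ne.symm hp]
      · intro u _ hu
        simp [hu]
      · simp
    simp only [e2, Fintype.sum_prod_type]
    rw [Finset.sum_comm]
    simp
  have hRt : ∀ s : Fin N × Fin N, ∑ p : Fin N × Fin N,
      (leg 3 0 Fi * leg 3 1 R * leg 3 0 F) ![s.2, a, p.1] ![s.1, a', p.2] * matD R p.2 p.1 =
      if s.2 = s.1 ∧ a = a' then 1 else 0 := by
    intro s
    have e : ∀ p : Fin N × Fin N,
        (leg 3 0 Fi * leg 3 1 R * leg 3 0 F) ![s.2, a, p.1] ![s.1, a', p.2] * matD R p.2 p.1 =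
        ∑ t : Fin N × Fin N, ∑ w, (Fi ![s.2, a] ![t.1, w] * F ![t.1, t.2] ![s.1, a']) *
          (R ![w, p.1] ![t.2, p.2] * matD R p.2 p.1) := by
      intro p
      rw [mul_leg_three_zero_apply, Finset.sum_mul]
      refine Finset.sum_congr rfl fun t _ => ?_
      rw [leg_three_zero_mul_apply, Fintype.sum_prod_type, Finset.sum_mul, Finset.sum_mul,
        Finset.sum_eq_single t.1]
      · rw [Finset.sum_mul, Finset.sum_mul]
        refine Finset.sum_congr rfl fun w _ => ?_
        simp only [leg_three_one_apply]
        simp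
        ring
      · intro v _ hv
        simp [leg_three_one_apply, hv]
      · simp
    simp only [e]
    rw [Finset.sum_comm]
    have e2 : ∀ t : Fin N × Fin N, (∑ p : Fin N × Fin N, ∑ w,
        (Fi ![s.2, a] ![t.1, w] * F ![t.1, t.2] ![s.1, a']) *
          (R ![w, p.1] ![t.2, p.2] * matD R p.2 p.1)) =
        Fi ![s.2, a] ![t.1, t.2] * F ![t.1, t.2] ![s.1, a'] := by
      intro t
      rw [Finset.sum_comm]
      simp only [← Finset.mul_sum, sum_mul_matD hs]
      simp
    simp only [e2]
    rw [← mul_apply_two, h2, Matrix.one_apply]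
    congr 1
    simp
  calc _ = ∑ p : Fin N × Fin N, (∑ s : Fin N × Fin N, Ψ ![c', s.1] ![c, s.2] *
      (leg 3 0 Fi * leg 3 1 R * leg 3 0 F) ![s.2, a, p.1] ![s.1, a', p.2]) * matD R p.2 p.1 := by
        simp only [← hL, key]
    _ = ∑ s : Fin N × Fin N, Ψ ![c', s.1] ![c, s.2] * ∑ p : Fin N × Fin N,
      (leg 3 0 Fi * leg 3 1 R * leg 3 0 F) ![s.2, a, p.1] ![s.1, a', p.2] * matD R p.2 p.1 := by
        simp only [Finset.sum_mul, Finset.mul_sum]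
        rw [Finset.sum_comm]
        simp only [mul_assoc]
    _ = _ := by
        simp only [hRt]
        rw [Fintype.sum_prod_type]
        by_cases ha : a = a'
        · simp [ha, matD, hΨdef]
        · simp [ha]

/-- `D_R ⊗ ⋯ ⊗ D_R`. -/
def tensorD (R : TMat N 2 ℂ) (n : ℕ) : TMat N n ℂ :=
  Matrix.of fun i j => ∏ l, matD R (i l) (j l)

/-- `Rᵢ` with `D_R ⊗ D_R`: both sides of `R⁻¹ D₂ D₁ = D₁ D₂ R⁻¹` are `D₁ Ψ₂₁ D₁`. -/
theorem commute_tensorD_two {R : TMat N 2 ℂ} (hR : IsRMatrix R) (hs : IsSkewInvertible R) :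
    Commute R (tensorD R 2) := by
  have hΨ := isSkewInverse_skewInverse hs
  have hi1 : R * R⁻¹ = 1 := Matrix.mul_nonsing_inv R ((Matrix.isUnit_iff_isUnit_det R).1 hR.isUnit)
  have hi2 : R⁻¹ * R = 1 := Matrix.nonsing_inv_mul R ((Matrix.isUnit_iff_isUnit_det R).1 hR.isUnit)
  have hyb := hR.yangBaxter
  have hyb' : leg 3 1 R * leg 3 0 R⁻¹ * leg 3 1 R⁻¹ = leg 3 0 R⁻¹ * leg 3 1 R⁻¹ * leg 3 0 R := by
    have e1 := mul_leg_inv hi1 3 0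
    have e2 := mul_leg_inv hi1 3 1
    have e3 := mul_leg_inv hi2 3 0
    have e4 := mul_leg_inv hi2 3 1
    calc _ = leg 3 0 R⁻¹ * (leg 3 1 R⁻¹ * (leg 3 1 R * leg 3 0 R * leg 3 1 R)) * leg 3 0 R⁻¹ *
          leg 3 1 R⁻¹ := by
          rw [← mul_assoc, ← mul_assoc, ← mul_assoc, mul_assoc (leg 3 0 R⁻¹), e4, mul_one, e3,
            one_mul]
      _ = leg 3 0 R⁻¹ * leg 3 1 R⁻¹ * leg 3 0 R * (leg 3 1 R * (leg 3 0 R * leg 3 0 R⁻¹) *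
          leg 3 1 R⁻¹) := by
          rw [← hyb]; simp only [mul_assoc]
      _ = _ := by rw [e1, mul_one, e2, mul_one]
  set Ψ := skewInverse R with hΨdef
  have hΨ2 : ∀ a b c d : Fin N, ∑ s : Fin N × Fin N, Ψ ![a, s.1] ![b, s.2] * R ![s.2, c] ![s.1, d] =
      if a = d ∧ c = b then 1 else 0 := fun a b c d => by
    rw [Fintype.sum_prod_type]
    exact (hΨ a b c d).2
  obtain ⟨D, hD⟩ : ∃ D, D = matD R := ⟨_, rfl⟩
  -- `R⁻¹ D₂ = D₁ Ψ₂₁`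
  have A : ∀ c' e a' f : Fin N, ∑ t, R⁻¹ ![c', e] ![a', t] * D t f =
      ∑ c, D c' c * Ψ ![e, c] ![f, a'] := by
    intro c' e a' f
    have h1 := fun a c => sum_conj_matD hs hyb.symm hi1 hi2 a a' c c'
    rw [← hD] at h1
    calc _ = ∑ s : Fin N × Fin N, ∑ t : Fin N × Fin N, ∑ y, (R⁻¹ ![c', y] ![a', t.2] * D t.2 t.1) *
          (Ψ ![e, s.1] ![f, s.2] * R ![s.2, t.1] ![s.1, y]) := by
          have e4 : ∀ t : Fin N × Fin N, (∑ s : Fin N × Fin N, ∑ y,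
              (R⁻¹ ![c', y] ![a', t.2] * D t.2 t.1) *
              (Ψ ![e, s.1] ![f, s.2] * R ![s.2, t.1] ![s.1, y])) =
              if t.1 = f then R⁻¹ ![c', e] ![a', t.2] * D t.2 t.1 else 0 := by
            intro t
            rw [Finset.sum_comm]
            simp only [← Finset.mul_sum, hΨ2]
            rw [Finset.sum_eq_single e]
            · by_cases hx : t.1 = f <;> simp [hx]
            · intro y _ hy
              simp [Ne.symm hy]
            · simp
          rw [Finset.sum_comm]
          simp only [e4, Fintype.sum_prod_type]
          rw [Finset.sum_comm]
          simp
    _ = ∑ s : Fin N × Fin N, Ψ ![e, s.1] ![f, s.2] *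
          (if s.2 = a' then D c' s.1 else 0) := by
          refine Finset.sum_congr rfl fun s _ => ?_
          rw [← h1, Finset.mul_sum]
          refine Finset.sum_congr rfl fun p _ => ?_
          rw [Finset.sum_mul, Finset.mul_sum]
          refine Finset.sum_congr rfl fun y _ => ?_
          ring
    _ = _ := by
          rw [Fintype.sum_prod_type]
          refine Finset.sum_congr rfl fun c _ => ?_
          simp [mul_comm]
  -- `D₂ R⁻¹ = Ψ₂₁ D₁`
  have B : ∀ e a f c : Fin N, ∑ t, R⁻¹ ![a, t] ![c, f] * D e t =
      ∑ c', Ψ ![e, a] ![f, c'] * D c' c := by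
    intro e a f c
    have h1 := fun a' c' => sum_conj_matD hs hyb' hi2 hi1 a a' c c'
    rw [← hD] at h1
    calc _ = ∑ s : Fin N × Fin N, ∑ t : Fin N × Fin N, ∑ y, (R⁻¹ ![a, t.1] ![c, y] * D t.2 t.1) *
          (Ψ ![e, s.1] ![f, s.2] * R ![s.2, y] ![s.1, t.2]) := by
          have e4 : ∀ t : Fin N × Fin N, (∑ s : Fin N × Fin N, ∑ y,
              (R⁻¹ ![a, t.1] ![c, y] * D t.2 t.1) *
              (Ψ ![e, s.1] ![f, s.2] * R ![s.2, y] ![s.1, t.2])) =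
              if t.2 = e then R⁻¹ ![a, t.1] ![c, f] * D t.2 t.1 else 0 := by
            intro t
            rw [Finset.sum_comm]
            simp only [← Finset.mul_sum, hΨ2]
            rw [Finset.sum_eq_single f]
            · by_cases hx : t.2 = e
              · simp [hx]
              · simp [hx, Ne.symm hx]
            · intro y _ hy
              simp [hy]
            · simp
          rw [Finset.sum_comm]
          simp only [e4, Fintype.sum_prod_type]
          simp
    _ = ∑ s : Fin N × Fin N, Ψ ![e, s.1] ![f, s.2] *
          (if a = s.1 then D s.2 c else 0) := by
          refine Finset.sum_congr rfl fun s _ => ?_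
          rw [← h1, Finset.mul_sum]
          refine Finset.sum_congr rfl fun p _ => ?_
          rw [Finset.sum_mul, Finset.mul_sum]
          refine Finset.sum_congr rfl fun y _ => ?_
          ring
    _ = _ := by
          rw [Fintype.sum_prod_type, Finset.sum_comm]
          refine Finset.sum_congr rfl fun c _ => ?_
          simp
  have hinv : R⁻¹ * tensorD R 2 = tensorD R 2 * R⁻¹ := by
    have h2 : ∀ w : Fin 2 → Fin N, w = ![w 0, w 1] := by
      intro w; funext a; fin_cases a <;> rfl
    ext i j
    rw [h2 i, h2 j, mul_apply_two, mul_apply_two]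
    simp only [tensorD, Matrix.of_apply, Fin.prod_univ_two, Matrix.cons_val_zero,
      Matrix.cons_val_one, Fintype.sum_prod_type, ← hD]
    calc _ = ∑ a', D a' (j 0) * ∑ t, R⁻¹ ![i 0, i 1] ![a', t] * D t (j 1) := by
          simp only [Finset.mul_sum]
          refine Finset.sum_congr rfl fun a _ => Finset.sum_congr rfl fun b _ => ?_
          ring
      _ = ∑ c, D (i 0) c * ∑ a', Ψ ![i 1, c] ![j 1, a'] * D a' (j 0) := by
          simp only [A, Finset.mul_sum]
          rw [Finset.sum_comm]
          refine Finset.sum_congr rfl fun a _ => Finset.sum_congr rfl fun b _ => ?_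
          ring
      _ = _ := by
          simp only [← B, Finset.mul_sum]
          refine Finset.sum_congr rfl fun a _ => Finset.sum_congr rfl fun b _ => ?_
          ring
  calc R * tensorD R 2 = R * (tensorD R 2 * R⁻¹) * R := by
        rw [mul_assoc, mul_assoc, hi2, mul_one]
    _ = tensorD R 2 * R := by rw [← hinv, ← mul_assoc, hi1, one_mul]

end SkewInverse

/-! ### The partial R-trace and the shift of tensor factors -/

section PartialTrace

variable {N n : ℕ} {W : Type*}

/-- Appending an index. -/
abbrev app (i : Fin n → Fin N) (a : Fin N) : Fin (n + 1) → Fin N :=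
  Fin.snoc (α := fun _ => Fin N) i a

theorem sum_app {M : Type*} [AddCommMonoid M] (f : (Fin (n + 1) → Fin N) → M) :
    ∑ w, f w = ∑ i, ∑ a, f (app i a) := by
  rw [← Fintype.sum_prod_type' (f := fun i a => f (app i a))]
  symm
  refine Fintype.sum_equiv ⟨fun t => app t.1 t.2, fun w => (Fin.init w, w (Fin.last n)), ?_, ?_⟩
    _ _ ?_
  · intro t
    simp [app]
  · intro w
    simp [app]
  · intro t; rfl

theorem exists_eq_app (w : Fin (n + 1) → Fin N) : ∃ i a, w = app i a :=
  ⟨Fin.init w, w (Fin.last n), by simp [app]⟩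

theorem app_castSucc (i : Fin n → Fin N) (a : Fin N) : app i a ∘ Fin.castSucc = i := by
  funext l
  simp [app]

theorem emb_castSucc_apply [Zero W] (Z : TMat N n W) (i j : Fin n → Fin N) (a b : Fin N) :
    emb Fin.castSucc Z (app i a) (app j b) = if a = b then Z i j else 0 := by
  simp only [emb, Matrix.of_apply, app_castSucc]
  have : (∀ l, (∀ a, Fin.castSucc a ≠ l) → app i a l = app j b l) ↔ a = b := by
    constructor
    · intro h
      simpa [app] using h (Fin.last n) fun a => (Fin.castSucc_lt_last a).ne
    · rintro rfl l hl
      induction l using Fin.lastCases with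
      | last => simp [app]
      | cast l => exact absurd rfl (hl l)
  simp only [this]

theorem leg_last_apply (X : TMat N 2 ℂ) (i j : Fin n → Fin N) (a b c d : Fin N) :
    leg (n + 2) n X (app (app i a) b) (app (app j c) d) =
      if i = j then X ![a, b] ![c, d] else 0 := by
  rw [leg_of_lt (by omega)]
  simp only [emb, Matrix.of_apply]
  have hc : ∀ (i : Fin n → Fin N) (a b : Fin N),
      app (app i a) b ∘ ![⟨n, by omega⟩, ⟨n + 1, by omega⟩] = ![a, b] := by
    intro i a b
    have h0 : (⟨n, by omega⟩ : Fin (n + 2)) = Fin.castSucc (Fin.last n) := rfl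
    have h1 : (⟨n + 1, by omega⟩ : Fin (n + 2)) = Fin.last (n + 1) := rfl
    funext x
    fin_cases x <;> simp [app, h0, h1, -Fin.castSucc_mk]
  rw [hc, hc]
  have : (∀ l : Fin (n + 2), (∀ x : Fin 2,
      (![⟨n, by omega⟩, ⟨n + 1, by omega⟩] : Fin 2 → Fin (n + 2)) x ≠ l) →
      app (app i a) b l = app (app j c) d l) ↔ i = j := by
    constructor
    · intro h
      funext l
      have := h l.castSucc.castSucc (by
        intro x
        have := l.isLt
        fin_cases x <;> simp [Fin.ext_iff] <;> omega)
      simpa [app] using this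
    · rintro rfl l hl
      induction l using Fin.lastCases with
      | last => exact absurd rfl (hl 1)
      | cast l =>
        induction l using Fin.lastCases with
        | last => exact absurd rfl (hl 0)
        | cast l => simp [app]
  simp only [this]

variable [Ring W]

theorem emb_castSucc_mul_apply (X : TMat N n W) (Z : TMat N (n + 1) W) (i : Fin n → Fin N)
    (a : Fin N) (w : Fin (n + 1) → Fin N) :
    (emb Fin.castSucc X * Z) (app i a) w = ∑ k, X i k * Z (app k a) w := by
  rw [Matrix.mul_apply, sum_app]
  refine Finset.sum_congr rfl fun k _ => ?_
  rw [Finset.sum_eq_single a] <;> simp +contextual [emb_castSucc_apply, eq_comm]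

theorem mul_emb_castSucc_apply (X : TMat N n W) (Z : TMat N (n + 1) W) (i : Fin n → Fin N)
    (a : Fin N) (w : Fin (n + 1) → Fin N) :
    (Z * emb Fin.castSucc X) w (app i a) = ∑ k, Z w (app k a) * X k i := by
  rw [Matrix.mul_apply, sum_app]
  refine Finset.sum_congr rfl fun k _ => ?_
  rw [Finset.sum_eq_single a] <;> simp +contextual [emb_castSucc_apply, eq_comm]

variable [Algebra ℂ W]

/-- The partial R-trace over the last tensor factor. -/
def partialTrace (R : TMat N 2 ℂ) (Z : TMat N (n + 1) W) : TMat N n W :=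
  Matrix.of fun i j => ∑ a, ∑ b, matD R a b • Z (app i b) (app j a)

theorem rTrace_partialTrace (R : TMat N 2 ℂ) (Z : TMat N (n + 1) W) :
    rTrace R (partialTrace R Z) = rTrace R Z := by
  simp only [rTrace, partialTrace, Matrix.of_apply]
  rw [sum_app]
  refine Finset.sum_congr rfl fun i _ => ?_
  simp only [sum_app, Finset.smul_sum]
  rw [Finset.sum_comm (s := Finset.univ (α := Fin N))]
  refine Finset.sum_congr rfl fun j _ => Finset.sum_congr rfl fun a _ =>
    Finset.sum_congr rfl fun b _ => ?_
  rw [Fin.prod_univ_castSucc, smul_smul]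
  simp [app]

theorem partialTrace_apply (R : TMat N 2 ℂ) (Z : TMat N (n + 1) W) (i j : Fin n → Fin N) :
    partialTrace R Z i j = ∑ p : Fin N × Fin N, matD R p.2 p.1 • Z (app i p.1) (app j p.2) := by
  rw [Fintype.sum_prod_type, Finset.sum_comm]
  rfl

theorem partialTrace_emb_mul (R : TMat N 2 ℂ) (X : TMat N n W) (Z : TMat N (n + 1) W) :
    partialTrace R (emb Fin.castSucc X * Z) = X * partialTrace R Z := by
  ext i j
  rw [partialTrace_apply, Matrix.mul_apply]
  simp only [partialTrace_apply, emb_castSucc_mul_apply, Finset.smul_sum, Finset.mul_sum,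
    mul_smul_comm]
  rw [Finset.sum_comm]

theorem partialTrace_mul_emb (R : TMat N 2 ℂ) (X : TMat N n W) (Z : TMat N (n + 1) W) :
    partialTrace R (Z * emb Fin.castSucc X) = partialTrace R Z * X := by
  ext i j
  rw [partialTrace_apply, Matrix.mul_apply]
  simp only [partialTrace_apply, mul_emb_castSucc_apply, Finset.smul_sum, Finset.sum_mul,
    smul_mul_assoc]
  rw [Finset.sum_comm]

theorem scal_apply (X : TMat N n ℂ) (i j : Fin n → Fin N) :
    scal W X i j = algebraMap ℂ W (X i j) := rfl

/-- Conjugation by the last `F` transports the partial R-trace by one factor to the right. -/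
theorem partialTrace_conj_leg {R F Fi : TMat N 2 ℂ} (hs : IsSkewInvertible R)
    (h : leg 3 1 R * leg 3 0 F * leg 3 1 F = leg 3 0 F * leg 3 1 F * leg 3 0 R)
    (h1 : F * Fi = 1) (h2 : Fi * F = 1) (Z : TMat N (n + 1) W) :
    partialTrace R (scal W (leg (n + 2) n F) * emb Fin.castSucc Z * scal W (leg (n + 2) n Fi)) =
      emb Fin.castSucc (partialTrace R Z) := by
  have key := sum_conj_matD hs h h1 h2
  ext i j
  obtain ⟨i, a, rfl⟩ := exists_eq_app i
  obtain ⟨j, a', rfl⟩ := exists_eq_app j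
  have e : ∀ x x' : Fin N, (scal W (leg (n + 2) n F) * emb Fin.castSucc Z *
      scal W (leg (n + 2) n Fi)) (app (app i a) x) (app (app j a') x') =
      ∑ c, ∑ c', (∑ y, F ![a, x] ![c, y] * Fi ![c', y] ![a', x']) • Z (app i c) (app j c') := by
    intro x x'
    have e1 : ∀ c' y, (scal W (leg (n + 2) n F) * emb Fin.castSucc Z)
        (app (app i a) x) (app (app j c') y) =
        ∑ c, F ![a, x] ![c, y] • Z (app i c) (app j c') := by
      intro c' y
      rw [mul_emb_castSucc_apply, sum_app, Finset.sum_eq_single i]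
      · refine Finset.sum_congr rfl fun c _ => ?_
        rw [scal_apply, leg_last_apply, if_pos rfl, Algebra.smul_def]
      · intro k _ hk
        refine Finset.sum_eq_zero fun c _ => ?_
        rw [scal_apply, leg_last_apply, if_neg hk.symm, map_zero, zero_mul]
      · simp
    rw [Matrix.mul_apply, sum_app, sum_app, Finset.sum_eq_single j]
    · have e2 : ∀ c' y, (scal W (leg (n + 2) n F) * emb Fin.castSucc Z)
          (app (app i a) x) (app (app j c') y) *
          scal W (leg (n + 2) n Fi) (app (app j c') y) (app (app j a') x') =
          ∑ c, (F ![a, x] ![c, y] * Fi ![c', y] ![a', x']) • Z (app i c) (app j c') := by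
        intro c' y
        rw [e1, scal_apply, leg_last_apply, if_pos rfl, ← Algebra.commutes,
          ← Algebra.smul_def, Finset.smul_sum]
        refine Finset.sum_congr rfl fun c _ => ?_
        rw [smul_smul, mul_comm]
      simp only [e2, Finset.sum_smul]
      refine Eq.trans ?_ Finset.sum_comm
      exact Finset.sum_congr rfl fun c' _ => Finset.sum_comm
    · intro k _ hk
      refine Finset.sum_eq_zero fun c _ => Finset.sum_eq_zero fun y _ => ?_
      rw [scal_apply, leg_last_apply, if_neg hk, map_zero, mul_zero]
    · simp
  rw [emb_castSucc_apply, partialTrace_apply]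
  calc _ = ∑ p : Fin N × Fin N, ∑ t : Fin N × Fin N,
      ((∑ y, F ![a, p.1] ![t.1, y] * Fi ![t.2, y] ![a', p.2]) * matD R p.2 p.1) •
        Z (app i t.1) (app j t.2) := by
        refine Finset.sum_congr rfl fun p _ => ?_
        rw [e, Finset.smul_sum, Fintype.sum_prod_type]
        refine Finset.sum_congr rfl fun c _ => ?_
        rw [Finset.smul_sum]
        refine Finset.sum_congr rfl fun c' _ => ?_
        rw [smul_smul, mul_comm]
    _ = ∑ t : Fin N × Fin N, (if a = a' then matD R t.2 t.1 else 0) •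
        Z (app i t.1) (app j t.2) := by
        rw [Finset.sum_comm]
        refine Finset.sum_congr rfl fun t _ => ?_
        rw [← key, Finset.sum_smul]
    _ = _ := by
        split_ifs
        · rw [partialTrace_apply]
        · simp

end PartialTrace

section Shift

variable {N n : ℕ} {W : Type*}

/-! ### Local relations between operators on neighbouring tensor factors -/

theorem exists_leg_triple {m : ℕ} (h : m + 2 < n) : ∃ φ : TMat N 3 ℂ →ₐ[ℂ] TMat N n ℂ,
    (∀ X, φ (leg 3 0 X) = leg n m X) ∧ ∀ X, φ (leg 3 1 X) = leg n (m + 1) X :=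
  ⟨embHom N ℂ (triple_injective h), fun X =>
    emb_leg (i := 0) (j := m) (triple_injective h) (by omega) rfl rfl X,
    fun X => emb_leg (i := 1) (j := m + 1) (triple_injective h) (by omega) rfl rfl X⟩

/-- `F_1 F_2 X_1 = X_2 F_1 F_2` and `X_1 F_2 F_1 = F_2 F_1 X_2`: conjugation by two neighbouring
copies of `F` moves `X` by one tensor factor. -/
structure TransportedBy (X F : TMat N 2 ℂ) : Prop where
  right : leg 3 0 F * leg 3 1 F * leg 3 0 X = leg 3 1 X * leg 3 0 F * leg 3 1 F
  left : leg 3 1 F * leg 3 0 F * leg 3 1 X = leg 3 0 X * leg 3 1 F * leg 3 0 F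

theorem TransportedBy.leg_right {X F : TMat N 2 ℂ} (hX : TransportedBy X F) {m : ℕ}
    (h : m + 2 < n) :
    leg n m F * leg n (m + 1) F * leg n m X = leg n (m + 1) X * leg n m F * leg n (m + 1) F := by
  obtain ⟨φ, h0, h1⟩ := exists_leg_triple (N := N) h
  simpa only [map_mul, h0, h1] using congrArg φ hX.right

theorem TransportedBy.leg_left {X F : TMat N 2 ℂ} (hX : TransportedBy X F) {m : ℕ}
    (h : m + 2 < n) :
    leg n (m + 1) F * leg n m F * leg n (m + 1) X = leg n m X * leg n (m + 1) F * leg n m F := by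
  obtain ⟨φ, h0, h1⟩ := exists_leg_triple (N := N) h
  simpa only [map_mul, h0, h1] using congrArg φ hX.left

theorem mul_inv_of_isUnit {F : TMat N 2 ℂ} (hF : IsUnit F) : F * F⁻¹ = 1 :=
  Matrix.mul_nonsing_inv F ((Matrix.isUnit_iff_isUnit_det F).1 hF)

theorem inv_mul_of_isUnit {F : TMat N 2 ℂ} (hF : IsUnit F) : F⁻¹ * F = 1 :=
  Matrix.nonsing_inv_mul F ((Matrix.isUnit_iff_isUnit_det F).1 hF)

theorem IsRMatrix.transportedBy_self {F : TMat N 2 ℂ} (hF : IsRMatrix F) : TransportedBy F F :=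
  ⟨hF.yangBaxter, hF.yangBaxter.symm⟩

theorem mul_inv_eq_inv_mul {A : Type*} [Monoid A] {w x y x' y' : A} (hx : x * x' = 1)
    (hy : y' * y = 1) (h : w * x = y * w) : w * x' = y' * w :=
  calc w * x' = y' * (y * w) * x' := by rw [← mul_assoc, hy, one_mul]
    _ = y' * w := by rw [← h, mul_assoc, mul_assoc, hx, mul_one]

theorem TransportedBy.inv {X F : TMat N 2 ℂ} (hX : TransportedBy X F) (hu : IsUnit X) :
    TransportedBy X⁻¹ F := by
  constructor
  · rw [mul_assoc (leg 3 1 X⁻¹)]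
    exact mul_inv_eq_inv_mul (mul_leg_inv (mul_inv_of_isUnit hu) 3 0)
      (mul_leg_inv (inv_mul_of_isUnit hu) 3 1) (by rw [hX.right, mul_assoc])
  · rw [mul_assoc (leg 3 0 X⁻¹)]
    exact mul_inv_eq_inv_mul (mul_leg_inv (mul_inv_of_isUnit hu) 3 1)
      (mul_leg_inv (inv_mul_of_isUnit hu) 3 0) (by rw [hX.left, mul_assoc])

/-! ### The shift of tensor factors by conjugation with `F` -/

/-- `X₁ X₂ ⋯ X_j` on `V^{⊗ k}`. -/
def chain (X : TMat N 2 ℂ) (k : ℕ) : ℕ → TMat N k ℂ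
  | 0 => 1
  | j + 1 => chain X k j * leg k j X

/-- `X_j⁻¹ ⋯ X₂⁻¹ X₁⁻¹` on `V^{⊗ k}`. -/
def chainInv (X : TMat N 2 ℂ) (k : ℕ) : ℕ → TMat N k ℂ
  | 0 => 1
  | j + 1 => leg k j X⁻¹ * chainInv X k j

theorem chain_mul_chainInv {F : TMat N 2 ℂ} (hF : IsUnit F) (k j : ℕ) :
    chain F k j * chainInv F k j = 1 := by
  induction j with
  | zero => simp [chain, chainInv]
  | succ j ih =>
    rw [chain, chainInv, mul_assoc, ← mul_assoc (leg k j F),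
      mul_leg_inv (mul_inv_of_isUnit hF), one_mul, ih]

theorem chainInv_mul_chain {F : TMat N 2 ℂ} (hF : IsUnit F) (k j : ℕ) :
    chainInv F k j * chain F k j = 1 := by
  have := chain_mul_chainInv hF k j
  exact mul_eq_one_comm.1 this

theorem chain_commute_leg (F X : TMat N 2 ℂ) (k : ℕ) {i j : ℕ} (h : j < i) :
    Commute (chain F k j) (leg k i X) := by
  induction j with
  | zero => exact Commute.one_left _
  | succ j ih => exact (ih (by omega)).mul_left (leg_commute (by omega) F X)

theorem chain_mul_leg {F X : TMat N 2 ℂ} (hX : TransportedBy X F) {k i j : ℕ} (hij : i + 2 ≤ j)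
    (hjk : j < k) : chain F k j * leg k i X = leg k (i + 1) X * chain F k j := by
  induction j, hij using Nat.le_induction with
  | base =>
    have h1 : Commute (chain F k i) (leg k (i + 1) X) := chain_commute_leg F X k (by omega)
    simp only [chain]
    rw [mul_assoc (chain F k i), mul_assoc (chain F k i), hX.leg_right (by omega), ← mul_assoc,
      ← mul_assoc, h1.eq]
    simp only [mul_assoc]
  | succ j hj ih =>
    simp only [chain]
    rw [mul_assoc, ← leg_commute (by omega) X F, ← mul_assoc, ih (by omega), mul_assoc]

theorem emb_castSucc_leg {i : ℕ} (h : i + 1 < n) (X : TMat N 2 ℂ) :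
    emb Fin.castSucc (leg n i X) = leg (n + 1) i X :=
  emb_leg (Fin.castSucc_injective n) h rfl rfl X

theorem emb_castSucc_chain (F : TMat N 2 ℂ) {j : ℕ} (h : j < n) :
    emb Fin.castSucc (chain F n j) = chain F (n + 1) j := by
  induction j with
  | zero => exact emb_one
  | succ j ih =>
    rw [chain, emb_mul (Fin.castSucc_injective n), ih (by omega), emb_castSucc_leg h, chain]

theorem emb_castSucc_chainInv (F : TMat N 2 ℂ) {j : ℕ} (h : j < n) :
    emb Fin.castSucc (chainInv F n j) = chainInv F (n + 1) j := by
  induction j with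
  | zero => exact emb_one
  | succ j ih =>
    rw [chainInv, emb_mul (Fin.castSucc_injective n), ih (by omega), emb_castSucc_leg h, chainInv]

variable [Ring W] [Algebra ℂ W]

theorem scal_mul_inv {X Y : TMat N n ℂ} (h : X * Y = 1) : scal W X * scal W Y = 1 := by
  rw [← scal_mul, h, scal_one]

/-- Conjugation by an invertible element. -/
def conjHom {A : Type*} [Ring A] [Algebra ℂ A] (u v : A) (huv : u * v = 1) (hvu : v * u = 1) :
    A →ₐ[ℂ] A :=
  AlgHom.ofLinearMap (LinearMap.mulLeft ℂ u ∘ₗ LinearMap.mulRight ℂ v) (by simp [huv]) (by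
    intro x y
    simp only [LinearMap.comp_apply, LinearMap.mulLeft_apply, LinearMap.mulRight_apply]
    simp only [mul_assoc]
    rw [← mul_assoc v u, hvu, one_mul])

/-- The homomorphism `Z ↦ F₁ ⋯ F_n Z F_n⁻¹ ⋯ F₁⁻¹` from operators on `V^{⊗ n}` to operators on
`V^{⊗ (n + 1)}`. -/
def shiftHom {F : TMat N 2 ℂ} (hF : IsUnit F) (n : ℕ) (W : Type*) [Ring W] [Algebra ℂ W] :
    TMat N n W →ₐ[ℂ] TMat N (n + 1) W :=
  (conjHom (scal W (chain F (n + 1) n)) (scal W (chainInv F (n + 1) n))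
    (scal_mul_inv (chain_mul_chainInv hF _ _)) (scal_mul_inv (chainInv_mul_chain hF _ _))).comp
    (embHom N W (Fin.castSucc_injective n))

theorem shiftHom_apply {F : TMat N 2 ℂ} (hF : IsUnit F) (Z : TMat N n W) :
    shiftHom hF n W Z = scal W (chain F (n + 1) n) * (emb Fin.castSucc Z *
      scal W (chainInv F (n + 1) n)) := rfl

theorem shiftHom_scal_leg {F X : TMat N 2 ℂ} (hF : IsUnit F) (hX : TransportedBy X F) {i : ℕ}
    (hi : i + 1 < n) :
    shiftHom hF n W (scal W (leg n i X)) = scal W (leg (n + 1) (i + 1) X) := by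
  rw [shiftHom_apply, emb_scal, emb_castSucc_leg hi, ← mul_assoc, ← scal_mul,
    chain_mul_leg hX hi (by omega), scal_mul, mul_assoc,
    scal_mul_inv (chain_mul_chainInv hF _ _), mul_one]

theorem partialTrace_shiftHom {R F : TMat N 2 ℂ} (hF : IsUnit F) (hs : IsSkewInvertible R)
    (hRF : TransportedBy R F) (Z : TMat N (n + 1) W) :
    partialTrace R (shiftHom hF (n + 1) W Z) = shiftHom hF n W (partialTrace R Z) := by
  rw [shiftHom_apply, chain, chainInv, ← emb_castSucc_chain F (by omega),
    ← emb_castSucc_chainInv F (by omega), scal_mul, scal_mul, ← emb_scal, ← emb_scal, mul_assoc,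
    ← mul_assoc (emb Fin.castSucc Z), ← mul_assoc, ← mul_assoc, ← mul_assoc, mul_assoc (emb _ _),
    mul_assoc (emb _ _), mul_assoc (emb _ _),
    partialTrace_emb_mul, partialTrace_mul_emb,
    partialTrace_conj_leg hs hRF.right.symm (mul_inv_of_isUnit hF) (inv_mul_of_isUnit hF)]
  rfl

/-! ### The copies of the matrix of generators -/

variable (F : TMat N 2 ℂ) (M : Matrix (Fin N) (Fin N) W)

theorem emb_copy {k : ℕ} {f : Fin n → Fin k} (hf : Function.Injective f)
    (hval : ∀ l, (f l : ℕ) = l) {i : ℕ} (hi : i < n) :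
    emb f (copy F M n i) = copy F M k i := by
  have hk : ∀ {l}, l < n → l < k := fun {l} hl => by
    have := (f ⟨l, hl⟩).isLt
    rwa [hval] at this
  induction i with
  | zero =>
    rw [copy, copy, dif_pos hi, dif_pos (hk hi), emb_comp hf]
    congr 1
    funext a
    fin_cases a
    exact Fin.ext (hval _)
  | succ i ih =>
    rw [copy, copy, emb_mul_emb hf, emb_mul_emb hf, emb_scal, emb_scal, ih (by omega),
      emb_leg hf hi (hval _) (hval _), emb_leg hf hi (hval _) (hval _)]

/-- The copy `M_{\overline{j+1}}` acts on the first `j + 1` factors only. -/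
theorem commute_leg_copy_of_lt {i j : ℕ} (hij : j < i) (hi : i + 1 < n) (X : TMat N 2 ℂ) :
    Commute (scal W (leg n i X)) (copy F M n j) := by
  rw [← emb_copy F M (k := n) (i := j) (n := j + 1) (f := Fin.castLE (by omega))
    (Fin.castLE_injective _)
    (fun _ => rfl) (by omega), leg_of_lt hi]
  refine scal_emb_commute (pair_injective hi) ?_ X _
  intro a b
  have := b.isLt
  fin_cases a <;> simp [Fin.ext_iff] <;> omega

variable {F}

theorem shiftHom_copy (hF : IsRMatrix F) {i : ℕ} (hi : i < n) :
    shiftHom hF.isUnit n W (copy F M n i) = copy F M (n + 1) (i + 1) := by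
  induction i with
  | zero =>
    rw [shiftHom_apply, emb_copy F M (Fin.castSucc_injective n) (fun _ => rfl) hi]
    have key : ∀ j, j < n → scal W (chain F (n + 1) (j + 1)) * (copy F M (n + 1) 0 *
        scal W (chainInv F (n + 1) (j + 1))) = copy F M (n + 1) 1 := by
      intro j hj
      induction j with
      | zero => simp only [chain, chainInv, one_mul, mul_one, copy, ← mul_assoc]
      | succ j ih =>
        have h1 := commute_leg_copy_of_lt F M (i := j + 1) (j := 0) (n := n + 1) (by omega)
          (by omega) F
        rw [chain, chainInv, scal_mul, scal_mul, mul_assoc, ← mul_assoc (copy F M (n + 1) 0),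
          ← mul_assoc (scal W (leg (n + 1) (j + 1) F)), ← mul_assoc (scal W (leg (n + 1) (j + 1) F)),
          h1.eq, mul_assoc (copy F M (n + 1) 0),
          scal_mul_inv (mul_leg_inv (mul_inv_of_isUnit hF.isUnit) _ _), mul_one, ih (by omega)]
    obtain ⟨m, rfl⟩ : ∃ m, n = m + 1 := ⟨n - 1, by omega⟩
    exact key m (by omega)
  | succ i ih =>
    have ht := hF.transportedBy_self
    rw [copy, map_mul, map_mul, shiftHom_scal_leg _ ht hi,
      shiftHom_scal_leg _ (ht.inv hF.isUnit) hi, ih (by omega)]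
    rfl

end Shift

/-! ### Products and cyclicity of the R-traces `ch` -/

section Characters

variable {N n : ℕ} {W : Type*}

theorem emb_id [Zero W] {h : n = n} (Z : TMat N n W) : emb (Fin.cast h) Z = Z := by
  ext i j
  simp only [emb, Matrix.of_apply]
  rw [if_pos fun l hl => absurd rfl (hl l)]
  rfl

variable [Ring W]

theorem emb_diagonal {k : ℕ} {f : Fin k → Fin n} (w : W) :
    emb f (Matrix.diagonal (fun _ => w) : TMat N k W) = Matrix.diagonal fun _ => w := by
  ext i j
  have := congrFun (congrFun (emb_one_of_semiring (N := N) (W := ℂ) (f := f)) i) j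
  simp only [emb, Matrix.of_apply, Matrix.diagonal_apply, Matrix.one_apply] at this ⊢
  split_ifs at this ⊢ <;> simp_all

variable [Algebra ℂ W]

/-- The partial R-trace over the last `m` tensor factors. -/
def partialTraceIter (R : TMat N 2 ℂ) {n : ℕ} : (m : ℕ) → TMat N (n + m) W → TMat N n W
  | 0, Z => Z
  | m + 1, Z => partialTraceIter R m (partialTrace R (n := n + m) Z)

theorem rTrace_partialTraceIter (R : TMat N 2 ℂ) (m : ℕ) (Z : TMat N (n + m) W) :
    rTrace R (partialTraceIter R m Z) = rTrace R Z := by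
  induction m with
  | zero => rfl
  | succ m ih => rw [partialTraceIter, ih, rTrace_partialTrace]

theorem partialTraceIter_emb_mul (R : TMat N 2 ℂ) (m : ℕ) (X : TMat N n W)
    (Z : TMat N (n + m) W) :
    partialTraceIter R m (emb (Fin.castAdd m) X * Z) = X * partialTraceIter R m Z := by
  induction m with
  | zero =>
    rw [partialTraceIter, partialTraceIter]
    congr 1
    exact emb_id (h := rfl) X
  | succ m ih =>
    have h : emb (Fin.castAdd (m + 1)) X = emb Fin.castSucc (emb (Fin.castAdd m) X) := by
      rw [emb_comp (Fin.castSucc_injective _)]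
      rfl
    rw [partialTraceIter, partialTraceIter, ← ih, h, ← partialTrace_emb_mul]

theorem partialTraceIter_mul_emb (R : TMat N 2 ℂ) (m : ℕ) (X : TMat N n W)
    (Z : TMat N (n + m) W) :
    partialTraceIter R m (Z * emb (Fin.castAdd m) X) = partialTraceIter R m Z * X := by
  induction m with
  | zero =>
    rw [partialTraceIter, partialTraceIter]
    congr 1
    exact emb_id (h := rfl) X
  | succ m ih =>
    have h : emb (Fin.castAdd (m + 1)) X = emb Fin.castSucc (emb (Fin.castAdd m) X) := by
      rw [emb_comp (Fin.castSucc_injective _)]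
      rfl
    rw [partialTraceIter, partialTraceIter, ← ih, h, ← partialTrace_mul_emb]

theorem partialTrace_cast (R : TMat N 2 ℂ) {a b : ℕ} (h : a + 1 = b + 1)
    (Z : TMat N (a + 1) W) : partialTrace R (emb (Fin.cast h) Z) =
      emb (Fin.cast (Nat.succ_injective h)) (partialTrace R Z) := by
  obtain rfl : a = b := Nat.succ_injective h
  rw [emb_id, emb_id]

theorem rTrace_cast (R : TMat N 2 ℂ) {a b : ℕ} (h : a = b) (Z : TMat N a W) :
    rTrace R (emb (Fin.cast h) Z) = rTrace R Z := by
  subst h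
  rw [emb_id]

theorem partialTraceIter_shiftHom {R F : TMat N 2 ℂ} (hF : IsUnit F) (hs : IsSkewInvertible R)
    (hRF : TransportedBy R F) (m : ℕ) (h : n + m + 1 = n + 1 + m) (Z : TMat N (n + m) W) :
    partialTraceIter R m (emb (Fin.cast h) (shiftHom hF (n + m) W Z)) =
      shiftHom hF n W (partialTraceIter R m Z) := by
  induction m with
  | zero => exact emb_id (h := rfl) _
  | succ m ih =>
    rw [partialTraceIter, partialTraceIter, ← ih (by omega)]
    congr 1
    rw [← partialTrace_shiftHom hF hs hRF]
    exact partialTrace_cast R (a := n + m + 1) (b := n + 1 + m) h _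

theorem scal_mul_diagonal (X : TMat N n ℂ) (w : W) :
    scal W X * Matrix.diagonal (fun _ => w) = Matrix.diagonal (fun _ => w) * scal W X := by
  ext i j
  rw [Matrix.mul_diagonal, Matrix.diagonal_mul]
  exact Algebra.commutes _ _

theorem shiftHom_diagonal {F : TMat N 2 ℂ} (hF : IsUnit F) (w : W) :
    shiftHom hF n W (Matrix.diagonal fun _ => w) = Matrix.diagonal fun _ => w := by
  rw [shiftHom_apply, emb_diagonal, ← mul_assoc, scal_mul_diagonal,
    mul_assoc, scal_mul_inv (chain_mul_chainInv hF _ _), mul_one]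

theorem eq_diagonal_rTrace (R : TMat N 2 ℂ) (Y : TMat N 0 W) :
    Y = Matrix.diagonal fun _ => rTrace R Y := by
  ext i j
  rw [Subsingleton.elim j i, Matrix.diagonal_apply_eq, rTrace, Fintype.sum_unique,
    Fintype.sum_unique, Subsingleton.elim i default]
  simp

/-- Operators on `V^{⊗ m}` are moved by conjugation with products of `F` to operators on
`V^{⊗ (n + m)}`; the R-trace over the last `m` factors of the result is a multiple of the
identity. -/
theorem exists_shift {R F : TMat N 2 ℂ} (hF : IsRMatrix F) (hs : IsSkewInvertible R)
    (hRF : TransportedBy R F) (M : Matrix (Fin N) (Fin N) W) (n m : ℕ) :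
    ∃ φ : TMat N m W →ₐ[ℂ] TMat N (n + m) W,
      (∀ i, i < m → φ (copy F M m i) = copy F M (n + m) (n + i)) ∧
      (∀ i, i + 1 < m → φ (scal W (leg m i R)) = scal W (leg (n + m) (n + i) R)) ∧
      ∀ Z, partialTraceIter R m (φ Z) = Matrix.diagonal fun _ => rTrace R Z := by
  induction n with
  | zero =>
    refine ⟨embHom N W (Fin.cast_injective (zero_add m).symm), ?_, ?_, ?_⟩
    · intro i hi
      rw [embHom_apply, emb_copy F M (n := m) (k := 0 + m)
        (Fin.cast_injective (zero_add m).symm) (fun _ => rfl) hi, zero_add i]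
    · intro i hi
      rw [embHom_apply, emb_scal, emb_leg (j := i) (Fin.cast_injective _) hi rfl rfl, zero_add i]
    · intro Z
      rw [eq_diagonal_rTrace R (partialTraceIter R m _), rTrace_partialTraceIter, embHom_apply,
        rTrace_cast]
  | succ n ih =>
    obtain ⟨φ, h1, h2, h3⟩ := ih
    have h : n + m + 1 = n + 1 + m := by omega
    refine ⟨(embHom N W (Fin.cast_injective h)).comp ((shiftHom hF.isUnit (n + m) W).comp φ),
      ?_, ?_, ?_⟩
    · intro i hi
      rw [AlgHom.comp_apply, AlgHom.comp_apply, h1 i hi, shiftHom_copy M hF (by omega),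
        embHom_apply, emb_copy F M (n := n + m + 1) (k := n + 1 + m)
          (Fin.cast_injective h) (fun _ => rfl) (by omega)]
      congr 1; omega
    · intro i hi
      rw [AlgHom.comp_apply, AlgHom.comp_apply, h2 i hi, shiftHom_scal_leg _ hRF (by omega),
        embHom_apply, emb_scal, emb_leg (j := n + 1 + i) (Fin.cast_injective _) (by omega)
          (by simp; omega) (by simp; omega)]
    · intro Z
      rw [AlgHom.comp_apply, AlgHom.comp_apply, embHom_apply,
        partialTraceIter_shiftHom hF.isUnit hs hRF, h3, shiftHom_diagonal]

/-- The subalgebra generated by the `R_i`. For an invertible matrix `R` this is the image of the group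
algebra of the braid group in `End (V^{⊗ n})`. -/
def braidImage (R : TMat N 2 ℂ) (n : ℕ) : Subalgebra ℂ (TMat N n ℂ) :=
  Algebra.adjoin ℂ {X | ∃ i, i + 1 < n ∧ X = leg n i R}

theorem leg_mem_braidImage (R : TMat N 2 ℂ) {n i : ℕ} (h : i + 1 < n) :
    leg n i R ∈ braidImage R n := Algebra.subset_adjoin ⟨i, h, rfl⟩

/-- The product `M_{\overline 1} ⋯ M_{\overline n}`. -/
def copies (F : TMat N 2 ℂ) (M : Matrix (Fin N) (Fin N) W) (n : ℕ) : TMat N n W :=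
  ((List.range n).map (copy F M n)).prod

/-- `Tr_{R(1, …, n)} (M_{\overline 1} ⋯ M_{\overline n} X)`, as a linear map. -/
def chOp (R F : TMat N 2 ℂ) (M : Matrix (Fin N) (Fin N) W) (n : ℕ) : TMat N n ℂ →ₗ[ℂ] W where
  toFun X := rTrace R (copies F M n * scal W X)
  map_add' X Y := by
    rw [← scalHom_apply, map_add, mul_add]
    simp [rTrace, smul_add, Finset.sum_add_distrib]
  map_smul' c X := by
    rw [← scalHom_apply, map_smul, mul_smul_comm]
    simp only [rTrace, Matrix.smul_apply, Finset.smul_sum, RingHom.id_apply, scalHom_apply]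
    simp only [smul_comm c]

theorem chOp_apply (R F : TMat N 2 ℂ) (M : Matrix (Fin N) (Fin N) W) (X : TMat N n ℂ) :
    chOp R F M n X = rTrace R (copies F M n * scal W X) := rfl

theorem rTrace_mul_diagonal_mul (R : TMat N 2 ℂ) (A : TMat N n W) (w : W) (X : TMat N n ℂ) :
    rTrace R (A * Matrix.diagonal (fun _ => w) * scal W X) = rTrace R (A * scal W X) * w := by
  rw [mul_assoc, ← scal_mul_diagonal, ← mul_assoc]
  simp only [rTrace, Matrix.mul_diagonal, Finset.sum_mul, smul_mul_assoc]

/-- The product of R-traces is the R-trace of the juxtaposition. -/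
theorem chOp_mul_chOp {R F : TMat N 2 ℂ} (hF : IsRMatrix F) (hs : IsSkewInvertible R)
    (hRF : TransportedBy R F) (M : Matrix (Fin N) (Fin N) W) {n m : ℕ} (X : TMat N n ℂ)
    {Y : TMat N m ℂ} (hY : Y ∈ braidImage R m) :
    chOp R F M n X * chOp R F M m Y =
      chOp R F M (n + m) (emb (Fin.castAdd m) X * emb (Fin.natAdd n) Y) := by
  obtain ⟨φ, h1, h2, h3⟩ := exists_shift hF hs hRF M n m
  have hφY : φ (scal W Y) = scal W (emb (Fin.natAdd n) Y) := by
    have : Set.EqOn (φ.comp (scalHom N m W))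
        ((scalHom N (n + m) W).comp (embHom N ℂ (Fin.natAdd_injective m n)))
        {X | ∃ i, i + 1 < m ∧ X = leg m i R} := by
      rintro _ ⟨i, hi, rfl⟩
      rw [AlgHom.comp_apply, AlgHom.comp_apply, scalHom_apply, h2 i hi, embHom_apply,
        emb_leg (j := n + i) (Fin.natAdd_injective m n) hi rfl rfl, scalHom_apply]
    exact AlgHom.eqOn_adjoin_iff.2 this hY
  have hc : copies F M (n + m) = emb (Fin.castAdd m) (copies F M n) * φ (copies F M m) := by
    rw [copies, List.range_add, List.map_append, List.prod_append, copies, copies,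
      ← embHom_apply (Fin.castAdd_injective n m), map_list_prod, map_list_prod, List.map_map,
      List.map_map, List.map_map]
    congr 2
    · refine List.map_congr_left fun i hi => ?_
      exact (emb_copy F M (Fin.castAdd_injective n m) (fun _ => rfl) (List.mem_range.1 hi)).symm
    · refine List.map_congr_left fun i hi => ?_
      exact (h1 i (List.mem_range.1 hi)).symm
  have hcomm : emb (Fin.castAdd m) X * emb (Fin.natAdd n) Y =
      emb (Fin.natAdd n) Y * emb (Fin.castAdd m) X :=
    emb_commute (Fin.castAdd_injective n m) (Fin.natAdd_injective m n) (fun a b => by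
      simp only [ne_eq, Fin.ext_iff, Fin.val_castAdd, Fin.val_natAdd]; omega) X Y
  rw [chOp_apply, chOp_apply, chOp_apply, hcomm, hc, scal_mul, ← hφY, ← emb_scal, ← mul_assoc,
    mul_assoc (emb _ _), ← map_mul, ← rTrace_partialTraceIter, partialTraceIter_mul_emb,
    partialTraceIter_emb_mul, h3, rTrace_mul_diagonal_mul]

/-! #### Cyclicity -/

theorem commute_emb_tensorD {R : TMat N 2 ℂ} {k : ℕ} {f : Fin k → Fin n}
    (hf : Function.Injective f) {X : TMat N k ℂ} (hX : Commute X (tensorD R k)) :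
    Commute (emb f X) (tensorD R n) := by
  classical
  ext i j
  rw [emb_mul_apply hf, mul_emb_apply hf]
  have hsplit : ∀ i j : Fin n → Fin N, tensorD R n i j =
      tensorD R k (i ∘ f) (j ∘ f) * ∏ l with ∀ a, f a ≠ l, matD R (i l) (j l) := by
    intro i j
    simp only [tensorD, Matrix.of_apply]
    rw [← Finset.prod_filter_not_mul_prod_filter _ (fun l => ∀ a, f a ≠ l)]
    congr 1
    have : (Finset.univ.filter fun l => ¬ ∀ a, f a ≠ l) = Finset.univ.map ⟨f, hf⟩ := by
      ext l
      simp
    rw [this, Finset.prod_map]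
    rfl
  have h1 : ∀ u, tensorD R n (Function.extend f u i) j =
      tensorD R k u (j ∘ f) * ∏ l with ∀ a, f a ≠ l, matD R (i l) (j l) := by
    intro u
    rw [hsplit, extend_comp_self hf]
    congr 1
    refine Finset.prod_congr rfl fun l hl => ?_
    rw [extend_apply_of_forall_ne u i (Finset.mem_filter.1 hl).2]
  have h2 : ∀ u, tensorD R n i (Function.extend f u j) =
      tensorD R k (i ∘ f) u * ∏ l with ∀ a, f a ≠ l, matD R (i l) (j l) := by
    intro u
    rw [hsplit, extend_comp_self hf]
    congr 1
    refine Finset.prod_congr rfl fun l hl => ?_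
    rw [extend_apply_of_forall_ne u j (Finset.mem_filter.1 hl).2]
  have h3 := congrFun (congrFun hX.eq (i ∘ f)) (j ∘ f)
  rw [Matrix.mul_apply, Matrix.mul_apply] at h3
  simp only [h1, h2]
  rw [← Finset.sum_congr rfl fun u _ => mul_assoc _ _ _, ← Finset.sum_mul, h3, Finset.sum_mul]
  exact Finset.sum_congr rfl fun u _ => by ring

theorem rTrace_eq_trace (R : TMat N 2 ℂ) (Y : TMat N n W) :
    rTrace R Y = Matrix.trace (scal W (tensorD R n) * Y) := by
  simp only [rTrace, Matrix.trace, Matrix.diag, Matrix.mul_apply, scal_apply, tensorD,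
    Matrix.of_apply, Algebra.smul_def]

theorem trace_mul_scal (A : TMat N n W) (X : TMat N n ℂ) :
    Matrix.trace (A * scal W X) = Matrix.trace (scal W X * A) := by
  simp only [Matrix.trace, Matrix.diag, Matrix.mul_apply, scal_apply]
  rw [Finset.sum_comm]
  exact Finset.sum_congr rfl fun i _ => Finset.sum_congr rfl fun j _ =>
    (Algebra.commutes _ _).symm

section

variable {R F : TMat N 2 ℂ} (M : Matrix (Fin N) (Fin N) W)

theorem Commute.conj_of_intertwine {A : Type*} [Monoid A] {w w' r r' x : A} (h1 : w * w' = 1)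
    (h2 : w' * w = 1) (h : w * r' = r * w) (hx : Commute r' x) : Commute r (w * x * w') :=
  calc r * (w * x * w') = w * (r' * x) * w' := by
        rw [← mul_assoc, ← mul_assoc, ← h]; simp only [mul_assoc]
    _ = w * x * (w' * (w * r')) * w' := by
        rw [hx.eq, ← mul_assoc w' w, h2, one_mul]; simp only [mul_assoc]
    _ = w * x * w' * r := by rw [h]; simp only [mul_assoc, h1, mul_one]

/-- `R_i` commutes with the copies to the right of its factors: conjugation by `F_{i+1} F_i` moves
`R_{i+1}`, which commutes with the copy on the factor `i`, to `R_i`. -/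
theorem commute_leg_copy (hF : IsRMatrix F) (hRF : TransportedBy R F) {i j : ℕ} (hij : i + 2 ≤ j)
    (hj : j < n) : Commute (scal W (leg n i R)) (copy F M n j) := by
  have hi1 : ∀ m, leg n m F * leg n m F⁻¹ = 1 := mul_leg_inv (mul_inv_of_isUnit hF.isUnit) n
  have hi2 : ∀ m, leg n m F⁻¹ * leg n m F = 1 := mul_leg_inv (inv_mul_of_isUnit hF.isUnit) n
  induction j, hij using Nat.le_induction with
  | base =>
    have hl := congrArg (scal W) (hRF.leg_left (n := n) (m := i) (by omega))
    rw [mul_assoc (leg n i R), scal_mul, scal_mul (leg n i R)] at hl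
    have h1 : leg n (i + 1) F * leg n i F * (leg n i F⁻¹ * leg n (i + 1) F⁻¹) = 1 := by
      rw [mul_assoc, ← mul_assoc (leg n i F), hi1, one_mul, hi1]
    have h2 := mul_eq_one_comm.1 h1
    have := Commute.conj_of_intertwine (scal_mul_inv h1) (scal_mul_inv h2) hl
      (commute_leg_copy_of_lt F M (j := i) (by omega) (by omega) R)
    simpa only [copy, scal_mul, mul_assoc] using this
  | succ j hj' ih =>
    rw [copy]
    have h1 : ∀ X : TMat N 2 ℂ, Commute (scal W (leg n i R)) (scal W (leg n j X)) := fun X => by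
      have := leg_commute (n := n) (m := i) (r := j) (by omega) R X
      rw [Commute, SemiconjBy, ← scal_mul, this, scal_mul]
    exact ((h1 F).mul_right (ih (by omega))).mul_right (h1 F⁻¹)

/-- The defining relation of the quantum matrix algebra, moved to the other tensor factors. -/
theorem commute_leg_copy_mul_copy (hF : IsRMatrix F) (hRF : TransportedBy R F)
    (hM : Commute (scal W (leg 2 0 R)) (copy F M 2 0 * copy F M 2 1)) {i : ℕ} (hi : i + 1 < n) :
    Commute (scal W (leg n i R)) (copy F M n i * copy F M n (i + 1)) := by
  induction i generalizing n with
  | zero =>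
    have hf : Function.Injective (Fin.castLE hi : Fin 2 → Fin n) := Fin.castLE_injective _
    have := hM.map (embHom N W hf)
    rwa [map_mul, embHom_apply, embHom_apply, embHom_apply, emb_scal,
      emb_leg (j := 0) hf (by omega) rfl rfl, emb_copy F M hf (fun _ => rfl) (by omega),
      emb_copy F M hf (fun _ => rfl) (by omega)] at this
  | succ i ih =>
    obtain ⟨n, rfl⟩ : ∃ k, n = k + 1 := ⟨n - 1, by omega⟩
    have := (ih (n := n) (by omega)).map (shiftHom hF.isUnit n W)
    rwa [map_mul, shiftHom_scal_leg _ hRF (by omega), shiftHom_copy M hF (by omega),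
      shiftHom_copy M hF (by omega)] at this

/-- `R_i` commutes with the copies to the left of its factors, with the product of the two copies on
its factors and with each copy to the right of them. -/
theorem commute_leg_copies (hF : IsRMatrix F) (hRF : TransportedBy R F)
    (hM : Commute (scal W (leg 2 0 R)) (copy F M 2 0 * copy F M 2 1)) {i : ℕ} (hi : i + 1 < n) :
    Commute (scal W (leg n i R)) (copies F M n) := by
  have key : ∀ k, i + 2 ≤ k → k ≤ n →
      Commute (scal W (leg n i R)) ((List.range k).map (copy F M n)).prod := by
    intro k hk
    induction k, hk using Nat.le_induction with
    | base =>
      intro _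
      rw [List.range_succ, List.range_succ, List.map_append, List.map_append, List.prod_append,
        List.prod_append, List.map_singleton, List.map_singleton, List.prod_singleton,
        List.prod_singleton, mul_assoc]
      refine Commute.mul_right ?_ (commute_leg_copy_mul_copy M hF hRF hM hi)
      refine Commute.list_prod_right _ _ fun x hx => ?_
      obtain ⟨j, hj, rfl⟩ := List.mem_map.1 hx
      exact commute_leg_copy_of_lt F M (List.mem_range.1 hj) hi R
    | succ k hk ih =>
      intro hkn
      rw [List.range_succ, List.map_append, List.prod_append, List.map_singleton,
        List.prod_singleton]
      exact (ih (by omega)).mul_right (commute_leg_copy M hF hRF hk (by omega))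
  exact key n hi le_rfl

/-- The R-trace is cyclic on the image of the braid group: this image commutes with
`D_R ⊗ ⋯ ⊗ D_R` and with `M_{\overline 1} ⋯ M_{\overline n}`. -/
theorem chOp_mul_comm (hR : IsRMatrix R) (hF : IsRMatrix F) (hs : IsSkewInvertible R)
    (hRF : TransportedBy R F)
    (hM : Commute (scal W (leg 2 0 R)) (copy F M 2 0 * copy F M 2 1)) {X : TMat N n ℂ}
    (Y : TMat N n ℂ) (hX : X ∈ braidImage R n) :
    chOp R F M n (X * Y) = chOp R F M n (Y * X) := by
  have h1 : Commute (scal W X) (scal W (tensorD R n) * copies F M n) := by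
    induction hX using Algebra.adjoin_induction with
    | mem x hx =>
      obtain ⟨i, hi, rfl⟩ := hx
      refine Commute.mul_right ?_ (commute_leg_copies M hF hRF hM hi)
      rw [leg_of_lt hi]
      exact (commute_emb_tensorD (pair_injective hi) (commute_tensorD_two hR hs)).map
        (scalHom N n W)
    | algebraMap c =>
      rw [← scalHom_apply, AlgHom.commutes]
      exact Algebra.commutes c _
    | add x y _ _ hx hy =>
      rw [← scalHom_apply, map_add]
      exact hx.add_left hy
    | mul x y _ _ hx hy =>
      rw [scal_mul]
      exact hx.mul_left hy
  calc chOp R F M n (X * Y)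
      = Matrix.trace (scal W (tensorD R n) * copies F M n * scal W X * scal W Y) := by
        rw [chOp_apply, rTrace_eq_trace, scal_mul]; simp only [mul_assoc]
    _ = Matrix.trace (scal W X * (scal W (tensorD R n) * copies F M n * scal W Y)) := by
        rw [← h1.eq, mul_assoc]
    _ = chOp R F M n (Y * X) := by
        rw [← trace_mul_scal, chOp_apply, rTrace_eq_trace, scal_mul]; simp only [mul_assoc]

end

end Characters

/-! ### Algebras generated by BMW generators -/

section BMW

variable {A : Type*} [Ring A] [Algebra ℂ A]

/-- The subalgebra generated by `r i, …, r (j - 1)`. -/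
def gen (r : ℕ → A) (i j : ℕ) : Subalgebra ℂ A :=
  Algebra.adjoin ℂ {x | ∃ l, i ≤ l ∧ l < j ∧ x = r l}

theorem mem_gen (r : ℕ → A) {i j l : ℕ} (h1 : i ≤ l) (h2 : l < j) : r l ∈ gen r i j :=
  Algebra.subset_adjoin ⟨l, h1, h2, rfl⟩

theorem gen_mono (r : ℕ → A) {i j i' j' : ℕ} (h1 : i' ≤ i) (h2 : j ≤ j') :
    gen r i j ≤ gen r i' j' :=
  Algebra.adjoin_mono fun _ ⟨l, h3, h4, h5⟩ => ⟨l, h1.trans h3, h4.trans_le h2, h5⟩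

theorem exists_smul_one_of_mem_gen_self {r : ℕ → A} {i : ℕ} {x : A} (hx : x ∈ gen r i i) :
    ∃ c : ℂ, x = c • 1 := by
  have h : gen r i i = ⊥ := by
    rw [gen, ← Algebra.adjoin_empty]
    congr 1
    ext x
    simp only [Set.mem_ofPred_eq, Set.mem_empty_iff_false, iff_false]
    rintro ⟨l, h1, h2, -⟩
    omega
  rw [h, Algebra.mem_bot] at hx
  obtain ⟨c, rfl⟩ := hx
  exact ⟨c, Algebra.algebraMap_eq_smul_one c⟩

theorem commute_of_mem_gen {r : ℕ → A} {i j : ℕ} {x y : A} (hx : x ∈ gen r i j)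
    (h : ∀ l, i ≤ l → l < j → Commute (r l) y) : Commute x y := by
  induction hx using Algebra.adjoin_induction with
  | mem x hx =>
    obtain ⟨l, h1, h2, rfl⟩ := hx
    exact h l h1 h2
  | algebraMap c => exact Algebra.commutes c y
  | add x y _ _ hx hy => exact hx.add_left hy
  | mul x y _ _ hx hy => exact hx.mul_left hy

/-- A subspace that contains `y` and is stable under left multiplication by the generators of
a subalgebra contains all `x * y` with `x` in the subalgebra. -/
theorem gen_mul_mem {r : ℕ → A} {i j : ℕ} {S : Submodule ℂ A}
    (hS : ∀ l, i ≤ l → l < j → ∀ s ∈ S, r l * s ∈ S) {x y : A} (hx : x ∈ gen r i j) (hy : y ∈ S) :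
    x * y ∈ S := by
  induction hx using Algebra.adjoin_induction generalizing y with
  | mem x hx =>
    obtain ⟨l, h1, h2, rfl⟩ := hx
    exact hS l h1 h2 y hy
  | algebraMap c => rw [← Algebra.smul_def]; exact S.smul_mem c hy
  | add x x' _ _ hx hx' => rw [add_mul]; exact S.add_mem (hx hy) (hx' hy)
  | mul x x' _ _ hx hx' => rw [mul_assoc]; exact hx (hx' hy)

/-- `x⁻¹ = x - (q - q⁻¹) + (q - q⁻¹) κ`, the inverse of a generator of a BMW algebra. -/
def bmwInv (q μ : ℂ) (x : A) : A := x - (q - q⁻¹) • (1 : A) + (q - q⁻¹) • kappa q μ x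

/-- `r 0, …, r (n - 1)` satisfy the relations of the generators of a Birman-Murakami-Wenzl algebra
on `n + 1` strands. -/
structure IsBMWGens (q μ : ℂ) (r : ℕ → A) (n : ℕ) : Prop where
  q_ne : q ≠ 0
  delta_ne : q - q⁻¹ ≠ 0
  mu_ne : μ ≠ 0
  eta_ne : eta q μ ≠ 0
  kappa_mul : ∀ i < n, kappa q μ (r i) * r i = μ • kappa q μ (r i)
  comm : ∀ i j, i + 1 < j → j < n → Commute (r i) (r j)
  braid : ∀ i, i + 1 < n → r i * r (i + 1) * r i = r (i + 1) * r i * r (i + 1)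
  KK : ∀ i, i + 1 < n → kappa q μ (r (i + 1)) * kappa q μ (r i) =
    r i * r (i + 1) * kappa q μ (r i)
  KK_inv : ∀ i, i + 1 < n → kappa q μ (r (i + 1)) * kappa q μ (r i) =
    bmwInv q μ (r i) * bmwInv q μ (r (i + 1)) * kappa q μ (r i)
  KKK : ∀ i, i + 1 < n →
    kappa q μ (r i) * kappa q μ (r (i + 1)) * kappa q μ (r i) = kappa q μ (r i)

theorem kappa_eq (q μ : ℂ) (hq : q ≠ 0) (x : A) :
    kappa q μ x = (μ * (q - q⁻¹))⁻¹ • (1 + (q - q⁻¹) • x - x * x) := by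
  rw [kappa]
  congr 1
  simp only [sub_mul, mul_add, smul_mul_assoc, mul_smul_comm, one_mul, mul_one, smul_sub,
    smul_smul, inv_mul_cancel₀ hq, one_smul, sub_smul]
  abel

theorem kappa_commute {q μ : ℂ} {x y : A} (h : Commute x y) : Commute (kappa q μ x) y := by
  refine Commute.smul_left (Commute.mul_left ?_ ?_) _
  · exact ((Commute.one_left y).smul_left q).sub_left h
  · exact ((Commute.one_left y).smul_left q⁻¹).add_left h

theorem kappa_intertwine {q μ : ℂ} {w x y : A} (h : w * x = y * w) :
    w * kappa q μ x = kappa q μ y * w := by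
  simp only [kappa, mul_smul_comm, smul_mul_assoc, mul_sub, mul_add, sub_mul, add_mul, mul_one,
    one_mul, ← mul_assoc, h]
  simp only [mul_assoc, h]

theorem mem_of_kappa {q μ : ℂ} {x : A} {S : Subalgebra ℂ A} (hx : x ∈ S) : kappa q μ x ∈ S :=
  S.smul_mem (S.mul_mem (S.sub_mem (S.smul_mem S.one_mem _) hx)
    (S.add_mem (S.smul_mem S.one_mem _) hx)) _

theorem mem_of_bmwInv {q μ : ℂ} {x : A} {S : Subalgebra ℂ A} (hx : x ∈ S) : bmwInv q μ x ∈ S :=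
  S.add_mem (S.sub_mem hx (S.smul_mem S.one_mem _)) (S.smul_mem (mem_of_kappa hx) _)

theorem mul_kappa_comm (q μ : ℂ) (x : A) : x * kappa q μ x = kappa q μ x * x :=
  kappa_intertwine rfl

section Single

variable {q μ : ℂ} {x : A}

theorem mul_self_eq (hq : q ≠ 0) (hd : q - q⁻¹ ≠ 0) (hμ : μ ≠ 0) :
    x * x = 1 + (q - q⁻¹) • x - (μ * (q - q⁻¹)) • kappa q μ x := by
  rw [kappa_eq q μ hq, smul_smul, mul_inv_cancel₀ (mul_ne_zero hμ hd), one_smul]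
  abel

theorem kappa_mul_self (hk : kappa q μ x * x = μ • kappa q μ x) :
    kappa q μ x * kappa q μ x = eta q μ • kappa q μ x := by
  have h : ∀ c d : ℂ, kappa q μ x * (c • (1 : A) + d • x) = (c + d * μ) • kappa q μ x := by
    intro c d
    rw [mul_add, mul_smul_comm, mul_smul_comm, mul_one, hk, smul_smul, add_smul]
  have h1 : kappa q μ x * (q • (1 : A) - x) = (q - μ) • kappa q μ x := by
    have := h q (-1)
    rwa [neg_one_smul, ← sub_eq_add_neg, neg_one_mul, ← sub_eq_add_neg] at this
  have h2 : kappa q μ x * (q⁻¹ • (1 : A) + x) = (q⁻¹ + μ) • kappa q μ x := by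
    simpa using h q⁻¹ 1
  conv_lhs => rw [kappa.eq_def q μ x]
  rw [← kappa, kappa.eq_def q μ x, mul_smul_comm, ← kappa.eq_def q μ x, ← mul_assoc, h1,
    smul_mul_assoc, h2, smul_smul, smul_smul, eta]
  congr 1
  rw [div_eq_mul_inv]
  ring

theorem mul_bmwInv (hq : q ≠ 0) (hd : q - q⁻¹ ≠ 0) (hμ : μ ≠ 0)
    (hk : kappa q μ x * x = μ • kappa q μ x) : x * bmwInv q μ x = 1 := by
  rw [bmwInv, mul_add, mul_sub, mul_smul_comm, mul_smul_comm, mul_one, mul_kappa_comm, hk,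
    mul_self_eq hq hd hμ, smul_smul, mul_comm μ]
  abel

theorem bmwInv_mul (hq : q ≠ 0) (hd : q - q⁻¹ ≠ 0) (hμ : μ ≠ 0)
    (hk : kappa q μ x * x = μ • kappa q μ x) : bmwInv q μ x * x = 1 := by
  rw [bmwInv, add_mul, sub_mul, smul_mul_assoc, smul_mul_assoc, one_mul, hk,
    mul_self_eq hq hd hμ, smul_smul, mul_comm μ]
  abel

end Single

namespace IsBMWGens

variable {q μ : ℂ} {r : ℕ → A} {n : ℕ} (h : IsBMWGens q μ r n)

include h

theorem mul_inv' {i : ℕ} (hi : i < n) : r i * bmwInv q μ (r i) = 1 :=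
  mul_bmwInv h.q_ne h.delta_ne h.mu_ne (h.kappa_mul i hi)

theorem inv_mul' {i : ℕ} (hi : i < n) : bmwInv q μ (r i) * r i = 1 :=
  bmwInv_mul h.q_ne h.delta_ne h.mu_ne (h.kappa_mul i hi)

/-! The relations for `K₂ K₁` imply those for `K₁ K₂` by conjugation with the half twist
`r₁ r₂ r₁`, which exchanges the two generators. -/

theorem halfTwist_right {i : ℕ} (hi : i + 1 < n) :
    r i * r (i + 1) * r i * r i = r (i + 1) * (r i * r (i + 1) * r i) := by
  rw [h.braid i hi, mul_assoc, mul_assoc, ← mul_assoc (r i), ← h.braid i hi]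

theorem halfTwist_left {i : ℕ} (hi : i + 1 < n) :
    r i * r (i + 1) * r i * r (i + 1) = r i * (r i * r (i + 1) * r i) := by
  rw [h.braid i hi, ← h.braid i hi, mul_assoc, mul_assoc, ← mul_assoc (r (i + 1)), ← h.braid i hi]

theorem eq_of_halfTwist_mul {i : ℕ} (hi : i + 1 < n) {x y : A}
    (hxy : r i * r (i + 1) * r i * x = r i * r (i + 1) * r i * y) : x = y := by
  have h1 : bmwInv q μ (r i) * (bmwInv q μ (r (i + 1)) * bmwInv q μ (r i)) *
      (r i * r (i + 1) * r i) = 1 := by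
    have e1 := h.inv_mul' (i := i) (by omega)
    have e2 := h.inv_mul' hi
    rw [mul_assoc, mul_assoc, mul_assoc (r i), ← mul_assoc _ (r i), e1, one_mul,
      ← mul_assoc _ (r (i + 1)), e2, one_mul, e1]
  rw [← one_mul x, ← h1, mul_assoc, hxy, ← mul_assoc, h1, one_mul]

theorem KK' {i : ℕ} (hi : i + 1 < n) : kappa q μ (r i) * kappa q μ (r (i + 1)) =
    r (i + 1) * r i * kappa q μ (r (i + 1)) := by
  have hr := h.halfTwist_right hi
  have hl := h.halfTwist_left hi
  have kr := kappa_intertwine (q := q) (μ := μ) hr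
  have kl := kappa_intertwine (q := q) (μ := μ) hl
  apply h.eq_of_halfTwist_mul hi
  generalize r i * r (i + 1) * r i = w at *
  rw [SemiconjBy.mul_right kr kl, SemiconjBy.mul_right (SemiconjBy.mul_right hl hr) kl, h.KK i hi]

theorem KK_inv' {i : ℕ} (hi : i + 1 < n) : kappa q μ (r i) * kappa q μ (r (i + 1)) =
    bmwInv q μ (r (i + 1)) * bmwInv q μ (r i) * kappa q μ (r (i + 1)) := by
  have hr := h.halfTwist_right hi
  have hl := h.halfTwist_left hi
  have kr := kappa_intertwine (q := q) (μ := μ) hr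
  have kl := kappa_intertwine (q := q) (μ := μ) hl
  have ir := mul_inv_eq_inv_mul (h.mul_inv' (by omega)) (h.inv_mul' hi) hr
  have il := mul_inv_eq_inv_mul (h.mul_inv' hi) (h.inv_mul' (by omega)) hl
  apply h.eq_of_halfTwist_mul hi
  generalize r i * r (i + 1) * r i = w at *
  rw [SemiconjBy.mul_right kr kl, SemiconjBy.mul_right (SemiconjBy.mul_right il ir) kl,
    h.KK_inv i hi]

theorem KKK' {i : ℕ} (hi : i + 1 < n) :
    kappa q μ (r (i + 1)) * kappa q μ (r i) * kappa q μ (r (i + 1)) = kappa q μ (r (i + 1)) := by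
  have hr := h.halfTwist_right hi
  have hl := h.halfTwist_left hi
  have kr := kappa_intertwine (q := q) (μ := μ) hr
  have kl := kappa_intertwine (q := q) (μ := μ) hl
  apply h.eq_of_halfTwist_mul hi
  generalize r i * r (i + 1) * r i = w at *
  rw [SemiconjBy.mul_right (SemiconjBy.mul_right kl kr) kl, kl, h.KKK i hi]

/-- `r₂ κ₁ κ₂ = r₁⁻¹ κ₂`. -/
theorem mul_kappa_kappa {i : ℕ} (hi : i + 1 < n) :
    r (i + 1) * kappa q μ (r i) * kappa q μ (r (i + 1)) =
      bmwInv q μ (r i) * kappa q μ (r (i + 1)) := by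
  rw [mul_assoc, h.KK_inv' hi, ← mul_assoc, ← mul_assoc, h.mul_inv' hi, one_mul]

/-- `r₂ κ₁ r₂ = r₁⁻¹ κ₂ r₁⁻¹`. -/
theorem mul_kappa_mul {i : ℕ} (hi : i + 1 < n) :
    r (i + 1) * kappa q μ (r i) * r (i + 1) =
      bmwInv q μ (r i) * kappa q μ (r (i + 1)) * bmwInv q μ (r i) := by
  have h1 : bmwInv q μ (r i) * r i = 1 := h.inv_mul' (by omega)
  have h1' : r i * bmwInv q μ (r i) = 1 := h.mul_inv' (by omega)
  have h2 : bmwInv q μ (r (i + 1)) * r (i + 1) = 1 := h.inv_mul' hi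
  have h2' : r (i + 1) * bmwInv q μ (r (i + 1)) = 1 := h.mul_inv' hi
  -- `κ₂ κ₁ = r₁⁻¹ r₂⁻¹ κ₁ = κ₂ r₁⁻¹ r₂⁻¹`
  have e : bmwInv q μ (r i) * bmwInv q μ (r (i + 1)) * kappa q μ (r i) =
      kappa q μ (r (i + 1)) * (bmwInv q μ (r i) * bmwInv q μ (r (i + 1))) := by
    apply kappa_intertwine
    have h3 : r (i + 1) * r i * (bmwInv q μ (r i) * bmwInv q μ (r (i + 1))) = 1 := by
      rw [mul_assoc, ← mul_assoc (r i), h1', one_mul, h2']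
    have h4 : bmwInv q μ (r i) * bmwInv q μ (r (i + 1)) * (r (i + 1) * r i) = 1 := by
      rw [mul_assoc, ← mul_assoc _ (r (i + 1)), h2, one_mul, h1]
    have h5 : r (i + 1) * r i * r (i + 1) = r i * (r (i + 1) * r i) := by
      rw [← h.braid i hi, mul_assoc]
    generalize bmwInv q μ (r i) * bmwInv q μ (r (i + 1)) = w at *
    rw [← one_mul (r (i + 1) * w), ← h4, mul_assoc, ← mul_assoc _ (r (i + 1)), h5, mul_assoc (r i),
      h3, mul_one]
  calc r (i + 1) * kappa q μ (r i) * r (i + 1)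
      = bmwInv q μ (r i) * (r i * r (i + 1) * kappa q μ (r i)) * r (i + 1) := by
        rw [← mul_assoc, ← mul_assoc, h1, one_mul]
    _ = bmwInv q μ (r i) * kappa q μ (r (i + 1)) * bmwInv q μ (r i) := by
        rw [← h.KK i hi, h.KK_inv i hi, e]
        simp only [mul_assoc, h2, mul_one]

theorem kappa_mul_kappa {i : ℕ} (hi : i + 1 < n) :
    kappa q μ (r (i + 1)) * r i * kappa q μ (r (i + 1)) = μ⁻¹ • kappa q μ (r (i + 1)) := by
  have h1 : kappa q μ (r (i + 1)) = μ • (kappa q μ (r (i + 1)) * r i * kappa q μ (r (i + 1))) := by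
    conv_lhs => rw [← h.KKK' hi, mul_assoc, h.KK' hi, ← mul_assoc, ← mul_assoc,
      h.kappa_mul _ hi]
    simp only [smul_mul_assoc]
  conv_rhs => rw [h1]
  rw [smul_smul, inv_mul_cancel₀ h.mu_ne, one_smul]

end IsBMWGens

end BMW

/-! ### Elimination of the last generator -/

section Reduction

variable {A : Type*} [Ring A] [Algebra ℂ A] {q μ : ℂ} {r : ℕ → A} {n : ℕ}

/-- The span of all `b * y * c` with `b`, `c` in the subalgebra of the first `j` generators and
`y ∈ {1, r j, κ j}`. -/
def bmwSpan (q μ : ℂ) (r : ℕ → A) (j : ℕ) : Submodule ℂ A :=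
  Submodule.span ℂ {x | ∃ b ∈ gen r 0 j, ∃ c ∈ gen r 0 j, ∃ y,
    (y = 1 ∨ y = r j ∨ y = kappa q μ (r j)) ∧ x = b * y * c}

theorem mem_bmwSpan {j : ℕ} {b c y : A} (hb : b ∈ gen r 0 j) (hc : c ∈ gen r 0 j)
    (hy : y = 1 ∨ y = r j ∨ y = kappa q μ (r j)) : b * y * c ∈ bmwSpan q μ r j :=
  Submodule.subset_span ⟨b, hb, c, hc, y, hy, rfl⟩

theorem one_mem_bmwSpan (q μ : ℂ) (r : ℕ → A) (j : ℕ) : (1 : A) ∈ bmwSpan q μ r j :=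
  Submodule.subset_span ⟨1, one_mem _, 1, one_mem _, 1, Or.inl rfl, by simp⟩

theorem mul_mem_bmwSpan {j : ℕ} {b c x : A} (hb : b ∈ gen r 0 j) (hc : c ∈ gen r 0 j)
    (hx : x ∈ bmwSpan q μ r j) : b * x * c ∈ bmwSpan q μ r j := by
  induction hx using Submodule.span_induction with
  | mem x hx =>
    obtain ⟨b', hb', c', hc', y, hy, rfl⟩ := hx
    have := mem_bmwSpan (q := q) (μ := μ) (mul_mem hb hb') (mul_mem hc' hc) hy
    simpa only [mul_assoc] using this
  | zero => simp
  | add x y _ _ hx hy => rw [mul_add, add_mul]; exact add_mem hx hy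
  | smul a x _ hx => rw [mul_smul_comm, smul_mul_assoc]; exact Submodule.smul_mem _ _ hx

namespace IsBMWGens

variable (h : IsBMWGens q μ r n)

include h

theorem commute_gen {j : ℕ} (hj : j + 1 < n) {c : A} (hc : c ∈ gen r 0 j) :
    Commute c (r (j + 1)) :=
  commute_of_mem_gen hc fun l _ hl => h.comm l (j + 1) (by omega) hj

theorem mul_mem_bmwSpan_of_single {j : ℕ} (hj : j < n) {y : A}
    (hy : y = 1 ∨ y = r j ∨ y = kappa q μ (r j)) : r j * y ∈ bmwSpan q μ r j := by
  have one : (1 : A) ∈ gen r 0 j := one_mem _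
  have h1 : ∀ y : A, (y = 1 ∨ y = r j ∨ y = kappa q μ (r j)) → y ∈ bmwSpan q μ r j := fun y hy => by
    simpa using mem_bmwSpan one one hy
  rcases hy with rfl | rfl | rfl
  · rw [mul_one]
    exact h1 _ (Or.inr (Or.inl rfl))
  · rw [mul_self_eq h.q_ne h.delta_ne h.mu_ne]
    exact sub_mem (add_mem (h1 _ (Or.inl rfl)) (Submodule.smul_mem _ _ (h1 _ (Or.inr (Or.inl rfl)))))
      (Submodule.smul_mem _ _ (h1 _ (Or.inr (Or.inr rfl))))
  · rw [mul_kappa_comm, h.kappa_mul j hj]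
    exact Submodule.smul_mem _ _ (h1 _ (Or.inr (Or.inr rfl)))

/-- The computation with three strands behind `gen_le_bmwSpan`. -/
theorem mul_mul_mem_bmwSpan {j : ℕ} (hj : j + 1 < n) {z y : A}
    (hz : z = 1 ∨ z = r j ∨ z = kappa q μ (r j))
    (hy : y = 1 ∨ y = r (j + 1) ∨ y = kappa q μ (r (j + 1))) :
    r (j + 1) * z * y ∈ bmwSpan q μ r (j + 1) := by
  have one : (1 : A) ∈ gen r 0 (j + 1) := one_mem _
  have hr : r j ∈ gen r 0 (j + 1) := mem_gen r (by omega) (by omega)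
  have hk : kappa q μ (r j) ∈ gen r 0 (j + 1) := mem_of_kappa hr
  have hi : bmwInv q μ (r j) ∈ gen r 0 (j + 1) := mem_of_bmwInv hr
  rcases hz with rfl | rfl | rfl
  · rw [mul_one]
    exact h.mul_mem_bmwSpan_of_single hj hy
  · rcases hy with rfl | rfl | rfl
    · simpa using mem_bmwSpan (q := q) (μ := μ) (j := j + 1) one hr (Or.inr (Or.inl rfl))
    · rw [← h.braid j hj]
      exact mem_bmwSpan hr hr (Or.inr (Or.inl rfl))
    · rw [← h.KK' hj]
      simpa using mem_bmwSpan (q := q) (μ := μ) (j := j + 1) hk one (Or.inr (Or.inr rfl))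
  · rcases hy with rfl | rfl | rfl
    · simpa using mem_bmwSpan (q := q) (μ := μ) (j := j + 1) one hk (Or.inr (Or.inl rfl))
    · rw [h.mul_kappa_mul hj]
      exact mem_bmwSpan hi hi (Or.inr (Or.inr rfl))
    · rw [h.mul_kappa_kappa hj]
      simpa using mem_bmwSpan (q := q) (μ := μ) (j := j + 1) hi one (Or.inr (Or.inr rfl))

/-- The subalgebra of the first `j + 1` generators is spanned by the products `b * y * c` with
`b`, `c` in the subalgebra of the first `j` generators and `y ∈ {1, r j, κ j}`. -/
theorem gen_le_bmwSpan {j : ℕ} (hj : j < n) {x : A} (hx : x ∈ gen r 0 (j + 1)) :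
    x ∈ bmwSpan q μ r j := by
  induction j generalizing x with
  | zero =>
    rw [← mul_one x]
    refine gen_mul_mem ?_ hx (one_mem_bmwSpan q μ r 0)
    intro l _ hl s hs
    obtain rfl : l = 0 := by omega
    induction hs using Submodule.span_induction with
    | mem s hs =>
      obtain ⟨b, hb, c, hc, y, hy, rfl⟩ := hs
      obtain ⟨t, rfl⟩ := exists_smul_one_of_mem_gen_self hb
      rw [smul_one_mul, smul_mul_assoc, mul_smul_comm, ← mul_assoc, ← one_mul (r 0 * y)]
      exact Submodule.smul_mem _ _ (mul_mem_bmwSpan (one_mem _) hc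
        (h.mul_mem_bmwSpan_of_single hj hy))
    | zero => simp
    | add x y _ _ hx hy => rw [mul_add]; exact add_mem hx hy
    | smul a x _ hx => rw [mul_smul_comm]; exact Submodule.smul_mem _ _ hx
  | succ j ih =>
    rw [← mul_one x]
    refine gen_mul_mem ?_ hx (one_mem_bmwSpan q μ r (j + 1))
    intro l _ hl s hs
    rcases Nat.lt_succ_iff_lt_or_eq.1 hl with hl | rfl
    · simpa using mul_mem_bmwSpan (mem_gen r (Nat.zero_le l) hl) (one_mem _) hs
    induction hs using Submodule.span_induction with
    | mem s hs =>
      obtain ⟨b, hb, c, hc, y, hy, rfl⟩ := hs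
      have hb' := ih (by omega) hb
      clear hb
      rw [← mul_assoc, ← mul_assoc]
      induction hb' using Submodule.span_induction with
      | mem b hb' =>
        obtain ⟨b', hb', c', hc', z, hz, rfl⟩ := hb'
        have e1 := (h.commute_gen hj hb').symm
        have e2 : Commute c' y := by
          have := h.commute_gen hj hc'
          rcases hy with rfl | rfl | rfl
          · exact Commute.one_right c'
          · exact this
          · exact (kappa_commute this.symm).symm
        have e3 : r (j + 1) * (b' * z * c') * y * c = b' * (r (j + 1) * z * y) * (c' * c) := by
          rw [← mul_assoc, ← mul_assoc, e1.eq]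
          simp only [mul_assoc]
          rw [← mul_assoc c', e2.eq, mul_assoc]
        rw [e3]
        exact mul_mem_bmwSpan (gen_mono r le_rfl (by omega) hb')
          (mul_mem (gen_mono r le_rfl (by omega) hc') hc) (h.mul_mul_mem_bmwSpan hj hz hy)
      | zero => simp
      | add x y _ _ hx hy => rw [mul_add, add_mul, add_mul]; exact add_mem hx hy
      | smul a x _ hx =>
        rw [mul_smul_comm, smul_mul_assoc, smul_mul_assoc]; exact Submodule.smul_mem _ _ hx
    | zero => simp
    | add x y _ _ hx hy => rw [mul_add]; exact add_mem hx hy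
    | smul a x _ hx => rw [mul_smul_comm]; exact Submodule.smul_mem _ _ hx

omit h in
/-- The left multiples of `y` by elements of a subalgebra. -/
theorem mem_map_mulRight {S : Subalgebra ℂ A} {x y : A} :
    x ∈ (Subalgebra.toSubmodule S).map (LinearMap.mulRight ℂ y) ↔ ∃ b ∈ S, b * y = x := Iff.rfl

/-- The left ideal generated by the last `κ` is the space of its multiples by elements that do not
involve the last generator. -/
theorem exists_mul_kappa_eq {j : ℕ} (hj : j < n) {x : A} (hx : x ∈ gen r 0 (j + 1)) :
    ∃ b ∈ gen r 0 j, b * kappa q μ (r j) = x * kappa q μ (r j) := by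
  rw [← mem_map_mulRight]
  refine gen_mul_mem ?_ hx (mem_map_mulRight.2 ⟨1, one_mem _, one_mul _⟩)
  rintro l - hl s hs
  obtain ⟨b, hb, rfl⟩ := mem_map_mulRight.1 hs
  clear hs
  rcases Nat.lt_succ_iff_lt_or_eq.1 hl with hl | rfl
  · exact mem_map_mulRight.2 ⟨r l * b, mul_mem (mem_gen r (Nat.zero_le l) hl) hb, mul_assoc _ _ _⟩
  rcases l with _ | j
  · obtain ⟨t, rfl⟩ := exists_smul_one_of_mem_gen_self hb
    rw [smul_one_mul, mul_smul_comm, mul_kappa_comm, h.kappa_mul 0 hj]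
    refine Submodule.smul_mem _ _ (Submodule.smul_mem _ _ ?_)
    exact mem_map_mulRight.2 ⟨1, one_mem _, one_mul _⟩
  · have hb' := h.gen_le_bmwSpan (by omega) hb
    have hr : r j ∈ gen r 0 (j + 1) := mem_gen r (by omega) (by omega)
    have hk : kappa q μ (r j) ∈ gen r 0 (j + 1) := mem_of_kappa hr
    have hi : bmwInv q μ (r j) ∈ gen r 0 (j + 1) := mem_of_bmwInv hr
    rw [← mul_assoc]
    clear hb
    induction hb' using Submodule.span_induction with
    | mem b hb' =>
      obtain ⟨b', hb', c', hc', z, hz, rfl⟩ := hb'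
      have e1 := (h.commute_gen hj hb').symm
      have e2 : Commute c' (kappa q μ (r (j + 1))) :=
        (kappa_commute (h.commute_gen hj hc').symm).symm
      have e3 : r (j + 1) * (b' * z * c') * kappa q μ (r (j + 1)) =
          b' * (r (j + 1) * z * kappa q μ (r (j + 1)) * c') := by
        rw [← mul_assoc, ← mul_assoc, e1.eq]
        simp only [mul_assoc, e2.eq]
      have e4 : ∃ d ∈ gen r 0 (j + 1),
          r (j + 1) * z * kappa q μ (r (j + 1)) = d * kappa q μ (r (j + 1)) := by
        rcases hz with rfl | rfl | rfl
        · refine ⟨μ • 1, Subalgebra.smul_mem _ (one_mem _) _, ?_⟩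
          rw [mul_one, mul_kappa_comm, h.kappa_mul _ hj, smul_one_mul]
        · exact ⟨_, hk, (h.KK' hj).symm⟩
        · exact ⟨_, hi, h.mul_kappa_kappa hj⟩
      obtain ⟨d, hd, e4⟩ := e4
      rw [e3, e4, mul_assoc, ← e2.eq, ← mul_assoc, ← mul_assoc]
      exact mem_map_mulRight.2 ⟨_, mul_mem (mul_mem (gen_mono r le_rfl (by omega) hb') hd)
        (gen_mono r le_rfl (by omega) hc'), rfl⟩
    | zero => simp
    | add x y _ _ hx hy => rw [mul_add, add_mul]; exact add_mem hx hy
    | smul a x _ hx => rw [mul_smul_comm, smul_mul_assoc]; exact Submodule.smul_mem _ _ hx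

/-- `κ b κ` for an element `b` that does not involve the last generator. -/
theorem exists_kappa_mul_kappa_eq {j : ℕ} (hj : j + 1 < n) {x : A} (hx : x ∈ gen r 0 (j + 1)) :
    ∃ b ∈ gen r 0 j, b * kappa q μ (r (j + 1)) =
      kappa q μ (r (j + 1)) * x * kappa q μ (r (j + 1)) := by
  rw [← mem_map_mulRight]
  have hx' := h.gen_le_bmwSpan (by omega) hx
  clear hx
  induction hx' using Submodule.span_induction with
  | mem x hx =>
    obtain ⟨b, hb, c, hc, z, hz, rfl⟩ := hx
    have e1 : Commute (kappa q μ (r (j + 1))) b := kappa_commute (h.commute_gen hj hb).symm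
    have e2 : Commute (kappa q μ (r (j + 1))) c := kappa_commute (h.commute_gen hj hc).symm
    have e3 : kappa q μ (r (j + 1)) * (b * z * c) * kappa q μ (r (j + 1)) =
        b * (kappa q μ (r (j + 1)) * z * kappa q μ (r (j + 1))) * c := by
      rw [← mul_assoc, ← mul_assoc, e1.eq]
      simp only [mul_assoc, e2.eq]
    have e4 : ∃ t : ℂ, kappa q μ (r (j + 1)) * z * kappa q μ (r (j + 1)) =
        t • kappa q μ (r (j + 1)) := by
      rcases hz with rfl | rfl | rfl
      · exact ⟨_, by rw [mul_one]; exact kappa_mul_self (h.kappa_mul _ hj)⟩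
      · exact ⟨_, h.kappa_mul_kappa hj⟩
      · exact ⟨1, by rw [one_smul]; exact h.KKK' hj⟩
    obtain ⟨t, e4⟩ := e4
    rw [e3, e4, mul_smul_comm, smul_mul_assoc, mul_assoc, e2.eq, ← mul_assoc]
    exact Submodule.smul_mem _ _ (mem_map_mulRight.2 ⟨_, mul_mem hb hc, rfl⟩)
  | zero => simp
  | add x y _ _ hx hy => rw [mul_add, add_mul]; exact add_mem hx hy
  | smul a x _ hx => rw [mul_smul_comm, smul_mul_assoc]; exact Submodule.smul_mem _ _ hx

end IsBMWGens

/-! ### Traces that vanish on products over complementary sets of strands -/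

/-- `r j * r (j + 1) * ⋯ * r (j + l - 1)`. -/
def word (r : ℕ → A) : ℕ → ℕ → A
  | _, 0 => 1
  | j, l + 1 => r j * word r (j + 1) l

theorem word_mem_gen (r : ℕ → A) (j l : ℕ) : word r j l ∈ gen r j (j + l) := by
  induction l generalizing j with
  | zero => exact one_mem _
  | succ l ih =>
    exact mul_mem (mem_gen r le_rfl (by omega)) (gen_mono r (by omega) (by omega) (ih (j + 1)))

/-- A linear map on an algebra with generators `r 0, …, r (n - 1)`, thought of as associated with
`n + 1` strands, that is cyclic and vanishes on all products of an element that only involves the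
first `j + 1` strands with one that only involves the other ones. -/
structure IsSplitTrace {Z : Type*} [AddCommGroup Z] [Module ℂ Z] (r : ℕ → A) (n : ℕ)
    (τ : A →ₗ[ℂ] Z) : Prop where
  comm : ∀ x ∈ gen r 0 n, ∀ y ∈ gen r 0 n, τ (x * y) = τ (y * x)
  split : ∀ j < n, ∀ x ∈ gen r 0 j, ∀ y ∈ gen r (j + 1) n, τ (x * y) = 0

namespace IsSplitTrace

variable {Z : Type*} [AddCommGroup Z] [Module ℂ Z] {τ : A →ₗ[ℂ] Z}

/-- A split trace vanishes on the ideal generated by the `κ`'s. -/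
theorem map_mul_kappa (hτ : IsSplitTrace r n τ) (h : IsBMWGens q μ r n)
    (h1 : n = 1 → τ (kappa q μ (r 0)) = 0) {i : ℕ} (hi : i < n) {x : A} (hx : x ∈ gen r 0 n) :
    τ (x * kappa q μ (r i)) = 0 := by
  have hk : ∀ i < n, kappa q μ (r i) ∈ gen r 0 n := fun i hi =>
    mem_of_kappa (mem_gen r (Nat.zero_le i) hi)
  obtain ⟨m, rfl⟩ : ∃ m, n = m + 1 := ⟨n - 1, by omega⟩
  induction Nat.le_of_lt_succ hi using Nat.decreasingInduction generalizing x with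
  | self =>
    obtain ⟨b, hb, hbx⟩ := h.exists_mul_kappa_eq (Nat.lt_succ_self m) hx
    rw [← hbx]
    -- two more strands: `η τ(b κ) = τ(b κ κ) = τ(κ b κ) = τ(b' κ)`, where `b'` and `κ` act on
    -- complementary sets of strands
    rcases m with _ | k
    · obtain ⟨t, rfl⟩ := exists_smul_one_of_mem_gen_self hb
      rw [smul_one_mul, map_smul, h1 rfl, smul_zero]
    · obtain ⟨b', hb', e⟩ := h.exists_kappa_mul_kappa_eq (Nat.lt_succ_self _) hb
      have e1 : τ (kappa q μ (r (k + 1)) * b * kappa q μ (r (k + 1))) = 0 := by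
        rw [← e]
        exact hτ.split k (by omega) _ hb' _ (mem_of_kappa (mem_gen r le_rfl (by omega)))
      have e2 : τ (kappa q μ (r (k + 1)) * b * kappa q μ (r (k + 1))) =
          eta q μ • τ (b * kappa q μ (r (k + 1))) := by
        rw [mul_assoc, hτ.comm _ (hk _ (by omega)) _
          (mul_mem (gen_mono r le_rfl (by omega) hb) (hk _ (by omega))), mul_assoc,
          kappa_mul_self (h.kappa_mul _ (by omega)), mul_smul_comm, map_smul]
      rw [e2] at e1
      exact (smul_eq_zero.1 e1).resolve_left h.eta_ne
  | of_succ i hi' ih =>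
    -- `κ_i = κ_i κ_{i+1} κ_i` and cyclicity
    have ki := hk i (by omega)
    rw [← h.KKK i (by omega), ← mul_assoc, hτ.comm _ (mul_mem hx (mul_mem ki
      (hk _ (by omega)))) _ ki, ← mul_assoc, ← mul_assoc]
    exact ih (by omega) (mul_mem (mul_mem ki hx) ki)

/-- Up to multiples of its value on the product of all generators, a split trace vanishes on the
algebra generated by BMW generators. -/
theorem map_mem_span (hτ : IsSplitTrace r n τ) (h : IsBMWGens q μ r n)
    (h1 : n = 1 → τ (kappa q μ (r 0)) = 0) {x : A} (hx : x ∈ gen r 0 n) :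
    τ x ∈ Submodule.span ℂ {τ (word r 0 n)} := by
  -- descending along the strands: `b = b' y c'` with `y` equal to `1`, `r j` or `κ j`; the first
  -- case is a product over complementary sets of strands, the second one lengthens the word, and
  -- the third one lies in the ideal generated by the `κ`'s
  have key : ∀ j l, j + l = n → ∀ b ∈ gen r 0 j,
      τ (b * word r j l) ∈ Submodule.span ℂ {τ (word r 0 n)} := by
    intro j
    induction j with
    | zero =>
      intro l hl b hb
      obtain ⟨t, rfl⟩ := exists_smul_one_of_mem_gen_self hb
      obtain rfl : l = n := by omega
      rw [smul_one_mul, map_smul]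
      exact Submodule.smul_mem _ _ (Submodule.mem_span_singleton_self _)
    | succ j ih =>
      intro l hl b hb
      have hb' := h.gen_le_bmwSpan (by omega) hb
      clear hb
      have hw : word r (j + 1) l ∈ gen r (j + 1) n := hl ▸ word_mem_gen r (j + 1) l
      have hw' := gen_mono r (Nat.zero_le _) le_rfl hw
      induction hb' using Submodule.span_induction with
      | mem x hx =>
        obtain ⟨b, hb, c, hc, z, hz, rfl⟩ := hx
        have hbn : b ∈ gen r 0 n := gen_mono r le_rfl (by omega) hb
        have hcn : c ∈ gen r 0 n := gen_mono r le_rfl (by omega) hc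
        have hrn : r j ∈ gen r 0 n := mem_gen r (by omega) (by omega)
        have hzn : z ∈ gen r 0 n := by
          rcases hz with rfl | rfl | rfl
          exacts [one_mem _, hrn, mem_of_kappa hrn]
        have e1 : Commute c (word r (j + 1) l) := by
          refine commute_of_mem_gen hc fun l' _ hl' => Commute.symm ?_
          exact commute_of_mem_gen hw fun i hi hi' => (h.comm l' i (by omega) hi').symm
        have e2 : τ (b * z * c * word r (j + 1) l) = τ (c * b * z * word r (j + 1) l) := by
          rw [mul_assoc (b * z), e1.eq, ← mul_assoc, hτ.comm _ (mul_mem (mul_mem hbn hzn) hw') _ hcn]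
          simp only [mul_assoc]
        rw [e2]
        rcases hz with rfl | rfl | rfl
        · rw [mul_one, hτ.split j (by omega) _ (mul_mem hc hb) _ hw]
          exact zero_mem _
        · rw [mul_assoc]
          exact ih (l + 1) (by omega) _ (mul_mem hc hb)
        · rw [hτ.comm _ (mul_mem (mul_mem hcn hbn) hzn) _ hw', ← mul_assoc,
            hτ.map_mul_kappa h h1 (by omega) (mul_mem hw' (mul_mem hcn hbn))]
          exact zero_mem _
      | zero => simp
      | add x y _ _ hx hy => rw [add_mul, map_add]; exact add_mem hx hy
      | smul a x _ hx => rw [smul_mul_assoc, map_smul]; exact Submodule.smul_mem _ _ hx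
  have := key n 0 (by omega) x hx
  rwa [word, mul_one] at this

end IsSplitTrace

end Reduction

/-! ### Antisymmetrizers in Hecke algebras -/

section Hecke

variable {A : Type*} [Ring A] [Algebra ℂ A] {q : ℂ} {h : ℕ → A} {n : ℕ}

/-- `h 0, …, h (n - 1)` satisfy the relations of the generators of a Hecke algebra on `n + 1`
strands. -/
structure IsHeckeGens (q : ℂ) (h : ℕ → A) (n : ℕ) : Prop where
  q_ne : q ≠ 0
  delta_ne : q - q⁻¹ ≠ 0
  sq : ∀ i < n, h i * h i = 1 + (q - q⁻¹) • h i
  comm : ∀ i j, i + 1 < j → j < n → Commute (h i) (h j)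
  braid : ∀ i, i + 1 < n → h i * h (i + 1) * h i = h (i + 1) * h i * h (i + 1)

/-- The baxterized generator of a Hecke algebra. -/
def heckeBax (q x : ℂ) (y : A) : A := 1 + ((x - 1) / (q - q⁻¹)) • y

/-- The antisymmetrizers of a Hecke algebra; the one with index `k` involves the first `k`
strands. -/
def heckeAnti (q : ℂ) (h : ℕ → A) : ℕ → A
  | 0 => 1
  | 1 => 1
  | i + 2 => (q ^ (i + 1) / qNum q (i + 2)) •
      (heckeAnti q h (i + 1) * heckeBax q (q ^ (-2 * ((i : ℤ) + 1))) (h i) *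
        heckeAnti q h (i + 1))

theorem antisymmetrizer_eq_heckeAnti {μ : ℂ} {k : ℕ}
    (hk : ∀ i, i + 1 < k → kappa q μ (h i) = 0) : antisymmetrizer q μ h k = heckeAnti q h k := by
  induction k using Nat.twoStepInduction with
  | zero => rfl
  | one => rfl
  | more k _ ih =>
    rw [antisymmetrizer, heckeAnti, ih fun i hi => hk i (by omega), baxterized, hk k (by omega),
      smul_zero, add_zero, heckeBax]

theorem qNum_neg_inv (q : ℂ) (i : ℕ) : qNum (-q⁻¹) i = (-1) ^ (i + 1) * qNum q i := by
  have h1 : (-q⁻¹)⁻¹ = -q := by rw [inv_neg, inv_inv]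
  have h2 : -q⁻¹ - -q = q - q⁻¹ := by ring
  rw [qNum, qNum, h1, h2, neg_pow, neg_pow q, pow_succ]
  ring

/-- Symmetrizers are the antisymmetrizers for the parameter `-q⁻¹`, which gives the same quadratic
relation. -/
theorem symmetrizer_eq_heckeAnti {μ : ℂ} {k : ℕ}
    (hk : ∀ i, i + 1 < k → kappa q μ (h i) = 0) :
    symmetrizer q μ h k = heckeAnti (-q⁻¹) h k := by
  induction k using Nat.twoStepInduction with
  | zero => rfl
  | one => rfl
  | more k _ ih =>
    have h1 : (-q⁻¹)⁻¹ = -q := by rw [inv_neg, inv_inv]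
    have h2 : -q⁻¹ - -q = q - q⁻¹ := by ring
    have h3 : (-q⁻¹) ^ (-2 * ((k : ℤ) + 1)) = q ^ (2 * ((k : ℤ) + 1)) := by
      rw [Even.neg_zpow ⟨-((k : ℤ) + 1), by ring⟩, inv_zpow', neg_mul, neg_neg]
    rw [symmetrizer, heckeAnti, ih fun i hi => hk i (by omega), baxterized, hk k (by omega),
      smul_zero, add_zero, heckeBax, h1, h2, h3, qNum_neg_inv]
    congr 1
    rw [neg_pow q⁻¹, pow_add (-1 : ℂ) (k + 1) 2, neg_one_sq, mul_one,
      mul_div_mul_left _ _ (pow_ne_zero _ (by norm_num))]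

/-- The Yang-Baxter equation; the condition on `w` is the additivity of the spectral parameters. -/
theorem heckeBax_ybe {a b : A} {u v w δ : ℂ} (ha : a * a = 1 + δ • a) (hb : b * b = 1 + δ • b)
    (hab : a * b * a = b * a * b) (hw : w = u + v + δ * (u * v)) :
    (1 + u • b) * (1 + w • a) * (1 + v • b) = (1 + v • a) * (1 + w • b) * (1 + u • a) := by
  have e : ∀ (u v : ℂ) (a b : A), b * b = 1 + δ • b → (1 + u • b) * (1 + w • a) * (1 + v • b) =
      (1 + u * v) • (1 : A) + (u + v + δ * (u * v)) • b + w • a + (u * w) • (b * a) +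
        (w * v) • (a * b) + (u * w * v) • (b * a * b) := by
    intro u v a b hb
    have : (1 + u • b) * (1 + w • a) * (1 + v • b) = (1 : A) + (u + v) • b + w • a +
        (u * w) • (b * a) + (w * v) • (a * b) + (u * v) • (b * b) +
          (u * w * v) • (b * a * b) := by
      simp only [mul_add, add_mul, mul_one, one_mul, smul_mul_assoc, mul_smul_comm]
      module
    rw [this, hb]
    module
  rw [e u v a b hb, e v u b a ha, hab, hw]
  module

theorem heckeAnti_succ_mem (q : ℂ) (h : ℕ → A) (k : ℕ) : heckeAnti q h (k + 1) ∈ gen h 0 k := by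
  induction k with
  | zero => exact one_mem _
  | succ k ih =>
    have ih' := gen_mono h le_rfl (Nat.le_succ k) ih
    have hk : h k ∈ gen h 0 (k + 1) := mem_gen h (Nat.zero_le k) (by omega)
    exact Subalgebra.smul_mem _ (mul_mem (mul_mem ih'
      (add_mem (one_mem _) (Subalgebra.smul_mem _ hk _))) ih') _

/-- The normalization of the antisymmetrizers is the one for which they fix the common
eigenvectors of the generators for the eigenvalue `-q⁻¹`. -/
theorem coeff_heckeAnti (hq : q ≠ 0) (hd : q - q⁻¹ ≠ 0) {k : ℕ} (hk : qNum q (k + 2) ≠ 0) :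
    q ^ (k + 1) / qNum q (k + 2) *
      (1 + (q ^ (-2 * ((k : ℤ) + 1)) - 1) / (q - q⁻¹) * (-q⁻¹)) = 1 := by
  have hq1 : (q ^ (k + 1)) ≠ 0 := pow_ne_zero _ hq
  have e1 : q ^ (-2 * ((k : ℤ) + 1)) = (q ^ (k + 1))⁻¹ * (q ^ (k + 1))⁻¹ := by
    rw [← mul_inv, ← pow_add, ← zpow_natCast, ← zpow_neg]
    congr 1
    push_cast
    ring
  have e2 : qNum q (k + 2) = (q ^ (k + 1) * q - (q ^ (k + 1))⁻¹ * q⁻¹) / (q - q⁻¹) := by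
    rw [qNum, pow_succ, pow_succ q⁻¹, inv_pow]
  rw [div_mul_eq_mul_div, div_eq_one_iff_eq hk, e1, e2]
  generalize q ^ (k + 1) = p at *
  rw [eq_div_iff hd, mul_assoc, add_mul, mul_right_comm, div_mul_cancel₀ _ hd]
  field_simp
  ring

theorem heckeAnti_mul_of_forall (hq : q ≠ 0) (hd : q - q⁻¹ ≠ 0) {k : ℕ}
    (hk : ∀ j, 2 ≤ j → j ≤ k + 1 → qNum q j ≠ 0) {v : A}
    (hv : ∀ i < k, h i * v = (-q⁻¹) • v) : heckeAnti q h (k + 1) * v = v := by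
  induction k with
  | zero => exact one_mul v
  | succ k ih =>
    have ih' := ih (fun j h1 h2 => hk j h1 (by omega)) fun i hi => hv i (by omega)
    rw [heckeAnti, smul_mul_assoc, mul_assoc, ih', mul_assoc, heckeBax, add_mul, one_mul,
      smul_mul_assoc, hv k (by omega), smul_smul, mul_add, ih', mul_smul_comm, ih']
    have := coeff_heckeAnti hq hd (hk (k + 2) (by omega) (by omega))
    conv_rhs => rw [← one_smul ℂ v, ← this]
    module

namespace IsHeckeGens

/-- Each generator acts on the antisymmetrizer by the eigenvalue `-q⁻¹`. For the last generator this
is the Yang-Baxter equation, which moves `1 + q h` through the product of baxterized generators and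
turns it into `1 + q h` for the preceding generator. -/
theorem mul_heckeAnti (hh : IsHeckeGens q h n) {k : ℕ} (hkn : k ≤ n)
    (hk : ∀ j, 2 ≤ j → j ≤ k + 1 → qNum q j ≠ 0) {i : ℕ} (hi : i < k) :
    h i * heckeAnti q h (k + 1) = (-q⁻¹) • heckeAnti q h (k + 1) := by
  have hq := hh.q_ne
  have hd := hh.delta_ne
  have hq2 : (q ^ 2 - 1) / (q - q⁻¹) = q := by
    rw [div_eq_iff hd]; field_simp
  -- `1 + q x` is the baxterized generator at the spectral parameter `q ^ 2`
  have eig : ∀ x v : A, (1 + q • x) * v = 0 ↔ x * v = (-q⁻¹) • v := by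
    intro x v
    rw [add_mul, one_mul, smul_mul_assoc]
    constructor
    · intro h0
      have : q⁻¹ • (v + q • (x * v)) = 0 := by rw [h0, smul_zero]
      rw [smul_add, smul_smul, inv_mul_cancel₀ hq, one_smul] at this
      rw [neg_smul]
      exact eq_neg_of_add_eq_zero_right this
    · intro h0
      rw [h0, smul_smul, mul_neg, mul_inv_cancel₀ hq, neg_one_smul, add_neg_cancel]
  induction k generalizing i with
  | zero => omega
  | succ k ih =>
    have ih' : ∀ i < k, h i * heckeAnti q h (k + 1) = (-q⁻¹) • heckeAnti q h (k + 1) :=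
      fun i hi => ih (by omega) (fun j h1 h2 => hk j h1 (by omega)) hi
    rcases Nat.lt_succ_iff_lt_or_eq.1 hi with hi | rfl
    · rw [heckeAnti, mul_smul_comm, ← mul_assoc, ← mul_assoc, ih' i hi, smul_mul_assoc,
        smul_mul_assoc, smul_comm]
    rw [← eig]
    rcases i with _ | m
    · have hx : (q ^ (-2 * (((0 : ℕ) : ℤ) + 1)) - 1) / (q - q⁻¹) = -q⁻¹ := by
        rw [div_eq_iff hd]
        have : q ^ (-2 * (((0 : ℕ) : ℤ) + 1)) = (q ^ 2)⁻¹ := by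
          rw [← zpow_natCast, ← zpow_neg]; norm_num
        rw [this]
        field_simp
        ring
      rw [heckeAnti, heckeBax, hx, mul_smul_comm]
      have : (1 + q • h 0) * (1 + (-q⁻¹) • h 0) = 0 := by
        have e1 : (1 + q • h 0) * (1 + (-q⁻¹) • h 0) = 1 + (q - q⁻¹) • h 0 - h 0 * h 0 := by
          have e0 : ∀ c d : ℂ, (1 + c • h 0) * (1 + d • h 0) =
              1 + (c + d) • h 0 + (c * d) • (h 0 * h 0) := fun c d => by
            simp only [mul_add, add_mul, mul_one, one_mul, smul_mul_assoc, mul_smul_comm]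
            module
          rw [e0, mul_neg, mul_inv_cancel₀ hq]
          module
        rw [e1, hh.sq 0 (by omega), sub_self]
      simp only [heckeAnti, one_mul, mul_one, this, smul_zero]
    · set e := heckeAnti q h (m + 1) with he
      set f := heckeAnti q h (m + 1 + 1) with hf
      have hef : e * f = f := heckeAnti_mul_of_forall hq hd (fun j h1 h2 => hk j h1 (by omega))
        fun i hi => ih' i (by omega)
      have hbe : Commute (h (m + 1)) e :=
        (commute_of_mem_gen (heckeAnti_succ_mem q h m) fun l _ hl =>
          hh.comm l (m + 1) (by omega) (by omega)).symm
      have haf : (1 + q • h m) * f = 0 := (eig _ _).2 (ih' m (by omega))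
      have hz : ∀ j : ℕ, q ^ (-2 * ((j : ℤ) + 1)) = q ^ 2 * q ^ (-2 * (((j + 1 : ℕ) : ℤ) + 1)) := by
        intro j
        rw [← zpow_natCast, ← zpow_add₀ hq]
        congr 1
      have ybe : (1 + q • h (m + 1)) * heckeBax q (q ^ (-2 * ((m : ℤ) + 1))) (h m) *
          heckeBax q (q ^ (-2 * (((m + 1 : ℕ) : ℤ) + 1))) (h (m + 1)) =
          heckeBax q (q ^ (-2 * (((m + 1 : ℕ) : ℤ) + 1))) (h m) *
          heckeBax q (q ^ (-2 * ((m : ℤ) + 1))) (h (m + 1)) * (1 + q • h m) := by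
        refine heckeBax_ybe (hh.sq m (by omega)) (hh.sq (m + 1) (by omega))
          (hh.braid m (by omega)) ?_
        rw [hz m]
        generalize q ^ (-2 * (((m + 1 : ℕ) : ℤ) + 1)) = z
        rw [show (q ^ 2 * z - 1) / (q - q⁻¹) = (q ^ 2 - 1) / (q - q⁻¹) * z + (z - 1) / (q - q⁻¹) by
          ring, hq2, mul_left_comm _ q, mul_div_cancel₀ _ hd]
        ring
      have hf' : f = (q ^ (m + 1) / qNum q (m + 2)) •
          (e * heckeBax q (q ^ (-2 * ((m : ℤ) + 1))) (h m) * e) := rfl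
      rw [heckeAnti, ← hf, mul_smul_comm]
      have hbe' : Commute (1 + q • h (m + 1)) e := (Commute.one_left e).add_left (hbe.smul_left q)
      have hbe'' : Commute e (heckeBax q (q ^ (-2 * (((m + 1 : ℕ) : ℤ) + 1))) (h (m + 1))) :=
        (Commute.one_right e).add_right (hbe.symm.smul_right _)
      conv_lhs => rw [← mul_assoc, ← mul_assoc]; arg 2; arg 1; arg 1; rw [hf']
      generalize heckeBax q (q ^ (-2 * (((m + 1 : ℕ) : ℤ) + 1))) (h (m + 1)) = B at *
      rw [mul_smul_comm, ← mul_assoc, ← mul_assoc, hbe'.eq, smul_mul_assoc, smul_mul_assoc,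
        mul_assoc _ e B, hbe''.eq, ← mul_assoc, mul_assoc _ e f, hef, mul_assoc e, mul_assoc e, ybe,
        mul_assoc e, mul_assoc _ _ f, haf, mul_zero, mul_zero, smul_zero, smul_zero]

/-- Antisymmetrizers are invariant under the anti-automorphism that fixes the generators. -/
theorem op_heckeAnti (q : ℂ) (h : ℕ → A) (k : ℕ) :
    heckeAnti q (fun i => MulOpposite.op (h i)) k = MulOpposite.op (heckeAnti q h k) := by
  induction k using Nat.twoStepInduction with
  | zero => rfl
  | one => rfl
  | more k _ ih =>
    rw [heckeAnti, heckeAnti, ih, heckeBax, heckeBax]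
    simp only [MulOpposite.op_smul, MulOpposite.op_mul, MulOpposite.op_add, MulOpposite.op_one,
      mul_assoc]

theorem op (hh : IsHeckeGens q h n) : IsHeckeGens q (fun i => MulOpposite.op (h i)) n where
  q_ne := hh.q_ne
  delta_ne := hh.delta_ne
  sq i hi := by rw [← MulOpposite.op_mul, hh.sq i hi]; rfl
  comm i j h1 h2 := (hh.comm i j h1 h2).op
  braid i hi := by
    simp only [← MulOpposite.op_mul, ← mul_assoc, hh.braid i hi]

theorem heckeAnti_mul (hh : IsHeckeGens q h n) {k : ℕ} (hkn : k ≤ n)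
    (hk : ∀ j, 2 ≤ j → j ≤ k + 1 → qNum q j ≠ 0) {i : ℕ} (hi : i < k) :
    heckeAnti q h (k + 1) * h i = (-q⁻¹) • heckeAnti q h (k + 1) := by
  have := hh.op.mul_heckeAnti hkn hk hi
  rw [op_heckeAnti] at this
  exact MulOpposite.op_injective this

theorem heckeAnti_mul_self (hh : IsHeckeGens q h n) {k : ℕ} (hkn : k ≤ n)
    (hk : ∀ j, 2 ≤ j → j ≤ k + 1 → qNum q j ≠ 0) :
    heckeAnti q h (k + 1) * heckeAnti q h (k + 1) = heckeAnti q h (k + 1) :=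
  heckeAnti_mul_of_forall hh.q_ne hh.delta_ne hk fun _ hi => hh.mul_heckeAnti hkn hk hi

theorem mul_heckeAnti_of_forall (hq : q ≠ 0) (hd : q - q⁻¹ ≠ 0) {k : ℕ}
    (hk : ∀ j, 2 ≤ j → j ≤ k + 1 → qNum q j ≠ 0) {v : A}
    (hv : ∀ i < k, v * h i = (-q⁻¹) • v) : v * heckeAnti q h (k + 1) = v := by
  have := heckeAnti_mul_of_forall (h := fun i => MulOpposite.op (h i)) (v := MulOpposite.op v)
    hq hd hk fun i hi => by rw [← MulOpposite.op_mul, hv i hi]; rfl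
  rw [op_heckeAnti] at this
  exact MulOpposite.op_injective this

end IsHeckeGens

end Hecke

/-! ### Traces of antisymmetrizers -/

section HeckeTrace

variable {A : Type*} [Ring A] [Algebra ℂ A] {q : ℂ} {h : ℕ → A} {n : ℕ}
  {Z : Type*} [AddCommGroup Z] [Module ℂ Z] {τ : A →ₗ[ℂ] Z}

theorem heckeBax_coeff_ne_zero (hd : q - q⁻¹ ≠ 0) {m : ℕ} (hm : qNum q m ≠ 0) :
    (q ^ (-2 * (m : ℤ)) - 1) / (q - q⁻¹) ≠ 0 := by
  refine div_ne_zero (fun h0 => hm ?_) hd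
  have e : q ^ (-2 * (m : ℤ)) = (q ^ m)⁻¹ * (q ^ m)⁻¹ := by
    rw [← mul_inv, ← pow_add, ← zpow_natCast, ← zpow_neg]
    congr 1
    push_cast
    ring
  rw [e, sub_eq_zero] at h0
  have := eq_inv_of_mul_eq_one_left h0
  rw [inv_inv] at this
  rw [qNum, inv_pow, this, sub_self, zero_div]

theorem qNum_ne_zero_of_le (hd : q - q⁻¹ ≠ 0) {k : ℕ}
    (hk : ∀ j, 2 ≤ j → j ≤ k + 1 → qNum q j ≠ 0) : qNum q (k + 1) ≠ 0 := by
  rcases k with _ | k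
  · simp [qNum, hd]
  · exact hk _ (by omega) le_rfl

namespace IsSplitTrace

/-- A step of the recursion for antisymmetrizers, under a split trace. -/
theorem map_heckeAnti_step (hτ : IsSplitTrace h n τ) (hh : IsHeckeGens q h n) {k l : ℕ}
    (hkl : k + 1 + l = n) (hk : ∀ j, 2 ≤ j → j ≤ k + 1 → qNum q j ≠ 0) (x : ℂ) :
    τ (heckeAnti q h (k + 1) * heckeBax q x (h k) * heckeAnti q h (k + 1) * word h (k + 1) l) =
      ((x - 1) / (q - q⁻¹)) • τ (heckeAnti q h (k + 1) * word h k (l + 1)) := by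
  have hE := heckeAnti_succ_mem q h k
  have hw : word h (k + 1) l ∈ gen h (k + 1) n := hkl ▸ word_mem_gen h (k + 1) l
  have hid := hh.heckeAnti_mul_self (k := k) (by omega) hk
  have hcomm : Commute (heckeAnti q h (k + 1)) (word h (k + 1) l) := by
    refine commute_of_mem_gen hE fun i _ hi => Commute.symm ?_
    exact commute_of_mem_gen hw fun j hj hj' => (hh.comm i j (by omega) hj').symm
  have hEn := gen_mono h le_rfl (by omega : k ≤ n) hE
  have hwn := gen_mono h (Nat.zero_le (k + 1)) le_rfl hw
  have hBn : heckeBax q x (h k) ∈ gen h 0 n :=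
    add_mem (one_mem _) (Subalgebra.smul_mem _ (mem_gen h (Nat.zero_le k) (by omega)) _)
  generalize heckeAnti q h (k + 1) = E at *
  rw [mul_assoc, hcomm.eq, ← mul_assoc, hτ.comm _ (mul_mem (mul_mem hEn hBn) hwn) _ hEn,
    ← mul_assoc, ← mul_assoc, hid, heckeBax, mul_add, mul_one, add_mul, map_add,
    hτ.split k (by omega) _ hE _ hw, zero_add, mul_smul_comm, smul_mul_assoc, map_smul, word,
    mul_assoc]

/-- Under a split trace, the antisymmetrizer is a nonzero multiple of the product of all
generators. -/
theorem exists_map_heckeAnti_mul_word (hτ : IsSplitTrace h n τ) (hh : IsHeckeGens q h n) {k l : ℕ}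
    (hkl : k + l = n) (hk : ∀ j, 2 ≤ j → j ≤ k + 1 → qNum q j ≠ 0) :
    ∃ c : ℂ, c ≠ 0 ∧ τ (heckeAnti q h (k + 1) * word h k l) = c • τ (word h 0 n) := by
  induction k generalizing l with
  | zero =>
    obtain rfl : l = n := by omega
    exact ⟨1, one_ne_zero, by rw [heckeAnti, one_mul, one_smul]⟩
  | succ k ih =>
    have hk' : ∀ j, 2 ≤ j → j ≤ k + 1 → qNum q j ≠ 0 := fun j h1 h2 => hk j h1 (by omega)
    obtain ⟨c, hc, e⟩ := ih (l := l + 1) (by omega) hk'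
    have hd := heckeBax_coeff_ne_zero hh.delta_ne (qNum_ne_zero_of_le hh.delta_ne hk')
    rw [Nat.cast_add, Nat.cast_one] at hd
    refine ⟨_, mul_ne_zero (div_ne_zero (pow_ne_zero (k + 1) hh.q_ne)
      (hk (k + 2) (by omega) (by omega))) (mul_ne_zero hd hc), ?_⟩
    rw [heckeAnti, smul_mul_assoc, map_smul, hτ.map_heckeAnti_step hh hkl hk', e, smul_smul,
      smul_smul, mul_assoc]

/-- A split trace vanishes on the product of all generators if the next antisymmetrizer, without its
normalization, is zero. The number `[k + 2]_q`, by which the normalization divides, may vanish. -/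
theorem map_word_eq_zero_of_last (hτ : IsSplitTrace h n τ) (hh : IsHeckeGens q h n) {k : ℕ}
    (hkn : k < n) (hk : ∀ j, 2 ≤ j → j ≤ k + 1 → qNum q j ≠ 0)
    (h0 : heckeAnti q h (k + 1) * heckeBax q (q ^ (-2 * ((k + 1 : ℕ) : ℤ))) (h k) *
      heckeAnti q h (k + 1) = 0) : τ (word h 0 n) = 0 := by
  obtain ⟨l, hl⟩ : ∃ l, k + 1 + l = n := ⟨n - (k + 1), by omega⟩
  obtain ⟨c, hc, e⟩ := hτ.exists_map_heckeAnti_mul_word hh (k := k) (l := l + 1) (by omega) hk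
  have hs := hτ.map_heckeAnti_step hh hl hk (q ^ (-2 * ((k + 1 : ℕ) : ℤ)))
  rw [h0, zero_mul, map_zero, e, smul_smul] at hs
  exact (smul_eq_zero.1 hs.symm).resolve_left (mul_ne_zero
    (heckeBax_coeff_ne_zero hh.delta_ne (qNum_ne_zero_of_le hh.delta_ne hk)) hc)

end IsSplitTrace

/-! #### The generators in the opposite order -/

/-- The first `n` generators in the opposite order. -/
def rev (h : ℕ → A) (n : ℕ) (i : ℕ) : A := h (n - 1 - i)

theorem gen_rev_le (h : ℕ → A) {i j : ℕ} (hj : j ≤ n) :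
    gen (rev h n) i j ≤ gen h (n - j) (n - i) := by
  refine Algebra.adjoin_le ?_
  rintro _ ⟨l, h1, h2, rfl⟩
  exact mem_gen h (by omega) (by omega)

theorem IsHeckeGens.rev (hh : IsHeckeGens q h n) : IsHeckeGens q (rev h n) n where
  q_ne := hh.q_ne
  delta_ne := hh.delta_ne
  sq i hi := hh.sq _ (by omega)
  comm i j h1 h2 := (hh.comm _ _ (by omega) (by omega)).symm
  braid i hi := by
    have := hh.braid (n - 1 - (i + 1)) (by omega)
    have e : n - 1 - (i + 1) + 1 = n - 1 - i := by omega
    rw [e] at this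
    exact this.symm

theorem IsSplitTrace.rev (hτ : IsSplitTrace h n τ) : IsSplitTrace (rev h n) n τ := by
  have hg : ∀ {i j x}, j ≤ n → x ∈ gen (QMat.rev h n) i j → x ∈ gen h (n - j) (n - i) :=
    fun hj hx => gen_rev_le h hj hx
  constructor
  · intro x hx y hy
    exact hτ.comm x (gen_mono h (Nat.zero_le _) (by omega) (hg le_rfl hx)) y
      (gen_mono h (Nat.zero_le _) (by omega) (hg le_rfl hy))
  · intro j hj x hx y hy
    have hx' := hg (by omega) hx
    have hy' := hg le_rfl hy
    rw [hτ.comm x (gen_mono h (Nat.zero_le _) (by omega) hx') y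
      (gen_mono h (Nat.zero_le _) (by omega) hy')]
    exact hτ.split (n - (j + 1)) (by omega) y (gen_mono h (by omega) le_rfl hy') x
      (gen_mono h (by omega) (by omega) hx')

/-- The products of all generators in the two orders are conjugate. -/
theorem IsSplitTrace.map_word_rev (hτ : IsSplitTrace h n τ) (hh : IsHeckeGens q h n) :
    τ (word (QMat.rev h n) 0 n) = τ (word h 0 n) := by
  rcases Nat.eq_zero_or_pos n with rfl | hn
  · rfl
  have key : ∀ j l, j + 1 + l = n →
      τ (word (QMat.rev h n) l (j + 1) * word h (j + 1) l) = τ (word h 0 n) := by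
    intro j
    induction j with
    | zero =>
      intro l hl
      have e : n = l + 1 := by omega
      have e' : QMat.rev h n l = h 0 := by rw [QMat.rev]; congr 1; omega
      rw [word, word, mul_one, e', e, word, zero_add]
    | succ j ih =>
      intro l hl
      have hv := gen_rev_le h (by omega) (word_mem_gen (QMat.rev h n) (l + 1) (j + 1))
        (n := n)
      have hv' : word (QMat.rev h n) (l + 1) (j + 1) ∈ gen h 0 (j + 1) :=
        gen_mono h (Nat.zero_le _) (by omega) hv
      have hw : word h (j + 1 + 1) l ∈ gen h (j + 1 + 1) n := hl ▸ word_mem_gen h (j + 1 + 1) l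
      have hc : Commute (word (QMat.rev h n) (l + 1) (j + 1)) (word h (j + 1 + 1) l) := by
        refine commute_of_mem_gen hv' fun i _ hi => Commute.symm ?_
        exact commute_of_mem_gen hw fun j hj hj' => (hh.comm i j (by omega) hj').symm
      have e' : QMat.rev h n l = h (j + 1) := by rw [QMat.rev]; congr 1; omega
      have hhn : h (j + 1) ∈ gen h 0 n := mem_gen h (Nat.zero_le _) (by omega)
      have ew : word (QMat.rev h n) l (j + 1 + 1) =
          QMat.rev h n l * word (QMat.rev h n) (l + 1) (j + 1) := rfl
      have ew' : word h (j + 1) (l + 1) = h (j + 1) * word h (j + 1 + 1) l := rfl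
      rw [ew, e', mul_assoc, hc.eq, ← mul_assoc, ← ih (l + 1) (by omega), ew',
        hτ.comm _ (mul_mem hhn (gen_mono h (Nat.zero_le _) le_rfl hw)) _
          (gen_mono h le_rfl (by omega) hv')]
  have := key (n - 1) 0 (by omega)
  rwa [word, mul_one, Nat.sub_add_cancel hn] at this

/-- The variant of `IsSplitTrace.map_word_eq_zero_of_last` in which the antisymmetrizer involves the
last `k + 1` strands and is continued by the generator to its left. -/
theorem IsSplitTrace.map_word_eq_zero (hτ : IsSplitTrace h n τ) (hh : IsHeckeGens q h n)
    {m k : ℕ} (hmk : m + k + 1 = n) (hk : ∀ j, 2 ≤ j → j ≤ k + 1 → qNum q j ≠ 0)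
    (h0 : heckeAnti q (fun i => h (m + 1 + i)) (k + 1) *
      heckeBax q (q ^ (-2 * ((k + 1 : ℕ) : ℤ))) (h m) *
      heckeAnti q (fun i => h (m + 1 + i)) (k + 1) = 0) : τ (word h 0 n) = 0 := by
  have hs : IsHeckeGens q (fun i => h (m + 1 + i)) k :=
    ⟨hh.q_ne, hh.delta_ne, fun i hi => hh.sq _ (by omega),
      fun i j h1 h2 => hh.comm _ _ (by omega) (by omega), fun i hi => hh.braid _ (by omega)⟩
  -- an antisymmetrizer does not depend on the order of the generators
  have hE : heckeAnti q (fun i => h (m + 1 + i)) (k + 1) = heckeAnti q (QMat.rev h n) (k + 1) := by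
    have e1 : heckeAnti q (QMat.rev h n) (k + 1) * heckeAnti q (fun i => h (m + 1 + i)) (k + 1) =
        heckeAnti q (fun i => h (m + 1 + i)) (k + 1) := by
      refine heckeAnti_mul_of_forall hh.q_ne hh.delta_ne hk fun i hi => ?_
      have := hs.mul_heckeAnti le_rfl hk (i := k - 1 - i) (by omega)
      have e : QMat.rev h n i = h (m + 1 + (k - 1 - i)) := by rw [QMat.rev]; congr 1; omega
      rw [e]
      exact this
    have e2 : heckeAnti q (QMat.rev h n) (k + 1) * heckeAnti q (fun i => h (m + 1 + i)) (k + 1) =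
        heckeAnti q (QMat.rev h n) (k + 1) := by
      refine IsHeckeGens.mul_heckeAnti_of_forall hh.q_ne hh.delta_ne hk fun i hi => ?_
      have := hh.rev.heckeAnti_mul (k := k) (by omega) hk (i := k - 1 - i) (by omega)
      have e : QMat.rev h n (k - 1 - i) = h (m + 1 + i) := by rw [QMat.rev]; congr 1; omega
      rw [e] at this
      exact this
    rw [← e1, e2]
  have e : h m = QMat.rev h n k := by rw [QMat.rev]; congr 1; omega
  rw [hE, e] at h0
  rw [← hτ.map_word_rev hh]
  exact hτ.rev.map_word_eq_zero_of_last hh.rev (by omega) hk h0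

end HeckeTrace

/-! ### From BMW algebras to Hecke algebras -/

section Transfer

universe u

variable {A : Type u} {B : Type*} [Ring A] [Algebra ℂ A] [Ring B] [Algebra ℂ B] {q μ : ℂ}

theorem map_kappa (f : A →ₐ[ℂ] B) (x : A) : f (kappa q μ x) = kappa q μ (f x) := by
  simp only [kappa, map_smul, map_mul, map_add, map_sub, map_one]

theorem map_baxterized (f : A →ₐ[ℂ] B) (ε : ℤ) (z : ℂ) (x : A) :
    f (baxterized q μ ε z x) = baxterized q μ ε z (f x) := by
  simp only [baxterized, map_smul, map_add, map_one, map_kappa]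

theorem map_antisymmetrizer (f : A →ₐ[ℂ] B) {s : ℕ → A} {t : ℕ → B} {k : ℕ}
    (hst : ∀ i, i + 1 < k → f (s i) = t i) :
    f (antisymmetrizer q μ s k) = antisymmetrizer q μ t k := by
  induction k using Nat.twoStepInduction with
  | zero => exact map_one f
  | one => exact map_one f
  | more k _ ih =>
    rw [antisymmetrizer, antisymmetrizer, map_smul, map_mul, map_mul, map_baxterized,
      ih fun i hi => hst i (by omega), hst k (by omega)]

theorem map_symmetrizer (f : A →ₐ[ℂ] B) {s : ℕ → A} {t : ℕ → B} {k : ℕ}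
    (hst : ∀ i, i + 1 < k → f (s i) = t i) :
    f (symmetrizer q μ s k) = symmetrizer q μ t k := by
  induction k using Nat.twoStepInduction with
  | zero => exact map_one f
  | one => exact map_one f
  | more k _ ih =>
    rw [symmetrizer, symmetrizer, map_smul, map_mul, map_mul, map_baxterized,
      ih fun i hi => hst i (by omega), hst k (by omega)]

theorem map_word (f : A →ₐ[ℂ] B) {s : ℕ → A} {t : ℕ → B} {j l : ℕ}
    (hst : ∀ i, i < j + l → f (s i) = t i) : f (word s j l) = word t j l := by
  induction l generalizing j with
  | zero => exact map_one f
  | succ l ih =>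
    rw [word, word, map_mul, hst j (by omega), ih fun i hi => hst i (by omega)]

variable {r : ℕ → A} {n : ℕ} {Z : Type*} [AddCommGroup Z] [Module ℂ Z] {τ : A →ₗ[ℂ] Z}

/-- A split trace on the algebra generated by BMW generators factors through a quotient in which the
`κ`'s vanish and the generators satisfy the Hecke relations. -/
theorem IsSplitTrace.exists_hecke_quotient (hτ : IsSplitTrace r n τ) (h : IsBMWGens q μ r n)
    (h1 : n = 1 → τ (kappa q μ (r 0)) = 0) :
    ∃ (Q : Type u) (_ : Ring Q) (_ : Algebra ℂ Q) (π : gen r 0 n →ₐ[ℂ] Q) (τ' : Q →ₗ[ℂ] Z)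
      (s : ℕ → gen r 0 n), (∀ i < n, (s i : A) = r i) ∧ (∀ x, τ' (π x) = τ x) ∧
      (∀ i < n, kappa q μ (π (s i)) = 0) ∧ IsHeckeGens q (fun i => π (s i)) n ∧
      IsSplitTrace (fun i => π (s i)) n τ' := by
  -- the radical of the bilinear form `(x, y) ↦ τ (x * y)`
  let I : Ideal (gen r 0 n) :=
    { carrier := {x | ∀ y : gen r 0 n, τ (x * y) = 0}
      add_mem' := fun {x x'} hx hx' y => by
        rw [Subalgebra.coe_add, add_mul, map_add, hx y, hx' y, add_zero]
      zero_mem' := fun y => by simp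
      smul_mem' := fun a x hx y => by
        have := hx (y * a)
        rw [smul_eq_mul, Subalgebra.coe_mul, mul_assoc, hτ.comm _ a.2 _ (mul_mem x.2 y.2),
          mul_assoc]
        exact this }
  have hI : I.IsTwoSided := ⟨fun {x} b hx y => by
    have := hx (b * y)
    rwa [Subalgebra.coe_mul, ← mul_assoc] at this⟩
  have hmem : ∀ x : gen r 0 n, x ∈ I ↔ ∀ y : gen r 0 n, τ (x * y) = 0 := fun x => Iff.rfl
  classical
  let s : ℕ → gen r 0 n := fun i => if hi : i < n then ⟨r i, mem_gen r (Nat.zero_le i) hi⟩ else 0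
  have hs : ∀ i < n, (s i : A) = r i := fun i hi => by simp only [s, dif_pos hi]
  let π : gen r 0 n →ₐ[ℂ] (gen r 0 n ⧸ I) := Ideal.Quotient.mkₐ ℂ I
  have hπ : Function.Surjective π := Ideal.Quotient.mkₐ_surjective ℂ I
  let τB : gen r 0 n →ₗ[ℂ] Z := τ ∘ₗ (gen r 0 n).val.toLinearMap
  let τ' : (gen r 0 n ⧸ I) →ₗ[ℂ] Z :=
    ((I.restrictScalars ℂ).liftQ τB (fun x hx => by
      have := (hmem x).1 hx 1
      rw [Subalgebra.coe_one, mul_one] at this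
      exact this)) ∘ₗ (Submodule.Quotient.restrictScalarsEquiv ℂ I).symm.toLinearMap
  have hτ' : ∀ x, τ' (π x) = τ x := fun x => rfl
  have hker : ∀ x, x ∈ I → π x = 0 := fun x hx => Ideal.Quotient.eq_zero_iff_mem.2 hx
  have hk : ∀ i < n, kappa q μ (π (s i)) = 0 := by
    intro i hi
    rw [← map_kappa]
    refine hker _ fun y => ?_
    have e : ((kappa q μ (s i) : gen r 0 n) : A) = kappa q μ (r i) := by
      rw [← hs i hi]
      exact map_kappa (gen r 0 n).val (s i)
    rw [e, hτ.comm _ (mem_of_kappa (mem_gen r (Nat.zero_le i) hi)) _ y.2]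
    exact hτ.map_mul_kappa h h1 hi y.2
  have hlift : ∀ i j x, j ≤ n → x ∈ gen (fun i => π (s i)) i j →
      ∃ b : gen r 0 n, (b : A) ∈ gen r i j ∧ π b = x := by
    intro i j x hj hx
    induction hx using Algebra.adjoin_induction with
    | mem x hx =>
      obtain ⟨l, h1, h2, rfl⟩ := hx
      exact ⟨s l, by rw [hs l (by omega)]; exact mem_gen r h1 h2, rfl⟩
    | algebraMap c => exact ⟨algebraMap ℂ _ c, (gen r i j).algebraMap_mem c, π.commutes c⟩
    | add x y _ _ hx hy =>
      obtain ⟨b, hb, rfl⟩ := hx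
      obtain ⟨c, hc, rfl⟩ := hy
      exact ⟨b + c, add_mem hb hc, map_add π b c⟩
    | mul x y _ _ hx hy =>
      obtain ⟨b, hb, rfl⟩ := hx
      obtain ⟨c, hc, rfl⟩ := hy
      exact ⟨b * c, mul_mem hb hc, map_mul π b c⟩
  refine ⟨gen r 0 n ⧸ I, inferInstance, inferInstance, π, τ', s, hs, hτ', hk, ?_, ?_⟩
  · refine ⟨h.q_ne, h.delta_ne, ?_, ?_, ?_⟩
    · intro i hi
      rw [mul_self_eq h.q_ne h.delta_ne h.mu_ne, hk i hi, smul_zero, sub_zero]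
    · intro i j hij hj
      have : Commute (s i) (s j) := Subtype.ext (by
        rw [Subalgebra.coe_mul, Subalgebra.coe_mul, hs i (by omega), hs j hj]
        exact h.comm i j hij hj)
      exact this.map π
    · intro i hi
      have : s i * s (i + 1) * s i = s (i + 1) * s i * s (i + 1) := Subtype.ext (by
        simp only [Subalgebra.coe_mul, hs i (by omega : i < n), hs (i + 1) hi]
        exact h.braid i hi)
      simpa only [map_mul] using congrArg π this
  · constructor
    · intro x _ y _
      obtain ⟨b, rfl⟩ := hπ x
      obtain ⟨c, rfl⟩ := hπ y
      rw [← map_mul, ← map_mul, hτ', hτ']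
      exact hτ.comm _ b.2 _ c.2
    · intro j hj x hx y hy
      obtain ⟨b, hb, rfl⟩ := hlift 0 j x (by omega) hx
      obtain ⟨c, hc, rfl⟩ := hlift (j + 1) n y le_rfl hy
      rw [← map_mul, hτ']
      exact hτ.split j hj _ hb _ hc

/-- Terms with `κ` in the baxterized generators do not contribute, whatever their coefficients. -/
theorem IsSplitTrace.exists_map_antisymmetrizer (hτ : IsSplitTrace r n τ) (h : IsBMWGens q μ r n)
    (h1 : n = 1 → τ (kappa q μ (r 0)) = 0) (hq : ∀ j, 2 ≤ j → j ≤ n + 1 → qNum q j ≠ 0) :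
    ∃ c : ℂ, c ≠ 0 ∧ τ (antisymmetrizer q μ r (n + 1)) = c • τ (word r 0 n) := by
  obtain ⟨Q, _, _, π, τ', s, hs, hτ', hk, hh, ht⟩ := hτ.exists_hecke_quotient h h1
  obtain ⟨c, hc, e⟩ := ht.exists_map_heckeAnti_mul_word hh (Nat.add_zero n) hq
  refine ⟨c, hc, ?_⟩
  have e1 := map_antisymmetrizer (q := q) (μ := μ) (gen r 0 n).val (s := s) (t := r) (k := n + 1)
    fun i hi => hs i (by omega)
  have e2 := map_word (gen r 0 n).val (s := s) (t := r) (j := 0) (l := n)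
    fun i hi => hs i (by omega)
  rw [← antisymmetrizer_eq_heckeAnti (μ := μ) (fun i hi => hk i (by omega)), word, mul_one,
    ← map_antisymmetrizer π (s := s) (fun i _ => rfl), ← map_word π (s := s) (fun i _ => rfl), hτ',
    hτ'] at e
  rw [← e1, ← e2]
  exact e

theorem IsSplitTrace.exists_map_symmetrizer (hτ : IsSplitTrace r n τ) (h : IsBMWGens q μ r n)
    (h1 : n = 1 → τ (kappa q μ (r 0)) = 0) (hq : ∀ j, 2 ≤ j → j ≤ n + 1 → qNum q j ≠ 0) :
    ∃ c : ℂ, c ≠ 0 ∧ τ (symmetrizer q μ r (n + 1)) = c • τ (word r 0 n) := by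
  obtain ⟨Q, _, _, π, τ', s, hs, hτ', hk, hh, ht⟩ := hτ.exists_hecke_quotient h h1
  have hd : -q⁻¹ - (-q⁻¹)⁻¹ = q - q⁻¹ := by rw [inv_neg, inv_inv]; ring
  have hh' : IsHeckeGens (-q⁻¹) (fun i => π (s i)) n :=
    ⟨neg_ne_zero.2 (inv_ne_zero hh.q_ne), by rw [hd]; exact hh.delta_ne,
      by rw [hd]; exact hh.sq, hh.comm, hh.braid⟩
  obtain ⟨c, hc, e⟩ := ht.exists_map_heckeAnti_mul_word hh' (Nat.add_zero n) fun j h1 h2 => by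
    rw [qNum_neg_inv]
    exact mul_ne_zero (pow_ne_zero _ (by norm_num)) (hq j h1 h2)
  refine ⟨c, hc, ?_⟩
  have e1 := map_symmetrizer (q := q) (μ := μ) (gen r 0 n).val (s := s) (t := r) (k := n + 1)
    fun i hi => hs i (by omega)
  have e2 := map_word (gen r 0 n).val (s := s) (t := r) (j := 0) (l := n)
    fun i hi => hs i (by omega)
  rw [← symmetrizer_eq_heckeAnti (μ := μ) (fun i hi => hk i (by omega)), word, mul_one,
    ← map_symmetrizer π (s := s) (fun i _ => rfl), ← map_word π (s := s) (fun i _ => rfl), hτ',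
    hτ'] at e
  rw [← e1, ← e2]
  exact e

theorem IsSplitTrace.map_word_eq_zero_of_bmw (hτ : IsSplitTrace r n τ) (h : IsBMWGens q μ r n)
    (h1 : n = 1 → τ (kappa q μ (r 0)) = 0) {m k : ℕ} (hmk : m + k + 1 = n)
    (hq : ∀ j, 2 ≤ j → j ≤ k + 1 → qNum q j ≠ 0)
    (h0 : antisymmetrizer q μ (fun i => r (m + 1 + i)) (k + 1) *
      baxterized q μ (-1) (q ^ (-2 * ((k + 1 : ℕ) : ℤ))) (r m) *
      antisymmetrizer q μ (fun i => r (m + 1 + i)) (k + 1) = 0) : τ (word r 0 n) = 0 := by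
  obtain ⟨Q, _, _, π, τ', s, hs, hτ', hk, hh, ht⟩ := hτ.exists_hecke_quotient h h1
  have e1 := map_antisymmetrizer (q := q) (μ := μ) (gen r 0 n).val
    (s := fun i => s (m + 1 + i)) (t := fun i => r (m + 1 + i)) (k := k + 1)
    fun i hi => hs _ (by omega)
  have e2 := map_word (gen r 0 n).val (s := s) (t := r) (j := 0) (l := n)
    fun i hi => hs i (by omega)
  have e3 := map_baxterized (q := q) (μ := μ) (gen r 0 n).val (-1)
    (q ^ (-2 * ((k + 1 : ℕ) : ℤ))) (s m)
  have e4 : (gen r 0 n).val (s m) = r m := hs m (by omega)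
  rw [e4] at e3
  rw [← e1, ← e3, ← map_mul, ← map_mul] at h0
  have h0' := (map_eq_zero_iff (gen r 0 n).val Subtype.val_injective).1 h0
  have h2 := congrArg π h0'
  rw [map_mul, map_mul, map_zero, map_baxterized,
    map_antisymmetrizer π (s := fun i => s (m + 1 + i)) (fun i _ => rfl),
    antisymmetrizer_eq_heckeAnti (fun i hi => hk _ (by omega)), baxterized, hk m (by omega),
    smul_zero, add_zero] at h2
  have h3 := ht.map_word_eq_zero hh hmk hq h2
  rw [← map_word π (s := s) (fun i _ => rfl), hτ'] at h3
  rw [← e2]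
  exact h3

end Transfer

/-! ### R-matrices of BMW type -/

section BMWType

variable {N : ℕ} {R F : TMat N 2 ℂ} {q μ : ℂ}

theorem exists_leg_pair {n m : ℕ} (h : m + 1 < n) : ∃ φ : TMat N 2 ℂ →ₐ[ℂ] TMat N n ℂ,
    ∀ X, φ X = leg n m X :=
  ⟨embHom N ℂ (pair_injective h), fun _ => (leg_of_lt h).symm⟩

theorem map_bmwInv {A B : Type*} [Ring A] [Algebra ℂ A] [Ring B] [Algebra ℂ B] (f : A →ₐ[ℂ] B)
    (x : A) : f (bmwInv q μ x) = bmwInv q μ (f x) := by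
  simp only [bmwInv, map_smul, map_add, map_sub, map_one, map_kappa]

theorem kappa_leg {n m : ℕ} (h : m + 1 < n) (X : TMat N 2 ℂ) :
    kappa q μ (leg n m X) = leg n m (kappa q μ X) := by
  obtain ⟨φ, hφ⟩ := exists_leg_pair (N := N) h
  rw [← hφ, ← hφ, map_kappa]

theorem bmwInv_leg {n m : ℕ} (h : m + 1 < n) (X : TMat N 2 ℂ) :
    bmwInv q μ (leg n m X) = leg n m (bmwInv q μ X) := by
  obtain ⟨φ, hφ⟩ := exists_leg_pair (N := N) h
  rw [← hφ, ← hφ, map_bmwInv]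

namespace IsBMWType

theorem delta_ne (hB : IsBMWType R q μ) : q - q⁻¹ ≠ 0 := by
  intro h
  have h1 : q * q = 1 := by
    have := mul_inv_cancel₀ hB.q_ne_zero
    rwa [← sub_eq_zero.1 h] at this
  rcases mul_self_eq_one_iff.1 h1 with h2 | h2
  exacts [hB.q_ne_one h2, hB.q_ne_neg_one h2]

theorem eta_ne (hB : IsBMWType R q μ) : eta q μ ≠ 0 := by
  refine div_ne_zero (mul_ne_zero (sub_ne_zero.2 hB.mu_ne_q.symm) fun h => ?_)
    (mul_ne_zero hB.mu_ne_zero hB.delta_ne)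
  exact hB.mu_ne_neg_inv_q (eq_neg_of_add_eq_zero_right h)

theorem kappa_mul (hB : IsBMWType R q μ) : kappa q μ R * R = μ • kappa q μ R := by
  have h0 := minpoly.aeval ℂ R
  rw [hB.minpoly_eq] at h0
  simp only [map_mul, map_sub, map_add, Polynomial.aeval_X, Polynomial.aeval_C,
    Algebra.algebraMap_eq_smul_one] at h0
  have h1 : (q • (1 : TMat N 2 ℂ) - R) * (q⁻¹ • 1 + R) * (R - μ • 1) = 0 := by
    rw [← neg_sub R, neg_mul, neg_mul, add_comm _ R, h0, neg_zero]
  have h2 : kappa q μ R * (R - μ • 1) = 0 := by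
    rw [kappa, smul_mul_assoc, h1, smul_zero]
  rw [mul_sub, mul_smul_comm, mul_one, sub_eq_zero] at h2
  exact h2

theorem bmwInv_eq (hB : IsBMWType R q μ) : bmwInv q μ R = R⁻¹ :=
  (Matrix.inv_eq_right_inv (mul_bmwInv hB.q_ne_zero hB.delta_ne hB.mu_ne_zero hB.kappa_mul)).symm

theorem isBMWGens (hB : IsBMWType R q μ) (hR : IsRMatrix R) (n : ℕ) :
    IsBMWGens q μ (fun i => leg (n + 1) i R) n where
  q_ne := hB.q_ne_zero
  delta_ne := hB.delta_ne
  mu_ne := hB.mu_ne_zero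
  eta_ne := hB.eta_ne
  kappa_mul i hi := by
    obtain ⟨φ, hφ⟩ := exists_leg_pair (N := N) (n := n + 1) (m := i) (by omega)
    rw [← hφ, ← map_kappa, ← map_mul, hB.kappa_mul, map_smul]
  comm i j hij _ := leg_commute hij R R
  braid i hi := leg_braid (by omega) hR
  KK i hi := by
    obtain ⟨φ, h0, h1⟩ := exists_leg_triple (N := N) (n := n + 1) (m := i) (by omega)
    rw [kappa_leg (by omega), kappa_leg (by omega), ← h0, ← h1, ← h0, ← h1, ← map_mul, hB.KK,
      map_mul, map_mul]
  KK_inv i hi := by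
    obtain ⟨φ, h0, h1⟩ := exists_leg_triple (N := N) (n := n + 1) (m := i) (by omega)
    rw [kappa_leg (by omega), kappa_leg (by omega), bmwInv_leg (by omega), bmwInv_leg (by omega),
      hB.bmwInv_eq, ← h0, ← h1, ← h0, ← h1, ← map_mul, hB.KK_inv, map_mul, map_mul]
  KKK i hi := by
    obtain ⟨φ, h0, h1⟩ := exists_leg_triple (N := N) (n := n + 1) (m := i) (by omega)
    rw [kappa_leg (by omega), kappa_leg (by omega), ← h0, ← h1, ← map_mul, ← map_mul, hB.KKK]

end IsBMWType

theorem braidImage_succ (R : TMat N 2 ℂ) (n : ℕ) :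
    braidImage R (n + 1) = gen (fun i => leg (n + 1) i R) 0 n := by
  rw [braidImage, gen]
  congr 1
  ext X
  constructor
  · rintro ⟨i, hi, rfl⟩
    exact ⟨i, Nat.zero_le i, by omega, rfl⟩
  · rintro ⟨i, -, hi, rfl⟩
    exact ⟨i, by omega, rfl⟩

theorem rho_of (hR : IsRMatrix R) (n : ℕ) (g : BraidGroup n) :
    rho hR n (MonoidAlgebra.of ℂ (BraidGroup n) g) = (braidRep hR n g : TMat N n ℂ) := by
  rw [rho, MonoidAlgebra.lift_of]
  rfl

theorem rho_sigma (hR : IsRMatrix R) {n i : ℕ} (hi : i + 1 < n) :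
    rho hR n (sigma n i) = leg n i R := by
  rw [sigma, dif_pos (by omega), rho_of, braidRep, PresentedGroup.toGroup.of, legUnit_val]

/-- Inverses of the generators need not be adjoined, since the inverse of an R-matrix of BMW type is a
polynomial in it. -/
theorem rho_mem_braidImage (hR : IsRMatrix R) (hB : IsBMWType R q μ) (n : ℕ) (α : BraidAlg n) :
    rho hR n α ∈ braidImage R n := by
  have hg : ∀ g : BraidGroup n, (braidRep hR n g : TMat N n ℂ) ∈ braidImage R n := by
    have h1 : (⊤ : Subgroup (BraidGroup n)) ≤
        ((braidImage R n).toSubmonoid.units).comap (braidRep hR n) := by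
      rw [← PresentedGroup.closure_range_of, Subgroup.closure_le]
      rintro _ ⟨i, rfl⟩
      have hi : (i : ℕ) + 1 < n := by omega
      rw [SetLike.mem_coe, Subgroup.mem_comap, braidRep, PresentedGroup.toGroup.of,
        Submonoid.mem_units_iff]
      refine ⟨leg_mem_braidImage R hi, ?_⟩
      have h2 : ((legUnit hR n i)⁻¹ : (TMat N n ℂ)ˣ) = bmwInv q μ (leg n i R) := by
        rw [Units.inv_eq_of_mul_eq_one_right]
        rw [legUnit_val, bmwInv_leg hi, hB.bmwInv_eq]
        exact mul_leg_inv (mul_inv_of_isUnit hR.isUnit) n i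
      rw [h2]
      exact mem_of_bmwInv (leg_mem_braidImage R hi)
    intro g
    exact (Submonoid.mem_units_iff _ _).1 (h1 (Subgroup.mem_top g)) |>.1
  induction α using MonoidAlgebra.induction_on with
  | of g => rw [rho_of]; exact hg g
  | add a b ha hb => rw [map_add]; exact add_mem ha hb
  | smul c a ha => rw [map_smul]; exact Subalgebra.smul_mem _ ha c

theorem exists_rho_eq (hR : IsRMatrix R) {n : ℕ} {X : TMat N n ℂ} (hX : X ∈ braidImage R n) :
    ∃ α, rho hR n α = X := by
  have : braidImage R n ≤ (rho hR n).range := by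
    refine Algebra.adjoin_le ?_
    rintro _ ⟨i, hi, rfl⟩
    exact ⟨sigma n i, rho_sigma hR hi⟩
  exact this hX

theorem rho_antisymmetrizer (hR : IsRMatrix R) (n : ℕ) :
    rho hR (n + 1) (antisymmetrizer q μ (sigma (n + 1)) (n + 1)) =
      antisymmetrizer q μ (fun i => leg (n + 1) i R) (n + 1) :=
  map_antisymmetrizer _ fun _ hi => rho_sigma hR hi

theorem rho_symmetrizer (hR : IsRMatrix R) (n : ℕ) :
    rho hR (n + 1) (symmetrizer q μ (sigma (n + 1)) (n + 1)) =
      symmetrizer q μ (fun i => leg (n + 1) i R) (n + 1) :=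
  map_symmetrizer _ fun _ hi => rho_sigma hR hi

/-! ### The characteristic subalgebra -/

theorem map_copy {W W' : Type*} [Ring W] [Algebra ℂ W] [Ring W'] [Algebra ℂ W'] (f : W →ₐ[ℂ] W')
    (F : TMat N 2 ℂ) (M : Matrix (Fin N) (Fin N) W) {n i : ℕ} (hi : i < n) :
    f.mapMatrix (copy F M n i) = copy F (M.map f) n i := by
  have hs : ∀ X : TMat N n ℂ, f.mapMatrix (scal W X) = scal W' X := fun X => by
    ext a b
    exact f.commutes (X a b)
  induction i with
  | zero =>
    rw [copy, copy, dif_pos hi, dif_pos hi]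
    ext a b
    simp only [emb, Matrix.of_apply, AlgHom.mapMatrix_apply, Matrix.map_apply]
    split_ifs <;> simp
  | succ i ih => rw [copy, copy, map_mul, map_mul, hs, hs, ih (by omega)]

/-- The defining relation of the quantum matrix algebra. -/
theorem commute_leg_copy_genMatrix (R F : TMat N 2 ℂ) :
    Commute (scal (QMAlgebra R F) (leg 2 0 R))
      (copy F (genMatrix R F) 2 0 * copy F (genMatrix R F) 2 1) := by
  set f := RingQuot.mkAlgHom ℂ (QMRel R F) with hf
  have hs : ∀ X : TMat N 2 ℂ, f.mapMatrix (scal _ X) = scal (QMAlgebra R F) X := fun X => by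
    ext a b
    exact f.commutes (X a b)
  have hg : (freeMatrix N).map f = genMatrix R F := rfl
  have h : f.mapMatrix (scal (FreeAlgebra ℂ (Fin N × Fin N)) (leg 2 0 R) *
      copy F (freeMatrix N) 2 0 * copy F (freeMatrix N) 2 1) =
      f.mapMatrix (copy F (freeMatrix N) 2 0 * copy F (freeMatrix N) 2 1 *
        scal (FreeAlgebra ℂ (Fin N × Fin N)) (leg 2 0 R)) := by
    ext i j
    exact RingQuot.mkAlgHom_rel ℂ (QMRel.entry i j)
  rw [map_mul, map_mul, map_mul, map_mul, hs, map_copy f F _ (by omega), map_copy f F _ (by omega),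
    hg] at h
  rw [Commute, SemiconjBy, ← mul_assoc]
  exact h

theorem ch_eq_chOp (hR : IsRMatrix R) (F : TMat N 2 ℂ) (n : ℕ) (α : BraidAlg n) :
    ch hR F n α = chOp R F (genMatrix R F) n (rho hR n α) := rfl

theorem IsCompatible.transportedBy (h : IsCompatible R F) : TransportedBy R F :=
  ⟨h.2.symm, h.1.symm⟩

theorem emb_natAdd_leg {n m i : ℕ} (hi : i + 1 < m) (X : TMat N 2 ℂ) :
    emb (Fin.natAdd n) (leg m i X) = leg (n + m) (n + i) X :=
  emb_leg (Fin.natAdd_injective m n) hi rfl rfl X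

theorem emb_castAdd_leg {n m i : ℕ} (hi : i + 1 < n) (X : TMat N 2 ℂ) :
    emb (Fin.castAdd m) (leg n i X) = leg (n + m) i X :=
  emb_leg (Fin.castAdd_injective n m) hi rfl rfl X

theorem emb_castAdd_mem {n m : ℕ} {X : TMat N n ℂ} (hX : X ∈ braidImage R n) :
    emb (Fin.castAdd m) X ∈ braidImage R (n + m) := by
  have : braidImage R n ≤ (braidImage R (n + m)).comap (embHom N ℂ (Fin.castAdd_injective n m)) := by
    refine Algebra.adjoin_le ?_
    rintro _ ⟨i, hi, rfl⟩
    rw [SetLike.mem_coe, Subalgebra.mem_comap, embHom_apply, emb_castAdd_leg hi]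
    exact leg_mem_braidImage R (by omega)
  exact this hX

theorem emb_natAdd_mem {n m : ℕ} {X : TMat N m ℂ} (hX : X ∈ braidImage R m) :
    emb (Fin.natAdd n) X ∈ braidImage R (n + m) := by
  have : braidImage R m ≤ (braidImage R (n + m)).comap (embHom N ℂ (Fin.natAdd_injective m n)) := by
    refine Algebra.adjoin_le ?_
    rintro _ ⟨i, hi, rfl⟩
    rw [SetLike.mem_coe, Subalgebra.mem_comap, embHom_apply, emb_natAdd_leg hi]
    exact leg_mem_braidImage R (by omega)
  exact this hX

theorem exists_emb_castAdd_eq {j m : ℕ} {X : TMat N (j + 1 + m) ℂ}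
    (hX : X ∈ gen (fun i => leg (j + 1 + m) i R) 0 j) :
    ∃ Y ∈ braidImage R (j + 1), emb (Fin.castAdd m) Y = X := by
  have : gen (fun i => leg (j + 1 + m) i R) 0 j ≤
      (braidImage R (j + 1)).map (embHom N ℂ (Fin.castAdd_injective (j + 1) m)) := by
    refine Algebra.adjoin_le ?_
    rintro _ ⟨i, -, hi, rfl⟩
    exact ⟨leg (j + 1) i R, leg_mem_braidImage R (by omega), emb_castAdd_leg (by omega) R⟩
  exact this hX

theorem exists_emb_natAdd_eq {j m : ℕ} {X : TMat N (j + (m + 1)) ℂ}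
    (hX : X ∈ gen (fun i => leg (j + (m + 1)) i R) j (j + m)) :
    ∃ Y ∈ braidImage R (m + 1), emb (Fin.natAdd j) Y = X := by
  have : gen (fun i => leg (j + (m + 1)) i R) j (j + m) ≤
      (braidImage R (m + 1)).map (embHom N ℂ (Fin.natAdd_injective (m + 1) j)) := by
    refine Algebra.adjoin_le ?_
    rintro _ ⟨i, hi, hi', rfl⟩
    obtain ⟨l, rfl⟩ := Nat.exists_eq_add_of_le hi
    exact ⟨leg (m + 1) l R, leg_mem_braidImage R (by omega), emb_natAdd_leg (by omega) R⟩
  exact this hX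

/-- `ch` modulo a subalgebra of the quantum matrix algebra. -/
def chMod (T : Subalgebra ℂ (QMAlgebra R F)) (n : ℕ) :
    TMat N n ℂ →ₗ[ℂ] QMAlgebra R F ⧸ Subalgebra.toSubmodule T :=
  (Subalgebra.toSubmodule T).mkQ ∘ₗ chOp R F (genMatrix R F) n

theorem chMod_eq_zero {T : Subalgebra ℂ (QMAlgebra R F)} {n : ℕ} {X : TMat N n ℂ} :
    chMod T n X = 0 ↔ chOp R F (genMatrix R F) n X ∈ T := by
  rw [chMod, LinearMap.comp_apply, Submodule.mkQ_apply, Submodule.Quotient.mk_eq_zero]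
  rfl

/-- A subalgebra `T` that contains `ch(κ₁)` contains all `ch(α)`, provided that the values of `ch` at
the products of all generators can be shown to lie in `T` by means of the trace property and the
multiplicativity of `ch`. -/
theorem chOp_mem_of_forall_word (hR : IsRMatrix R) (hF : IsRMatrix F) (hRF : IsCompatible R F)
    (hs : IsSkewInvertible R) (hB : IsBMWType R q μ) (T : Subalgebra ℂ (QMAlgebra R F))
    (hT : chOp R F (genMatrix R F) 2 (kappa q μ (leg 2 0 R)) ∈ T)
    (hword : ∀ n, IsSplitTrace (fun i => leg (n + 1) i R) n (chMod T (n + 1)) →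
      (n = 1 → chMod T (n + 1) (kappa q μ (leg (n + 1) 0 R)) = 0) →
      chMod T (n + 1) (word (fun i => leg (n + 1) i R) 0 n) = 0) (n : ℕ) :
    ∀ X ∈ braidImage R (n + 1), chOp R F (genMatrix R F) (n + 1) X ∈ T := by
  induction n using Nat.strong_induction_on with
  | _ n ih =>
    have hk : n = 1 → chMod T (n + 1) (kappa q μ (leg (n + 1) 0 R)) = 0 := by
      rintro rfl
      exact chMod_eq_zero.2 hT
    have hτ : IsSplitTrace (fun i => leg (n + 1) i R) n (chMod T (n + 1)) := by
      constructor
      · intro x hx y _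
        rw [← braidImage_succ] at hx
        rw [chMod, LinearMap.comp_apply, LinearMap.comp_apply, chOp_mul_comm _ hR hF hs
          hRF.transportedBy (commute_leg_copy_genMatrix R F) y hx]
      · intro j hj x hx y hy
        obtain ⟨m, rfl⟩ : ∃ m, n = j + 1 + m := ⟨n - (j + 1), by omega⟩
        obtain ⟨x', hx', rfl⟩ := exists_emb_castAdd_eq (m := m + 1) hx
        obtain ⟨y', hy', rfl⟩ := exists_emb_natAdd_eq (j := j + 1) hy
        have := chOp_mul_chOp hF hs hRF.transportedBy (genMatrix R F) x' hy'
        refine chMod_eq_zero.2 ?_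
        have e : chOp R F (genMatrix R F) (j + 1 + m + 1)
          (emb (Fin.castAdd (m + 1)) x' * emb (Fin.natAdd (j + 1)) y') = _ := this.symm
        rw [e]
        exact mul_mem (ih j (by omega) _ hx') (ih m (by omega) _ hy')
    intro X hX
    rw [braidImage_succ] at hX
    have := hτ.map_mem_span (hB.isBMWGens hR n) hk hX
    rw [hword n hτ hk, Submodule.span_zero_singleton, Submodule.mem_bot] at this
    exact chMod_eq_zero.1 this

/-- Products of R-traces are R-traces, so the characteristic subspace is closed under
multiplication. -/
theorem charSubspace_mul_mem (hR : IsRMatrix R) (hF : IsRMatrix F) (hRF : IsCompatible R F)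
    (hs : IsSkewInvertible R) (hB : IsBMWType R q μ) {x y : QMAlgebra R F}
    (hx : x ∈ charSubspace hR F) (hy : y ∈ charSubspace hR F) : x * y ∈ charSubspace hR F := by
  have := Submodule.mul_mem_mul hx hy
  rw [charSubspace, Submodule.span_mul_span] at this
  refine Submodule.span_le.2 ?_ this
  rintro _ ⟨x, hx, y, hy, rfl⟩
  rcases hx with rfl | ⟨n, hn, α, rfl⟩
  · simp only [one_mul]
    exact Submodule.subset_span hy
  rcases hy with rfl | ⟨m, hm, β, rfl⟩
  · simp only [mul_one]
    exact Submodule.subset_span (Or.inr ⟨n, hn, α, rfl⟩)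
  have hα := rho_mem_braidImage hR hB n α
  have hβ := rho_mem_braidImage hR hB m β
  obtain ⟨γ, hγ⟩ := exists_rho_eq hR (mul_mem (emb_castAdd_mem (m := m) hα)
    (emb_natAdd_mem (n := n) hβ))
  refine Submodule.subset_span (Or.inr ⟨n + m, by omega, γ, ?_⟩)
  simp only [ch_eq_chOp, hγ]
  exact chOp_mul_chOp hF hs hRF.transportedBy _ _ hβ

/-- The characteristic subspace is the subalgebra generated by some elements of it, if, for each `n`,
this subalgebra contains the value of `ch` at the product of all generators as soon as `ch` is a
split trace modulo it. -/
theorem charSubspace_eq_adjoin (hR : IsRMatrix R) (hF : IsRMatrix F) (hRF : IsCompatible R F)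
    (hs : IsSkewInvertible R) (hB : IsBMWType R q μ) (S : Set (QMAlgebra R F))
    (hg : contraction hR F q μ ∈ S) (hS : S ⊆ charSubspace hR F)
    (hword : ∀ n, IsSplitTrace (fun i => leg (n + 1) i R) n (chMod (Algebra.adjoin ℂ S) (n + 1)) →
      (n = 1 → chMod (Algebra.adjoin ℂ S) (n + 1) (kappa q μ (leg (n + 1) 0 R)) = 0) →
      chMod (Algebra.adjoin ℂ S) (n + 1) (word (fun i => leg (n + 1) i R) 0 n) = 0) :
    charSubspace hR F = Subalgebra.toSubmodule (Algebra.adjoin ℂ S) := by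
  have one : (1 : QMAlgebra R F) ∈ charSubspace hR F := Submodule.subset_span (Or.inl rfl)
  apply le_antisymm
  · have hT : chOp R F (genMatrix R F) 2 (kappa q μ (leg 2 0 R)) ∈ Algebra.adjoin ℂ S := by
      have h1 := Subalgebra.smul_mem _ (Algebra.subset_adjoin (R := ℂ) hg) (eta q μ)
      rwa [contraction, ch_eq_chOp, contractor2, map_smul, map_smul, smul_smul,
        mul_inv_cancel₀ hB.eta_ne, one_smul, map_kappa, rho_sigma hR (by omega)] at h1
    refine Submodule.span_le.2 ?_
    rintro _ (rfl | ⟨n, hn, α, rfl⟩)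
    · exact one_mem (Algebra.adjoin ℂ S)
    · obtain ⟨n, rfl⟩ : ∃ m, n = m + 1 := ⟨n - 1, by omega⟩
      exact chOp_mem_of_forall_word hR hF hRF hs hB _ hT hword n _
        (rho_mem_braidImage hR hB (n + 1) α)
  · intro x hx
    rw [Subalgebra.mem_toSubmodule] at hx
    induction hx using Algebra.adjoin_induction with
    | mem x hx => exact hS hx
    | algebraMap c =>
      rw [Algebra.algebraMap_eq_smul_one]
      exact Submodule.smul_mem _ c one
    | add x y _ _ hx hy => exact add_mem hx hy
    | mul x y _ _ hx hy => exact charSubspace_mul_mem hR hF hRF hs hB hx hy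

theorem ch_mem_charSubspace (hR : IsRMatrix R) (F : TMat N 2 ℂ) {n : ℕ} (hn : 1 ≤ n)
    (α : BraidAlg n) : ch hR F n α ∈ charSubspace hR F :=
  Submodule.subset_span (Or.inr ⟨n, hn, α, rfl⟩)

theorem elemA_mem_charSubspace (hR : IsRMatrix R) (F : TMat N 2 ℂ) (i : ℕ) :
    elemA hR F q μ i ∈ charSubspace hR F := by
  cases i with
  | zero => exact Submodule.subset_span (Or.inl rfl)
  | succ i => exact ch_mem_charSubspace hR F (by omega) _

theorem elemS_mem_charSubspace (hR : IsRMatrix R) (F : TMat N 2 ℂ) (i : ℕ) :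
    elemS hR F q μ i ∈ charSubspace hR F := by
  cases i with
  | zero => exact Submodule.subset_span (Or.inl rfl)
  | succ i => exact ch_mem_charSubspace hR F (by omega) _

/-- If `a_{n+1}` lies in a subalgebra modulo which `ch` is a split trace, then so does `ch` of the
product of the first `n` generators. -/
theorem chMod_word_eq_zero_of_elemA (hR : IsRMatrix R) (hB : IsBMWType R q μ)
    {T : Subalgebra ℂ (QMAlgebra R F)} {n : ℕ}
    (hτ : IsSplitTrace (fun i => leg (n + 1) i R) n (chMod T (n + 1)))
    (hk : n = 1 → chMod T (n + 1) (kappa q μ (leg (n + 1) 0 R)) = 0)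
    (hq : ∀ j, 2 ≤ j → j ≤ n + 1 → qNum q j ≠ 0) (hT : elemA hR F q μ (n + 1) ∈ T) :
    chMod T (n + 1) (word (fun i => leg (n + 1) i R) 0 n) = 0 := by
  obtain ⟨c, hc, e⟩ := hτ.exists_map_antisymmetrizer (hB.isBMWGens hR n) hk hq
  rw [elemA, ch_eq_chOp, rho_antisymmetrizer] at hT
  rw [chMod_eq_zero.2 hT] at e
  exact (smul_eq_zero.1 e.symm).resolve_left hc

theorem chMod_word_eq_zero_of_elemS (hR : IsRMatrix R) (hB : IsBMWType R q μ)
    {T : Subalgebra ℂ (QMAlgebra R F)} {n : ℕ}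
    (hτ : IsSplitTrace (fun i => leg (n + 1) i R) n (chMod T (n + 1)))
    (hk : n = 1 → chMod T (n + 1) (kappa q μ (leg (n + 1) 0 R)) = 0)
    (hq : ∀ j, 2 ≤ j → j ≤ n + 1 → qNum q j ≠ 0) (hT : elemS hR F q μ (n + 1) ∈ T) :
    chMod T (n + 1) (word (fun i => leg (n + 1) i R) 0 n) = 0 := by
  obtain ⟨c, hc, e⟩ := hτ.exists_map_symmetrizer (hB.isBMWGens hR n) hk hq
  rw [elemS, ch_eq_chOp, rho_symmetrizer] at hT
  rw [chMod_eq_zero.2 hT] at e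
  exact (smul_eq_zero.1 e.symm).resolve_left hc

/-- For an R-matrix of height `k`, products of at least `k` generators need no new elements of the
subalgebra: the element that is required to vanish is, up to its normalization, the image of the
next antisymmetrizer, moved to the last strands. -/
theorem chMod_word_eq_zero_of_height (hR : IsRMatrix R) (hB : IsBMWType R q μ)
    {T : Subalgebra ℂ (QMAlgebra R F)} {k n : ℕ} (hh : HasHeight hR q μ k) (hkn : k ≤ n)
    (hτ : IsSplitTrace (fun i => leg (n + 1) i R) n (chMod T (n + 1)))
    (hk : n = 1 → chMod T (n + 1) (kappa q μ (leg (n + 1) 0 R)) = 0) :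
    chMod T (n + 1) (word (fun i => leg (n + 1) i R) 0 n) = 0 := by
  have h2 := hh.two_le
  obtain ⟨k, rfl⟩ : ∃ l, k = l + 1 := ⟨k - 1, by omega⟩
  obtain ⟨m, rfl⟩ : ∃ m, n = m + (k + 1) := ⟨n - (k + 1), by omega⟩
  refine hτ.map_word_eq_zero_of_bmw (hB.isBMWGens hR _) hk (m := m) (k := k) rfl
    hh.qNum_ne_zero ?_
  let φ := embHom N ℂ (Fin.natAdd_injective (k + 1 + 1) m)
  have hφ : ∀ i, i + 1 < k + 1 + 1 → (φ.comp (rho hR (k + 1 + 1))) (sigma (k + 1 + 1) i) =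
      leg (m + (k + 1) + 1) (m + i) R := fun i hi => by
    rw [AlgHom.comp_apply, rho_sigma hR hi]
    exact emb_natAdd_leg hi R
  have h0 : (φ.comp (rho hR (k + 1 + 1))) _ = _ := congrArg φ hh.eq_zero
  rw [map_zero, map_mul, map_mul, map_baxterized, hφ 0 (by omega),
    map_antisymmetrizer _ (t := fun i => leg (m + (k + 1) + 1) (m + 1 + i) R) (fun i hi => by
      rw [hφ (i + 1) (by omega)]; congr 1; omega)] at h0
  exact h0

end BMWType

end

end QMat

theorem proposition4p8 {N : ℕ} (R F : QMat.TMat N 2 ℂ)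
    (hR : QMat.IsRMatrix R) (hF : QMat.IsRMatrix F) (hRF : QMat.IsCompatible R F)
    (hRs : QMat.IsStrictSkewInvertible R) (hFs : QMat.IsStrictSkewInvertible F)
    (q μ : ℂ) (hB : QMat.IsBMWType R q μ) :
    ((∀ j : ℕ, 2 ≤ j → QMat.qNum q j ≠ 0 ∧ μ ≠ -q ^ (-2 * (j : ℤ) + 3)) →
      QMat.charSubspace hR F = Subalgebra.toSubmodule (Algebra.adjoin ℂ
        ({QMat.contraction hR F q μ} ∪ {x | ∃ i : ℕ, x = QMat.elemA hR F q μ i}))) ∧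
    ((∀ j : ℕ, 2 ≤ j → QMat.qNum q j ≠ 0 ∧ μ ≠ q ^ (2 * (j : ℤ) - 3)) →
      QMat.charSubspace hR F = Subalgebra.toSubmodule (Algebra.adjoin ℂ
        ({QMat.contraction hR F q μ} ∪ {x | ∃ i : ℕ, x = QMat.elemS hR F q μ i}))) ∧
    (∀ k : ℕ, (QMat.IsSpType hR q μ k ∨ QMat.IsOType hR q μ k) →
      QMat.charSubspace hR F = Subalgebra.toSubmodule (Algebra.adjoin ℂ
        ({QMat.contraction hR F q μ} ∪ {x | ∃ i : ℕ, i ≤ k ∧ x = QMat.elemA hR F q μ i}))) := by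
  have hg : QMat.contraction hR F q μ ∈ QMat.charSubspace hR F :=
    QMat.ch_mem_charSubspace hR F (by omega) _
  refine ⟨fun h => ?_, fun h => ?_, fun k hk => ?_⟩
  · refine QMat.charSubspace_eq_adjoin hR hF hRF hRs.1 hB _ (Or.inl rfl) ?_ fun n hτ hk => ?_
    · rintro _ (rfl | ⟨i, rfl⟩)
      exacts [hg, QMat.elemA_mem_charSubspace hR F i]
    · exact QMat.chMod_word_eq_zero_of_elemA hR hB hτ hk (fun j hj _ => (h j hj).1)
        (Algebra.subset_adjoin (Or.inr ⟨n + 1, rfl⟩))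
  · refine QMat.charSubspace_eq_adjoin hR hF hRF hRs.1 hB _ (Or.inl rfl) ?_ fun n hτ hk => ?_
    · rintro _ (rfl | ⟨i, rfl⟩)
      exacts [hg, QMat.elemS_mem_charSubspace hR F i]
    · exact QMat.chMod_word_eq_zero_of_elemS hR hB hτ hk (fun j hj _ => (h j hj).1)
        (Algebra.subset_adjoin (Or.inr ⟨n + 1, rfl⟩))
  · have hh : QMat.HasHeight hR q μ k := hk.elim (fun h => h.height) fun h => h.height
    refine QMat.charSubspace_eq_adjoin hR hF hRF hRs.1 hB _ (Or.inl rfl) ?_ fun n hτ hk' => ?_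
    · rintro _ (rfl | ⟨i, -, rfl⟩)
      exacts [hg, QMat.elemA_mem_charSubspace hR F i]
    · rcases Nat.lt_or_ge n k with hn | hn
      · exact QMat.chMod_word_eq_zero_of_elemA hR hB hτ hk'
          (fun j hj hj' => hh.qNum_ne_zero j hj (by omega))
          (Algebra.subset_adjoin (Or.inr ⟨n + 1, hn, rfl⟩))
      · exact QMat.chMod_word_eq_zero_of_height hR hB hh hn hτ hk'
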